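/- **System.** A base station serves finitely many real-time (RT) users $i\in\mathcal N_R$ and at least one, finitely many, non-real-time (NRT) users $i\in\mathcal N_{NR}$; $\mathcal N=\mathcal N_R\cup\mathcal N_{NR}$. Slots have duration $T_s>0$, packets have length $L>0$, the peak power is $P_{\max}>0$ and the average power bound is $P_{avg}>0$. RT user $i$ has an arrival rate $\lambda_i\in[0,1]$ and a required delivery ratio $q_i\in[0,1]$. Channel gains take values in a finite set $\mathcal M\subset[0,\infty)$, and $\pi$ is a probability distribution on the fading states $m=(\gamma_i)_{i\in\mathcal N}\in\mathcal M^{\mathcal N}$. In slot $k=0,1,2,\dots$ there are arrival indicators $a_i(k)\in\{0,1\}$, $i\in\mathcal N$, and a fading state $\gamma(k)$. With respect to a filtration $(\mathcal F_k)$, the pair $(a(k),\gamma(k))$ is $\mathcal F_{k+1}$-measurable and independent of $\mathcal F_k$, with $\Pr(a_i(k)=1)=\lambda_i$ and $\Pr(\gamma(k)=m)=\pi_m$. Dependence within one slot is allowed; thus an RT user without a packet may be modelled as having gain $0$ in that slot. **Allocations.** An allocation for state $m$ is a pair of vectors $(\mu_i)_{i\in\mathcal N},(P_i)_{i\in\mathcal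 N}$ with $\mu_i\ge0$, $\sum_i\mu_i\le T_s$, $0\le P_i\le P_{\max}$, and, with $R_i=\log(1+P_i\gamma_i)$, for each RT user either $\mu_i=0$ or $\mu_iR_i=L$ (whole packets). A policy chooses random, measurable $\mu(k),P(k)$ for each slot; it is causal if $\mu(k),P(k)$ are $\mathcal F_{k+1}$-measurable for every $k$. All NRT arrivals are admitted: $Q_i(0)=0$, $Q_i(k+1)=(Q_i(k)+La_i(k)-\mu_i(k)R_i(k))^+$, $i\in\mathcal N_{NR}$. A policy *meets all constraints* if in every slot it uses an allocation for $\gamma(k)$ with $\sum_i\mu_i(k)=T_s$ and $$\limsup_k\mathbb E[Q_i(k)]<\infty\ (i\in\mathcal N_{NR}),\quad \liminf_K\frac1{LK}\sum_{k<K}\mu_i(k)R_i(k)\ge q_i\lambda_i\ \text{a.s.}\ (i\in\mathcal N_R),\quad \limsup_K\frac1{KT_s}\sum_{k<K}\sum_{i\in\mathcal N}P_i(k)\mu_i(k)\le P_{avg}\ \text{a.s.}$$ A vector $\lambda=(\lambda_i)_{i\in\mathcal N_{NR}}$ is *admissible* if, for some arrivals and fading states as above with these NRT rates, some causal policy meets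 all constraints. **Lambert region.** $\mathcal R$ is the set of $\lambda\in\mathbb R^{\mathcal N_{NR}}$ for which there are deterministic allocations $(\mu(k,m),P(k,m))$ for state $m$, $k\ge0$, $m\in\mathcal M^{\mathcal N}$, such that, with $D_i(k)=\frac1L\sum_m\pi_m\,\mu_i(k,m)\log(1+P_i(k,m)\gamma_i(m))$, where $\gamma_i(m)$ is the gain of user $i$ in state $m$, $$\lim_K\frac1K\sum_{k<K}D_i(k)=\lambda_i\ (i\in\mathcal N_{NR}),\quad \liminf_K\frac1K\sum_{k<K}D_i(k)\ge q_i\lambda_i\ (i\in\mathcal N_R),\quad \limsup_K\frac1{KT_s}\sum_{k<K}\sum_m\pi_m\sum_{i\in\mathcal N}\mu_i(k,m)P_i(k,m)\le P_{avg}.$$ **Lambert-Strict algorithm, all arrivals admitted.** Keep virtual queues $Y_i(0)=X(0)=0$, $Y_i(k+1)=(Y_i(k)+a_i(k)q_i-\mathbf 1[\mu_i(k)\ne0])^+$ for $i\in\mathcal N_R$, and $X(k+1)=(X(k)+\frac1{T_s}\sum_{i\in\mathcal N} P_i(k)\mu_i(k)-P_{avg})^+$. In each slot (dropping $k$): 1.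 For NRT users put $P_i=\min((T_sQ_i/X-1/\gamma_i)^+,P_{\max})$ (read as $0$ if $\gamma_i=0$; and if $X=0<\gamma_i$, as $P_{\max}$ when $Q_i>0$ and $0$ when $Q_i=0$) and $\Psi_i=Q_i\log(1+P_i\gamma_i)-XP_i/T_s$. Select an NRT user $i^*$ maximizing $\Psi_i$. 2. Consider every set $A\subseteq\mathcal N_R$, except those for which there are $i\in\mathcal N_R\setminus A$, $j\in A$ with $Y_i>Y_j$, $\gamma_i>\gamma_j$. For $i\in A$ put $P_i=\min\big(\frac1{\gamma_i}\big[\frac{\tilde\phi\gamma_i-1}{W_0(e^{-1}(\tilde\phi\gamma_i-1))}-1\big],P_{\max}\big)$ with $\tilde\phi=(\Psi_{i^*}+\phi)T_s/X$ (the quotient with $W_0$ is read as $e$ if $\tilde\phi\gamma_i=1$; $P_i=P_{\max}$ if $X=0$), where $W_0$ is the principal branch of the Lambert $W$ function; let $\mu_i$ be such that $\mu_i\log(1+P_i\gamma_i)=L$, and $\mu_{i^*}=T_s-\sum_{i\in A}\mu_i$; here $\phi\ge0$ is such that $\mu_{i^*}\ge0$ and $\phi\mu_{i^*}=0$ (sets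 $A$ for which this is impossible are discarded). 3. Among the remaining sets use one that maximizes $\sum_{i\in A}(Y_i-XP_i\mu_i/T_s)+\Psi_{i^*}\mu_{i^*}$; all users outside $A\cup\{i^*\}$ get $\mu_i=P_i=0$. Ties are broken in an arbitrary causal way. **Theorem.** Let arrivals and fading states as above, with NRT rates $\lambda$, be given. (a) There is a causal policy generated by the Lambert-Strict algorithm. If $(1+\epsilon)\lambda\in\mathcal R$ for some $\epsilon>0$, every such policy meets all constraints; in particular it stabilizes the NRT queues. (b) If $\lambda\notin\mathcal R$, no policy, not even one that knows the future, meets all constraints. (c) Consequently $\mathcal R$ is the capacity region: the closure of the set of admissible vectors $\lambda$ is $\mathcal R\cap[0,1]^{\mathcal N_{NR}}$ (rates of arrival indicators lie in $[0,1]$). -/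

import Mathlib

open MeasureTheory ProbabilityTheory Filter Topology

noncomputable section

namespace Downlink

/-- The users: `Sum.inl i` is a real-time (RT) user, `Sum.inr i` a non-real-time (NRT) user. -/
abbrev User (nR nN : ℕ) : Type := Fin nR ⊕ Fin nN

/-- The fixed data of the downlink system, everything except the NRT arrival rates. A fading state
assigns to every user one of the finitely many possible gains. -/
structure System (nR nN : ℕ) where
  /-- slot duration -/
  Ts : ℝ
  /-- packet length -/
  L : ℝ
  /-- peak power -/
  Pmax : ℝ
  /-- bound on the average power -/
  Pavg : ℝ
  /-- required delivery ratios of the RT users -/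
  q : Fin nR → ℝ
  /-- arrival rates of the RT users, in packets per slot -/
  rateR : Fin nR → ℝ
  /-- the finite set of possible channel gains -/
  gains : Finset ℝ
  /-- probabilities of the fading states -/
  prob : (User nR nN → gains) → ℝ
  Ts_pos : 0 < Ts
  L_pos : 0 < L
  Pmax_pos : 0 < Pmax
  Pavg_pos : 0 < Pavg
  q_mem : ∀ i, q i ∈ Set.Icc (0 : ℝ) 1
  rateR_mem : ∀ i, rateR i ∈ Set.Icc (0 : ℝ) 1
  gains_nonneg : ∀ g ∈ gains, 0 ≤ g
  prob_nonneg : ∀ m, 0 ≤ prob m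
  prob_sum : ∑ m, prob m = 1

/-- Transmission rate with power `p` over a channel with gain `g`. -/
def rate (p g : ℝ) : ℝ := Real.log (1 + p * g)

namespace System

variable {nR nN : ℕ} (S : System nR nN)

/-- Fading states. -/
abbrev State : Type := User nR nN → S.gains

/-- The restrictions on the durations `μ` and powers `P` of one slot with fading state `m`. An RT
user is either not scheduled or is given exactly the time that transmits its whole packet. -/
structure IsSlotAllocation (m : S.State) (μ P : User nR nN → ℝ) : Prop where
  time_nonneg : ∀ i, 0 ≤ μ i
  time_sum : ∑ i, μ i ≤ S.Ts
  power_nonneg : ∀ i, 0 ≤ P i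
  power_le : ∀ i, P i ≤ S.Pmax
  whole_packet : ∀ i : Fin nR,
    μ (Sum.inl i) = 0 ∨ μ (Sum.inl i) * rate (P (Sum.inl i)) (m (Sum.inl i)) = S.L

/-- Packets per slot delivered to user `i` by the state-dependent allocation `(μ, P)`, averaged over
the fading states. -/
def meanService (μ P : S.State → User nR nN → ℝ) (i : User nR nN) : ℝ :=
  (∑ m, μ m i * rate (P m i) (m i) * S.prob m) / S.L

/-- Transmission power of the state-dependent allocation `(μ, P)`, averaged over the slot and over
the fading states. -/
def meanPower (μ P : S.State → User nR nN → ℝ) : ℝ :=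
  (∑ m, (∑ i, μ m i * P m i) * S.prob m) / S.Ts

/-- The Lambert region, a set of NRT arrival rate vectors. -/
def lambertRegion : Set (Fin nN → ℝ) :=
  {lam | ∃ μ P : ℕ → S.State → User nR nN → ℝ,
    (∀ k m, S.IsSlotAllocation m (μ k m) (P k m)) ∧
    (∀ i : Fin nN, Tendsto
      (fun K : ℕ => (∑ k ∈ Finset.range K, S.meanService (μ k) (P k) (Sum.inr i)) / K)
      atTop (𝓝 (lam i))) ∧
    (∀ i : Fin nR, S.q i * S.rateR i ≤ liminf
      (fun K : ℕ => (∑ k ∈ Finset.range K, S.meanService (μ k) (P k) (Sum.inl i)) / K) atTop) ∧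
    limsup (fun K : ℕ => (∑ k ∈ Finset.range K, S.meanPower (μ k) (P k)) / K) atTop ≤ S.Pavg}

/-! ### Queues along one sample path, initially empty -/

/-- Queue of NRT user `i`, in bits, when all arrivals are admitted. -/
def queue (a : ℕ → User nR nN → ℝ) (g : ℕ → S.State) (μ P : ℕ → User nR nN → ℝ) (i : Fin nN) :
    ℕ → ℝ
  | 0 => 0
  | k + 1 => max (queue a g μ P i k + S.L * a k (Sum.inr i)
      - μ k (Sum.inr i) * rate (P k (Sum.inr i)) (g k (Sum.inr i))) 0

open Classical in
/-- Virtual queue of the delivery ratio constraint of RT user `i`. -/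
def deliveryQueue (a : ℕ → User nR nN → ℝ) (μ : ℕ → User nR nN → ℝ) (i : Fin nR) : ℕ → ℝ
  | 0 => 0
  | k + 1 => max (deliveryQueue a μ i k + a k (Sum.inl i) * S.q i
      - (if μ k (Sum.inl i) = 0 then 0 else 1)) 0

/-- Virtual queue of the average power constraint. -/
def powerQueue (μ P : ℕ → User nR nN → ℝ) : ℕ → ℝ
  | 0 => 0
  | k + 1 => max (powerQueue μ P k + (∑ i, P k i * μ k i) / S.Ts - S.Pavg) 0

/-! ### The Lambert-Strict algorithm -/

/-- Water-filling power of an NRT user with queue `Q` and gain `g`. At `X = 0` and at `g = 0` this is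
the limit of the formula of the last line. -/
def waterFilling (X Q g : ℝ) : ℝ :=
  open Classical in
  if g = 0 then 0
  else if X = 0 then (if Q = 0 then 0 else S.Pmax)
  else min (max (S.Ts * Q / X - 1 / g) 0) S.Pmax

/-- The weight of an NRT user, per second of transmission with the water-filling power. -/
def psiN (X Q g : ℝ) : ℝ :=
  Q * rate (S.waterFilling X Q g) g - X * S.waterFilling X Q g / S.Ts

/-- Principal branch of the Lambert W function: for `z ≥ -1/e`, the `w ≥ -1` with `w * exp w = z`. -/
def lambertW0 (z : ℝ) : ℝ :=
  Function.invFunOn (fun w : ℝ => w * Real.exp w) (Set.Ici (-1)) z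

/-- `z / W₀(z / e)`, continuously extended to `z = 0`. -/
def lambertRatio (z : ℝ) : ℝ :=
  open Classical in
  if z = 0 then Real.exp 1 else z / lambertW0 (z / Real.exp 1)

/-- Lambert power of a scheduled RT user with gain `g`, where `ψ` is the weight of the selected NRT
user and `φ` the multiplier. At `X = 0` the argument `(ψ + φ) * Ts / X` is read as infinite. -/
def lambertPower (X ψ φ g : ℝ) : ℝ :=
  open Classical in
  if X = 0 then S.Pmax
  else min (1 / g * (lambertRatio ((ψ + φ) * S.Ts / X * g - 1) - 1)) S.Pmax

/-- The set `A` of RT users is not skipped by the algorithm, and its loop assigns to the RT users the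
powers `p` and the durations `t`, and to the selected NRT user the remaining time `tN`. -/
structure IsCandidate (X ψ : ℝ) (Y g : Fin nR → ℝ) (A : Finset (Fin nR)) (p t : Fin nR → ℝ)
    (tN : ℝ) : Prop where
  not_skipped : ¬ ∃ i, i ∉ A ∧ ∃ j, j ∈ A ∧ Y j < Y i ∧ g j < g i
  power : ∃ φ : ℝ, 0 ≤ φ ∧ φ * tN = 0 ∧ ∀ i ∈ A, p i = S.lambertPower X ψ φ (g i)
  packet : ∀ i ∈ A, t i * rate (p i) (g i) = S.L
  unscheduled : ∀ i, i ∉ A → p i = 0 ∧ t i = 0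
  remaining : tN = S.Ts - ∑ i, t i
  remaining_nonneg : 0 ≤ tN

/-- The value by which the algorithm compares the candidate sets. -/
def candidateValue (X ψ : ℝ) (Y : Fin nR → ℝ) (A : Finset (Fin nR)) (p t : Fin nR → ℝ) (tN : ℝ) :
    ℝ :=
  ∑ i ∈ A, (Y i - X * p i * t i / S.Ts) + ψ * tN

/-- `(μ, P)` is an output of the algorithm, for some way of breaking ties, in a slot with queues `Q`,
virtual queues `Y`, `X`, and fading state `m`. -/
def IsLambertStrict (Q : Fin nN → ℝ) (Y : Fin nR → ℝ) (X : ℝ) (m : S.State)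
    (μ P : User nR nN → ℝ) : Prop :=
  ∃ j : Fin nN,
    (∀ i, S.psiN X (Q i) (m (Sum.inr i)) ≤ S.psiN X (Q j) (m (Sum.inr j))) ∧
    P (Sum.inr j) = S.waterFilling X (Q j) (m (Sum.inr j)) ∧
    (∀ i, i ≠ j → P (Sum.inr i) = 0 ∧ μ (Sum.inr i) = 0) ∧
    ∃ A : Finset (Fin nR),
      S.IsCandidate X (S.psiN X (Q j) (m (Sum.inr j))) Y (fun i => m (Sum.inl i)) A
        (fun i => P (Sum.inl i)) (fun i => μ (Sum.inl i)) (μ (Sum.inr j)) ∧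
      ∀ A' p t tN,
        S.IsCandidate X (S.psiN X (Q j) (m (Sum.inr j))) Y (fun i => m (Sum.inl i)) A' p t tN →
        S.candidateValue X (S.psiN X (Q j) (m (Sum.inr j))) Y A' p t tN ≤
          S.candidateValue X (S.psiN X (Q j) (m (Sum.inr j))) Y A
            (fun i => P (Sum.inl i)) (fun i => μ (Sum.inl i)) (μ (Sum.inr j))

/-! ### The stochastic system -/

section Stochastic

variable {Ω : Type*} {mΩ : MeasurableSpace Ω}

/-- Arrivals `a` (indicators) and fading states `γ` of the slots, for NRT arrival rates `lam`. In
every slot they are independent of the past `ℱ k`, and hence independent over time. Within one slot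
no independence is required. -/
structure IsEnvironment (lam : Fin nN → ℝ) (Pr : Measure Ω) (ℱ : Filtration ℕ mΩ)
    (a : ℕ → Ω → User nR nN → ℝ) (γ : ℕ → Ω → S.State) : Prop where
  arrival : ∀ k ω i, a k ω i = 0 ∨ a k ω i = 1
  meas : ∀ k, Measurable[ℱ (k + 1)] (fun ω => (a k ω, γ k ω))
  indep : ∀ k, Indep (MeasurableSpace.comap (fun ω => (a k ω, γ k ω)) inferInstance) (ℱ k) Pr
  rate_RT : ∀ k i, Pr.real {ω | a k ω (Sum.inl i) = 1} = S.rateR i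
  rate_NRT : ∀ k i, Pr.real {ω | a k ω (Sum.inr i) = 1} = lam i
  state : ∀ k m, Pr.real {ω | γ k ω = m} = S.prob m

/-- A policy that does not anticipate the future: the decisions of slot `k` may depend on the past,
on the arrivals and gains of slot `k`, and on private randomization. -/
def IsCausal (ℱ : Filtration ℕ mΩ) (μ P : ℕ → Ω → User nR nN → ℝ) : Prop :=
  ∀ k, Measurable[ℱ (k + 1)] (μ k) ∧ Measurable[ℱ (k + 1)] (P k)

/-- The policy `(μ, P)` is generated by the Lambert-Strict algorithm with all arrivals admitted. -/
def FollowsLambertStrict (a : ℕ → Ω → User nR nN → ℝ) (γ : ℕ → Ω → S.State)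
    (μ P : ℕ → Ω → User nR nN → ℝ) : Prop :=
  ∀ k ω, S.IsLambertStrict
    (fun i => S.queue (fun l => a l ω) (fun l => γ l ω) (fun l => μ l ω) (fun l => P l ω) i k)
    (fun i => S.deliveryQueue (fun l => a l ω) (fun l => μ l ω) i k)
    (S.powerQueue (fun l => μ l ω) (fun l => P l ω) k)
    (γ k ω) (μ k ω) (P k ω)

/-- With all arrivals admitted, the policy `(μ, P)` stabilizes the NRT queues and meets the delivery
ratio, average power, peak power and time constraints. -/
structure MeetsConstraints (Pr : Measure Ω) (a : ℕ → Ω → User nR nN → ℝ) (γ : ℕ → Ω → S.State)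
    (μ P : ℕ → Ω → User nR nN → ℝ) : Prop where
  allocation : ∀ k ω, S.IsSlotAllocation (γ k ω) (μ k ω) (P k ω)
  full_slot : ∀ k ω, ∑ i, μ k ω i = S.Ts
  stable : ∀ i : Fin nN, limsup (fun k : ℕ => ∫⁻ ω, ENNReal.ofReal
    (S.queue (fun l => a l ω) (fun l => γ l ω) (fun l => μ l ω) (fun l => P l ω) i k) ∂Pr) atTop < ⊤
  delivery : ∀ i : Fin nR, ∀ᵐ ω ∂Pr, S.q i * S.rateR i ≤ liminf (fun K : ℕ =>
    (∑ k ∈ Finset.range K, μ k ω (Sum.inl i) * rate (P k ω (Sum.inl i)) (γ k ω (Sum.inl i)))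
      / (S.L * K)) atTop
  avg_power : ∀ᵐ ω ∂Pr, limsup (fun K : ℕ =>
    (∑ k ∈ Finset.range K, ∑ i, P k ω i * μ k ω i) / (K * S.Ts)) atTop ≤ S.Pavg

end Stochastic

/-- `lam` is admissible: for arrivals with these NRT rates, some causal policy meets all
constraints. -/
def IsAdmissible (lam : Fin nN → ℝ) : Prop :=
  ∃ (Ω : Type) (mΩ : MeasurableSpace Ω) (Pr : Measure Ω) (ℱ : Filtration ℕ mΩ)
    (a : ℕ → Ω → User nR nN → ℝ) (γ : ℕ → Ω → S.State) (μ P : ℕ → Ω → User nR nN → ℝ),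
    IsProbabilityMeasure Pr ∧ S.IsEnvironment lam Pr ℱ a γ ∧ IsCausal ℱ μ P ∧
    S.MeetsConstraints Pr a γ μ P

end System

end Downlink

end

/-!
Collect the backlog of the power budget, of the RT deliveries and of the NRT users in one vector
`v`, and the power used (with a minus sign), the packets delivered and the bits sent in one slot in
an outcome vector `o`. Strict concavity of the rate and the Lambert form of the optimal RT power
show that Lambert-Strict picks in every slot an outcome that maximizes `⟪v, o⟫` over all
allocations: it is a max-weight policy.

Let `h v` be the mean over the fading states of the maximum of `⟪v, o⟫`, and let `b` be the vector
of required means. The region is cut out by the inequalities `⟪v, b⟫ ≤ h v` for `v ≥ 0`. The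
converse follows from the law of large numbers, since stable queues are, almost surely and for
infinitely many `K`, small compared to `K` (Fatou).

For rates strictly inside the region, max-weight has nonpositive drift of `‖v‖ ^ 2`, so the backlog
is `o(K)` almost surely, which is enough for the almost sure constraints. For bounded means more is
needed: `⟪v, b⟫ ≤ h v` may be an equality along a cone of vectors `v`, on which the NRT coordinates
vanish. By a Hoffman bound `h v - ⟪v, b⟫` is at least a multiple of the distance of `v` to this
cone, so this distance has negative drift where it is large, and its mean stays bounded.
-/

noncomputable section

namespace Downlink

/-! ### Distance to a convex set -/

section MetricProjection

variable {E : Type*} [NormedAddCommGroup E] [InnerProductSpace ℝ E] {K : Set E}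

lemma norm_sub_eq_infDist_iff (hK : Convex ℝ K) {x p : E} (hp : p ∈ K) :
    ‖x - p‖ = Metric.infDist x K ↔ ∀ y ∈ K, inner ℝ (x - p) (y - p) ≤ 0 := by
  rw [← norm_eq_iInf_iff_real_inner_le_zero hK hp, Metric.infDist_eq_iInf]
  simp only [dist_eq_norm]

lemma norm_sub_le_norm_sub_of_inner_nonpos {x x' p p' : E} (h : inner ℝ (x - p) (p' - p) ≤ 0)
    (h' : inner ℝ (x' - p') (p - p') ≤ 0) : ‖p - p'‖ ≤ ‖x - x'‖ := by
  have hsq : ‖p - p'‖ ^ 2 ≤ inner ℝ (x - x') (p - p') := by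
    have expand : inner ℝ (x - x') (p - p') - ‖p - p'‖ ^ 2 =
        -inner ℝ (x - p) (p' - p) - inner ℝ (x' - p') (p - p') := by
      rw [← real_inner_self_eq_norm_sq]
      simp only [inner_sub_left, inner_sub_right]
      ring
    linarith
  have hcs := real_inner_le_norm (x - x') (p - p')
  by_contra! hlt
  nlinarith [norm_nonneg (x - x')]

lemma exists_metricProjection [CompleteSpace E] (hne : K.Nonempty) (hcl : IsClosed K)
    (hK : Convex ℝ K) :
    ∃ p : E → E, LipschitzWith 1 p ∧ ∀ x, p x ∈ K ∧ ‖x - p x‖ = Metric.infDist x K := by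
  have hex : ∀ x, ∃ v ∈ K, ‖x - v‖ = Metric.infDist x K := fun x => by
    obtain ⟨v, hv, h⟩ := exists_norm_eq_iInf_of_complete_convex hne hcl.isComplete hK x
    exact ⟨v, hv, by simpa only [Metric.infDist_eq_iInf, dist_eq_norm] using h⟩
  choose p hp hdist using hex
  have hvar := fun x => (norm_sub_eq_infDist_iff hK (hp x)).1 (hdist x)
  refine ⟨p, LipschitzWith.of_dist_le_mul fun x y => ?_, fun x => ⟨hp x, hdist x⟩⟩
  rw [NNReal.coe_one, one_mul, dist_eq_norm, dist_eq_norm]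
  exact norm_sub_le_norm_sub_of_inner_nonpos (hvar x _ (hp y)) (hvar y _ (hp x))

lemma infDist_sub_infDist_le {F : Type*} [SeminormedAddCommGroup F] {K : Set F} {x x' p : F}
    (hp : p ∈ K) (hd : ‖x - p‖ = Metric.infDist x K) (hpos : 0 < Metric.infDist x K) :
    Metric.infDist x' K - Metric.infDist x K ≤
      (‖x' - p‖ ^ 2 - ‖x - p‖ ^ 2) / (2 * Metric.infDist x K) := by
  have hx' : Metric.infDist x' K ≤ ‖x' - p‖ := by
    simpa only [dist_eq_norm] using Metric.infDist_le_dist_of_mem (x := x') hp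
  rw [le_div_iff₀ (by positivity), hd]
  nlinarith [sq_nonneg (‖x' - p‖ - Metric.infDist x K)]

end MetricProjection

/-! ### The Hoffman bound for polyhedral cones -/

section Hoffman

variable {E : Type*} [NormedAddCommGroup E] [InnerProductSpace ℝ E]

open ProperCone

lemma eq_zero_of_mem_innerDual_innerDual [CompleteSpace E] {G : Set E} {z : E}
    (hz : z ∈ innerDual (innerDual G : Set E)) (h : ∀ g ∈ G, inner ℝ g z ≤ 0) : z = 0 := by
  have hneg : -z ∈ (innerDual G : Set E) := fun g hg => by
    simpa using h g hg
  have : 0 ≤ inner ℝ (-z) z := hz hneg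
  simpa using this

lemma exists_mul_norm_le_of_mem_innerDual_innerDual [FiniteDimensional ℝ E] (J : Finset E) :
    ∃ κ : ℝ, 0 < κ ∧ ∀ z ∈ innerDual (innerDual (J : Set E) : Set E), ∀ e : ℝ, 0 ≤ e →
      (∀ g ∈ J, inner ℝ g z ≤ e) → κ * ‖z‖ ≤ e := by
  set D : ProperCone ℝ E := innerDual (innerDual (J : Set E) : Set E) with hD
  let f : E → ℝ := fun z => ∑ g ∈ J, max (inner ℝ g z) 0
  have hcompact : IsCompact ((D : Set E) ∩ Metric.sphere 0 1) :=
    (isCompact_sphere 0 1).inter_left D.isClosed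
  have hpos : ∀ z ∈ (D : Set E) ∩ Metric.sphere 0 1, 0 < f z := by
    rintro z ⟨hz, hz1⟩
    by_contra! hle
    have hzero := (Finset.sum_eq_zero_iff_of_nonneg fun g _ => le_max_right _ _).1
      (le_antisymm hle (Finset.sum_nonneg fun g _ => le_max_right _ _))
    have : z = 0 := eq_zero_of_mem_innerDual_innerDual hz fun g hg => by simpa using hzero g hg
    simp [this] at hz1
  obtain ⟨c, hc, hmin⟩ := hcompact.exists_forall_le' (by fun_prop : ContinuousOn f _) hpos
  refine ⟨c / (J.card + 1), by positivity, fun z hz e he hle => ?_⟩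
  rcases eq_or_ne z 0 with rfl | hz0
  · simpa using he
  have hn : 0 < ‖z‖ := norm_pos_iff.2 hz0
  have hunit : ‖z‖⁻¹ • z ∈ (D : Set E) ∩ Metric.sphere 0 1 :=
    ⟨D.smul_mem hz (inv_nonneg.2 hn.le), by simp [norm_smul, hn.ne']⟩
  have hf : f (‖z‖⁻¹ • z) ≤ J.card * (e / ‖z‖) := by
    rw [← nsmul_eq_mul]
    refine Finset.sum_le_card_nsmul _ _ _ fun g hg => max_le ?_ (by positivity)
    rw [inner_smul_right, inv_mul_eq_div]
    gcongr
    exact hle g hg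
  have hcz : c * ‖z‖ ≤ J.card * e := by
    have := (hmin _ hunit).trans hf
    rwa [← mul_div_assoc, le_div_iff₀ hn] at this
  rw [div_mul_eq_mul_div, div_le_iff₀ (by positivity)]
  linarith

/-- The normal cone of a polyhedral cone at `p` is generated by the constraints active at `p`. -/
lemma sub_mem_innerDual_innerDual_active [CompleteSpace E] {F : Finset E} {x p : E}
    (hp : p ∈ innerDual (F : Set E))
    (hvar : ∀ y ∈ innerDual (F : Set E), inner ℝ (x - p) (y - p) ≤ 0) :
    p - x ∈ innerDual (innerDual {g ∈ (F : Set E) | inner ℝ g p = 0} : Set E) := by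
  intro u hu
  have hfeas : ∀ᶠ t : ℝ in 𝓝[>] 0, ∀ g ∈ F, 0 ≤ inner ℝ g (p + t • u) := by
    refine (Finset.eventually_all F).2 fun g hg => ?_
    rcases (mem_innerDual.1 hp hg).eq_or_lt with hactive | hlt
    · filter_upwards [self_mem_nhdsWithin] with t ht
      rw [inner_add_right, inner_smul_right, ← hactive, zero_add]
      exact mul_nonneg (le_of_lt ht) (hu ⟨hg, hactive.symm⟩)
    · have hcont : Continuous fun t : ℝ => inner ℝ g (p + t • u) := by fun_prop
      have : ∀ᶠ t : ℝ in 𝓝 0, 0 < inner ℝ g (p + t • u) :=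
        continuousAt_const.eventually_lt hcont.continuousAt (by simpa using hlt)
      exact (this.filter_mono nhdsWithin_le_nhds).mono fun t => le_of_lt
  obtain ⟨t, ht, htpos⟩ := (hfeas.and self_mem_nhdsWithin).exists
  have := hvar (p + t • u) fun g hg => ht g hg
  rw [add_sub_cancel_left, inner_smul_right] at this
  change 0 ≤ inner ℝ u (p - x)
  rw [real_inner_comm, ← neg_sub, inner_neg_left]
  linarith [nonpos_of_mul_nonpos_right this htpos]

lemma exists_hoffman_bound [FiniteDimensional ℝ E] {G : Set E} (hG : G.Finite) :
    ∃ κ : ℝ, 0 < κ ∧ ∀ x : E, ∀ e : ℝ, 0 ≤ e → (∀ g ∈ G, -e ≤ inner ℝ g x) →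
      κ * Metric.infDist x (innerDual G) ≤ e := by
  classical
  obtain ⟨F, rfl⟩ := hG.exists_finset_coe
  choose κ hκ hbound using exists_mul_norm_le_of_mem_innerDual_innerDual (E := E)
  obtain ⟨J₀, -, hmin⟩ := F.powerset.exists_min_image κ ⟨∅, by simp⟩
  refine ⟨κ J₀, hκ J₀, fun x e he hx => ?_⟩
  have hconv : Convex ℝ (innerDual (F : Set E) : Set E) :=
    (innerDual (F : Set E)).toPointedCone.convex
  obtain ⟨p, -, hproj⟩ := exists_metricProjection (E := E) ⟨0, zero_mem _⟩
    (innerDual (F : Set E)).isClosed hconv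
  obtain ⟨hp, hdist⟩ := hproj x
  set J : Finset E := {g ∈ F | inner ℝ g (p x) = 0} with hJ
  have hnormal : p x - x ∈ innerDual (innerDual (J : Set E) : Set E) := by
    rw [hJ, Finset.coe_filter]
    exact sub_mem_innerDual_innerDual_active hp ((norm_sub_eq_infDist_iff hconv hp).1 hdist)
  have hle : ∀ g ∈ J, inner ℝ g (p x - x) ≤ e := fun g hg => by
    obtain ⟨hgF, hactive⟩ := Finset.mem_filter.1 hg
    rw [inner_sub_right, hactive]
    linarith [hx g hgF]
  calc κ J₀ * Metric.infDist x (innerDual (F : Set E)) = κ J₀ * ‖p x - x‖ := by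
        rw [← hdist, norm_sub_rev]
    _ ≤ κ J * ‖p x - x‖ := by
        gcongr
        exact hmin J (by simp [hJ])
    _ ≤ e := hbound J _ hnormal e he hle

end Hoffman

/-! ### Support functions -/

section Support

lemma nonneg_of_forall_norm_le {E : Type*} [SeminormedAddGroup E] {O : Set E} {C : ℝ}
    (hne : O.Nonempty) (hC : ∀ o ∈ O, ‖o‖ ≤ C) : 0 ≤ C :=
  let ⟨o, ho⟩ := hne; (norm_nonneg o).trans (hC o ho)

variable {E : Type*} [NormedAddCommGroup E] [InnerProductSpace ℝ E] {O : Set E} {C : ℝ}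

/-- The support function of a set `O`. It takes junk values unless `O` is bounded and nonempty. -/
def support (O : Set E) (w : E) : ℝ := sSup ((fun o => inner ℝ w o) '' O)

lemma inner_le_support (hC : ∀ o ∈ O, ‖o‖ ≤ C) (w : E) {o : E} (ho : o ∈ O) :
    inner ℝ w o ≤ support O w := by
  refine le_csSup ⟨‖w‖ * C, ?_⟩ ⟨o, ho, rfl⟩
  rintro _ ⟨o', ho', rfl⟩
  exact (real_inner_le_norm w o').trans (mul_le_mul_of_nonneg_left (hC o' ho') (norm_nonneg w))

lemma support_le (hne : O.Nonempty) {w : E} {c : ℝ} (h : ∀ o ∈ O, inner ℝ w o ≤ c) :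
    support O w ≤ c :=
  csSup_le (hne.image _) (by rintro _ ⟨o, ho, rfl⟩; exact h o ho)

lemma exists_support_sub_lt (hne : O.Nonempty) (w : E) {δ : ℝ} (hδ : 0 < δ) :
    ∃ o ∈ O, support O w - δ < inner ℝ w o := by
  obtain ⟨_, ⟨o, ho, rfl⟩, hlt⟩ := exists_lt_of_lt_csSup (hne.image fun o => inner ℝ w o)
    (sub_lt_self (support O w) hδ)
  exact ⟨o, ho, hlt⟩

lemma support_zero (hne : O.Nonempty) : support O 0 = 0 := by
  simp [support, hne]

lemma support_add_smul_le (hne : O.Nonempty) (hC : ∀ o ∈ O, ‖o‖ ≤ C) {a b : ℝ} (ha : 0 ≤ a)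
    (hb : 0 ≤ b) (x y : E) :
    support O (a • x + b • y) ≤ a * support O x + b * support O y := by
  refine support_le hne fun o ho => ?_
  rw [inner_add_left, real_inner_smul_left, real_inner_smul_left]
  gcongr
  exacts [inner_le_support hC x ho, inner_le_support hC y ho]

lemma support_le_add (hne : O.Nonempty) (hC : ∀ o ∈ O, ‖o‖ ≤ C) (w w' : E) :
    support O w ≤ support O w' + C * ‖w - w'‖ := by
  refine support_le hne fun o ho => ?_
  have hdiff : inner ℝ (w - w') o ≤ C * ‖w - w'‖ := by
    rw [mul_comm]
    exact (real_inner_le_norm _ _).trans (mul_le_mul_of_nonneg_left (hC o ho) (norm_nonneg _))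
  rw [inner_sub_left] at hdiff
  linarith [inner_le_support hC w' ho]

lemma lipschitzWith_support (hne : O.Nonempty) (hC : ∀ o ∈ O, ‖o‖ ≤ C) :
    LipschitzWith C.toNNReal (support O) :=
  LipschitzWith.of_le_add_mul _ fun x y => by
    rw [Real.coe_toNNReal _ (nonneg_of_forall_norm_le hne hC), dist_eq_norm]
    exact support_le_add hne hC x y

lemma abs_support_le (hne : O.Nonempty) (hC : ∀ o ∈ O, ‖o‖ ≤ C) (w : E) :
    |support O w| ≤ C * ‖w‖ := by
  have := (lipschitzWith_support hne hC).dist_le_mul w 0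
  rwa [support_zero hne, dist_zero_right, dist_zero_right, Real.norm_eq_abs,
    Real.coe_toNNReal _ (nonneg_of_forall_norm_le hne hC)] at this

end Support

/-! ### Vectors of queues -/

section PosVec

variable {J : Type*}

/-- The componentwise positive part of a vector, by which queues are kept nonnegative. -/
def posVec (x : EuclideanSpace ℝ J) : EuclideanSpace ℝ J := WithLp.toLp 2 fun j => max (x j) 0

@[simp] lemma posVec_apply (x : EuclideanSpace ℝ J) (j : J) : posVec x j = max (x j) 0 := rfl

variable [Fintype J]

lemma norm_posVec_sub_le (x : EuclideanSpace ℝ J) {y : EuclideanSpace ℝ J} (hy : ∀ j, 0 ≤ y j) :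
    ‖posVec x - y‖ ≤ ‖x - y‖ := by
  refine (sq_le_sq₀ (norm_nonneg _) (norm_nonneg _)).1 ?_
  rw [EuclideanSpace.real_norm_sq_eq, EuclideanSpace.real_norm_sq_eq]
  refine Finset.sum_le_sum fun j _ => ?_
  simp only [PiLp.sub_apply, posVec_apply]
  rcases le_total 0 (x j) with h | h
  · rw [max_eq_left h]
  · rw [max_eq_right h]
    nlinarith [hy j]

lemma norm_posVec_add_sub_le (x : EuclideanSpace ℝ J) {y : EuclideanSpace ℝ J}
    (hy : ∀ j, 0 ≤ y j) : ‖posVec (y + x) - y‖ ≤ ‖x‖ := by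
  simpa using norm_posVec_sub_le (y + x) hy

lemma inner_eq_sum_mul (x y : EuclideanSpace ℝ J) : inner ℝ x y = ∑ j, x j * y j := by
  simp [PiLp.inner_apply, mul_comm]

lemma norm_le_sum_abs (x : EuclideanSpace ℝ J) : ‖x‖ ≤ ∑ j, |x j| := by
  classical
  calc ‖x‖ = ‖∑ j, EuclideanSpace.single j (x j)‖ := by
        congr 1
        ext i
        simp [Finset.sum_apply, Pi.single_apply]
    _ ≤ ∑ j, |x j| := (norm_sum_le _ _).trans (by simp)

end PosVec

/-! ### Drift criteria -/

lemma norm_le_mul_of_norm_succ_sub_le {E : Type*} [SeminormedAddCommGroup E] {u : ℕ → E} {M : ℝ}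
    (h0 : u 0 = 0) (h : ∀ k, ‖u (k + 1) - u k‖ ≤ M) (k : ℕ) : ‖u k‖ ≤ M * k := by
  induction k with
  | zero => simp [h0]
  | succ k ih =>
    have htri := norm_le_norm_add_norm_sub' (u (k + 1)) (u k)
    push_cast
    linarith [h k]

lemma le_max_of_succ_le_mul_add {x : ℕ → ℝ} {ρ D : ℝ} (hρ : 0 < ρ) (hρ1 : ρ ≤ 1)
    (h : ∀ k, x (k + 1) ≤ (1 - ρ) * x k + D) (k : ℕ) : x k ≤ max (x 0) (D / ρ) := by
  induction k with
  | zero => exact le_max_left _ _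
  | succ k ih =>
    have hD : D ≤ max (x 0) (D / ρ) * ρ := (div_le_iff₀ hρ).1 (le_max_right _ _)
    have hmul := mul_le_mul_of_nonneg_left ih (sub_nonneg.2 hρ1)
    linarith [h k]

lemma exp_increment_le {θ M U U' : ℝ} (hθ : 0 ≤ θ) (hθM : θ * M ≤ 1) (h : |U' - U| ≤ M) :
    Real.exp (θ * U') ≤ Real.exp (θ * U) * (1 + θ ^ 2 * M ^ 2 + θ * (U' - U)) := by
  have habs : |θ * (U' - U)| ≤ θ * M := by
    rw [abs_mul, abs_of_nonneg hθ]
    exact mul_le_mul_of_nonneg_left h hθ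
  have htaylor := (abs_le.1 (Real.abs_exp_sub_one_sub_id_le (habs.trans hθM))).2
  have hsq : (θ * (U' - U)) ^ 2 ≤ θ ^ 2 * M ^ 2 := by
    rw [← mul_pow]
    exact sq_le_sq' (abs_le.1 habs).1 (abs_le.1 habs).2
  have hexp : Real.exp (θ * U') = Real.exp (θ * U) * Real.exp (θ * (U' - U)) := by
    rw [← Real.exp_add]
    ring_nf
  rw [hexp]
  exact mul_le_mul_of_nonneg_left (by linarith) (Real.exp_pos _).le

section Drift

variable {Ω : Type*} {mΩ : MeasurableSpace Ω} {Pr : Measure Ω} [IsProbabilityMeasure Pr]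

lemma integral_exp_succ_le {U U' : Ω → ℝ} {θ M η U₀ : ℝ} (hU : Measurable U)
    (hU' : Measurable U') (hθ : 0 ≤ θ) (hθM : θ * M ≤ 1) (hθM' : θ * M ^ 2 ≤ η / 2)
    (hθη : θ * η ≤ 1) (hint : Integrable (fun ω => Real.exp (θ * U ω)) Pr)
    (hint' : Integrable (fun ω => Real.exp (θ * U' ω)) Pr) (hincr : ∀ ω, |U' ω - U ω| ≤ M)
    (hdrift : ∫ ω in {ω | U₀ ≤ U ω}, Real.exp (θ * U ω) * (U' ω - U ω) ∂Pr ≤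
      -η * ∫ ω in {ω | U₀ ≤ U ω}, Real.exp (θ * U ω) ∂Pr) :
    ∫ ω, Real.exp (θ * U' ω) ∂Pr ≤
      (1 - θ * η / 2) * ∫ ω, Real.exp (θ * U ω) ∂Pr + Real.exp (θ * (U₀ + M)) := by
  set s : Set Ω := {ω | U₀ ≤ U ω}
  have hs : MeasurableSet s := measurableSet_le measurable_const hU
  have hincr_int : Integrable (fun ω => Real.exp (θ * U ω) * (U' ω - U ω)) Pr :=
    hint.mul_bdd (c := M) (hU'.sub hU).aestronglyMeasurable (ae_of_all _ hincr)
  have large : ∫ ω in s, Real.exp (θ * U' ω) ∂Pr ≤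
      (1 - θ * η / 2) * ∫ ω, Real.exp (θ * U ω) ∂Pr := by
    have hmono : ∫ ω in s, Real.exp (θ * U ω) ∂Pr ≤ ∫ ω, Real.exp (θ * U ω) ∂Pr :=
      setIntegral_le_integral hint (ae_of_all _ fun ω => (Real.exp_pos _).le)
    have hnonneg : 0 ≤ ∫ ω in s, Real.exp (θ * U ω) ∂Pr :=
      integral_nonneg fun ω => (Real.exp_pos _).le
    calc ∫ ω in s, Real.exp (θ * U' ω) ∂Pr
        ≤ ∫ ω in s, ((1 + θ ^ 2 * M ^ 2) * Real.exp (θ * U ω)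
            + θ * (Real.exp (θ * U ω) * (U' ω - U ω))) ∂Pr := by
          refine integral_mono hint'.integrableOn
            ((hint.const_mul _).add (hincr_int.const_mul _)).integrableOn fun ω => ?_
          refine (exp_increment_le hθ hθM (hincr ω)).trans (le_of_eq ?_)
          ring
      _ = (1 + θ ^ 2 * M ^ 2) * ∫ ω in s, Real.exp (θ * U ω) ∂Pr
            + θ * ∫ ω in s, Real.exp (θ * U ω) * (U' ω - U ω) ∂Pr := by
          rw [integral_add (hint.const_mul _).integrableOn (hincr_int.const_mul _).integrableOn,
            integral_const_mul, integral_const_mul]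
      _ ≤ (1 - θ * η / 2) * ∫ ω in s, Real.exp (θ * U ω) ∂Pr := by
          nlinarith [mul_le_mul_of_nonneg_left hdrift hθ, mul_le_mul_of_nonneg_left hθM' hθ]
      _ ≤ _ := mul_le_mul_of_nonneg_left hmono (by linarith)
  have small : ∫ ω in sᶜ, Real.exp (θ * U' ω) ∂Pr ≤ Real.exp (θ * (U₀ + M)) := by
    calc ∫ ω in sᶜ, Real.exp (θ * U' ω) ∂Pr ≤ ∫ _ in sᶜ, Real.exp (θ * (U₀ + M)) ∂Pr := by
          refine setIntegral_mono_on hint'.integrableOn (integrable_const _).integrableOn hs.compl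
            fun ω hω => Real.exp_le_exp.2 (mul_le_mul_of_nonneg_left ?_ hθ)
          linarith [(abs_le.1 (hincr ω)).2, show U ω < U₀ from not_le.1 hω]
      _ ≤ ∫ _, Real.exp (θ * (U₀ + M)) ∂Pr :=
          setIntegral_le_integral (integrable_const _) (ae_of_all _ fun _ => (Real.exp_pos _).le)
      _ = Real.exp (θ * (U₀ + M)) := by simp
  rw [← integral_add_compl hs hint']
  exact add_le_add large small

/-- Exponential moments turn the drift condition, which only concerns `{U₀ ≤ U k}`, into an affine
recursion that needs no control of `U k` below `U₀`. -/
lemma exists_integral_le_of_drift {U : ℕ → Ω → ℝ} (hU : ∀ k, Measurable (U k))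
    (h0 : ∀ ω, U 0 ω = 0) {M η U₀ : ℝ} (hη : 0 < η)
    (hincr : ∀ k ω, |U (k + 1) ω - U k ω| ≤ M)
    (hdrift : ∀ θ : ℝ, 0 < θ → ∀ k,
      ∫ ω in {ω | U₀ ≤ U k ω}, Real.exp (θ * U k ω) * (U (k + 1) ω - U k ω) ∂Pr ≤
        -η * ∫ ω in {ω | U₀ ≤ U k ω}, Real.exp (θ * U k ω) ∂Pr) :
    ∃ B : ℝ, ∀ k, ∫ ω, U k ω ∂Pr ≤ B := by
  obtain ⟨θ, hθ, hθM, hθM', hθη⟩ :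
      ∃ θ : ℝ, 0 < θ ∧ θ * M ≤ 1 ∧ θ * M ^ 2 ≤ η / 2 ∧ θ * η ≤ 1 := by
    have small : ∀ a b : ℝ, 0 < b → ∀ᶠ θ in 𝓝[>] (0 : ℝ), θ * a ≤ b := fun a b hb => by
      have hlim : Tendsto (fun θ : ℝ => θ * a) (𝓝 0) (𝓝 0) :=
        Continuous.tendsto' (by fun_prop) 0 0 (by simp)
      exact (hlim.eventually (eventually_le_nhds hb)).filter_mono nhdsWithin_le_nhds
    exact (eventually_mem_nhdsWithin.and ((small M 1 one_pos).and
      ((small (M ^ 2) (η / 2) (half_pos hη)).and (small η 1 one_pos)))).exists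
  have hbound : ∀ k ω, |U k ω| ≤ M * k := fun k ω =>
    norm_le_mul_of_norm_succ_sub_le (u := fun k => U k ω) (h0 ω) (fun k => hincr k ω) k
  have hexp : ∀ k, Integrable (fun ω => Real.exp (θ * U k ω)) Pr := fun k => by
    refine Integrable.of_bound ((hU k).const_mul θ).exp.aestronglyMeasurable
      (Real.exp (θ * (M * k))) (ae_of_all _ fun ω => ?_)
    rw [Real.norm_eq_abs, Real.abs_exp, Real.exp_le_exp]
    exact mul_le_mul_of_nonneg_left ((le_abs_self _).trans (hbound k ω)) hθ.le
  have hmoment := le_max_of_succ_le_mul_add (x := fun k => ∫ ω, Real.exp (θ * U k ω) ∂Pr)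
    (ρ := θ * η / 2) (by positivity) (by linarith) fun k =>
    integral_exp_succ_le (hU k) (hU (k + 1)) hθ.le hθM hθM' hθη (hexp k) (hexp (k + 1)) (hincr k)
      (hdrift θ hθ k)
  refine ⟨_, fun k => (le_div_iff₀' hθ).2 (le_trans ?_ (hmoment k))⟩
  rw [← integral_const_mul]
  refine integral_mono ((Integrable.of_bound (hU k).aestronglyMeasurable _
    (ae_of_all _ (hbound k))).const_mul θ) (hexp k) fun ω => ?_
  linarith [Real.add_one_le_exp (θ * U k ω)]

end Drift

/-! ### Independence and almost sure convergence -/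

section Probability

variable {Ω : Type*} {mΩ : MeasurableSpace Ω} {Pr : Measure Ω}

lemma integral_comp_le_of_indepFun [IsProbabilityMeasure Pr] {A B : Type*} [MeasurableSpace A]
    [MeasurableSpace B] {X : Ω → A} {Y : Ω → B} (hX : Measurable X) (hY : Measurable Y)
    (hXY : IndepFun X Y Pr) {F : A → B → ℝ} (hF : Measurable (Function.uncurry F))
    (hint : Integrable (fun ω => F (X ω) (Y ω)) Pr) {c : A → ℝ}
    (hc : Integrable (fun ω => c (X ω)) Pr)
    (h : ∀ᵐ ω ∂Pr, ∫ ω', F (X ω) (Y ω') ∂Pr ≤ c (X ω)) :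
    ∫ ω, F (X ω) (Y ω) ∂Pr ≤ ∫ ω, c (X ω) ∂Pr := by
  have hmap : Pr.map (fun ω => (X ω, Y ω)) = (Pr.map X).prod (Pr.map Y) :=
    (indepFun_iff_map_prod_eq_prod_map_map hX.aemeasurable hY.aemeasurable).1 hXY
  have : IsProbabilityMeasure (Pr.map X) := Measure.isProbabilityMeasure_map hX.aemeasurable
  have : IsProbabilityMeasure (Pr.map Y) := Measure.isProbabilityMeasure_map hY.aemeasurable
  have hprod : Integrable (Function.uncurry F) ((Pr.map X).prod (Pr.map Y)) := by
    rw [← hmap, integrable_map_measure hF.aestronglyMeasurable (hX.prodMk hY).aemeasurable]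
    exact hint
  have hinner : ∀ x, ∫ y, F x y ∂(Pr.map Y) = ∫ ω', F x (Y ω') ∂Pr := fun x =>
    integral_map hY.aemeasurable (hF.comp measurable_prodMk_left).aestronglyMeasurable
  have hleft := hprod.integral_prod_left
  calc ∫ ω, F (X ω) (Y ω) ∂Pr
      = ∫ z, Function.uncurry F z ∂(Pr.map X).prod (Pr.map Y) := by
        rw [← hmap, integral_map (hX.prodMk hY).aemeasurable hF.aestronglyMeasurable]
        rfl
    _ = ∫ ω, ∫ y, F (X ω) y ∂(Pr.map Y) ∂Pr := by
        rw [integral_prod _ hprod, integral_map hX.aemeasurable hleft.aestronglyMeasurable]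
        rfl
    _ ≤ ∫ ω, c (X ω) ∂Pr := by
        refine integral_mono_ae (hleft.comp_measurable hX) hc ?_
        filter_upwards [h] with ω hω
        rwa [hinner]

lemma ae_tendsto_zero_of_summable_integral {f : ℕ → Ω → ℝ} (hf : ∀ n, Integrable (f n) Pr)
    (h0 : ∀ n ω, 0 ≤ f n ω) (hs : Summable fun n => ∫ ω, f n ω ∂Pr) :
    ∀ᵐ ω ∂Pr, Tendsto (fun n => f n ω) atTop (𝓝 0) := by
  have hmeas : ∀ n, AEMeasurable (fun ω => ENNReal.ofReal (f n ω)) Pr := fun n =>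
    (hf n).aestronglyMeasurable.aemeasurable.ennreal_ofReal
  have hfin : ∫⁻ ω, ∑' n, ENNReal.ofReal (f n ω) ∂Pr ≠ ⊤ := by
    rw [lintegral_tsum hmeas]
    simp only [← ofReal_integral_eq_lintegral_ofReal (hf _) (ae_of_all _ (h0 _))]
    exact hs.tsum_ofReal_ne_top
  filter_upwards [ae_lt_top' (AEMeasurable.tsum hmeas) hfin] with ω hω
  have hlim := (ENNReal.tendsto_toReal ENNReal.zero_ne_top).comp
    (ENNReal.tendsto_atTop_zero_of_tsum_ne_top hω.ne)
  simpa [Function.comp_def, ENNReal.toReal_ofReal (h0 _ ω)] using hlim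

end Probability

/-! ### Limits of real sequences -/

section Limits

variable {f g : ℕ → ℝ} {B x : ℝ}

lemma tendsto_div_of_tendsto_squares {M : ℝ} (hincr : ∀ k, f (k + 1) ≤ f k + M)
    (hsq : Tendsto (fun n : ℕ => f (n ^ 2) / (n : ℝ) ^ 2) atTop (𝓝 0)) :
    Tendsto (fun k : ℕ => f k / k) atTop (𝓝 0) := by
  have hmono : Monotone fun k : ℕ => M * k - f k := monotone_nat_of_le_succ fun k => by
    push_cast
    linarith [hincr k]
  have hratio : ∀ a > (1 : ℝ), ∀ᶠ n : ℕ in atTop, (((n + 1) ^ 2 : ℕ) : ℝ) ≤ a * (n ^ 2 : ℕ) := by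
    intro a ha
    have hone : Tendsto (fun n : ℕ => (1 + 1 / (n : ℝ)) ^ 2) atTop (𝓝 1) := by
      simpa using (tendsto_one_div_atTop_nhds_zero_nat.const_add (1 : ℝ)).pow 2
    filter_upwards [hone.eventually_lt_const ha, eventually_gt_atTop 0] with n hn hpos
    have : (0 : ℝ) < n := Nat.cast_pos.2 hpos
    have hexp : (((n + 1) ^ 2 : ℕ) : ℝ) = (1 + 1 / (n : ℝ)) ^ 2 * (n ^ 2 : ℕ) := by
      push_cast
      field_simp
    rw [hexp]
    gcongr
  have hlim : Tendsto (fun k : ℕ => (M * k - f k) / k) atTop (𝓝 M) := by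
    refine tendsto_div_of_monotone_of_exists_subseq_tendsto_div _ M hmono fun a ha =>
      ⟨fun n => n ^ 2, hratio a ha, tendsto_pow_atTop two_ne_zero, ?_⟩
    have hdiff := hsq.const_sub M
    rw [sub_zero] at hdiff
    refine hdiff.congr' ?_
    filter_upwards [eventually_gt_atTop 0] with n hn
    have : (0 : ℝ) < n := Nat.cast_pos.2 hn
    push_cast
    field_simp
  have hsub := hlim.const_sub M
  rw [sub_self] at hsub
  refine hsub.congr' ?_
  filter_upwards [eventually_gt_atTop 0] with k hk
  have : (0 : ℝ) < k := Nat.cast_pos.2 hk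
  field_simp
  ring

lemma tendsto_div_of_sq_le {B : ℝ} (h0 : ∀ k, 0 ≤ f k) (h : ∀ k : ℕ, f k ^ 2 ≤ B * k) :
    Tendsto (fun k : ℕ => f k / k) atTop (𝓝 0) := by
  have hsqrt : Tendsto (fun k : ℕ => √(B / k)) atTop (𝓝 0) := by
    simpa using (tendsto_const_div_atTop_nhds_zero_nat B).sqrt
  refine squeeze_zero (fun k => div_nonneg (h0 k) k.cast_nonneg)
    (fun k => Real.le_sqrt_of_sq_le ?_) hsqrt
  calc (f k / k) ^ 2 = f k ^ 2 / (k : ℝ) ^ 2 := div_pow _ _ _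
    _ ≤ B * k / (k : ℝ) ^ 2 := by gcongr; exact h k
    _ = B / k := by
        obtain rfl | hk := eq_or_ne k 0
        · simp
        · field_simp

lemma isBoundedUnder_of_abs_le (hf : ∀ k, |f k| ≤ B) :
    IsBoundedUnder (· ≤ ·) atTop f ∧ IsBoundedUnder (· ≥ ·) atTop f :=
  ⟨isBoundedUnder_of ⟨B, fun k => (abs_le.1 (hf k)).2⟩,
    isBoundedUnder_of ⟨-B, fun k => (abs_le.1 (hf k)).1⟩⟩

lemma le_liminf_of_tendsto (hf : ∀ k, |f k| ≤ B) (hg : Tendsto g atTop (𝓝 x))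
    (h : ∀ᶠ k in atTop, g k ≤ f k) : x ≤ liminf f atTop := by
  rw [← hg.liminf_eq]
  exact liminf_le_liminf h hg.isBoundedUnder_ge
    (isBoundedUnder_of_abs_le hf).1.isCoboundedUnder_ge

lemma limsup_le_of_tendsto (hf : ∀ k, |f k| ≤ B) (hg : Tendsto g atTop (𝓝 x))
    (h : ∀ᶠ k in atTop, f k ≤ g k) : limsup f atTop ≤ x := by
  rw [← hg.limsup_eq]
  exact limsup_le_limsup h (isBoundedUnder_of_abs_le hf).2.isCoboundedUnder_le
    hg.isBoundedUnder_le

lemma eventually_sub_le_of_le_liminf (hf : ∀ k, |f k| ≤ B) (h : x ≤ liminf f atTop) {e : ℝ}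
    (he : 0 < e) : ∀ᶠ k in atTop, x - e ≤ f k :=
  (eventually_lt_of_lt_liminf ((sub_lt_self x he).trans_le h)
    (isBoundedUnder_of_abs_le hf).2).mono fun _ => le_of_lt

lemma eventually_le_add_of_limsup_le (hf : ∀ k, |f k| ≤ B) (h : limsup f atTop ≤ x) {e : ℝ}
    (he : 0 < e) : ∀ᶠ k in atTop, f k ≤ x + e :=
  (eventually_lt_of_limsup_lt (h.trans_lt (lt_add_of_pos_right x he))
    (isBoundedUnder_of_abs_le hf).1).mono fun _ => le_of_lt

lemma abs_average_le (hf : ∀ k, |f k| ≤ B) (K : ℕ) :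
    |(∑ k ∈ Finset.range K, f k) / K| ≤ B := by
  have hB : 0 ≤ B := (abs_nonneg _).trans (hf 0)
  rw [abs_div, Nat.abs_cast]
  refine div_le_of_le_mul₀ K.cast_nonneg hB ((Finset.abs_sum_le_sum_abs _ _).trans ?_)
  simpa [mul_comm] using Finset.sum_le_card_nsmul (Finset.range K) _ B fun k _ => hf k

end Limits

/-! ### Max-weight processes -/

section MeanSupport

variable {J M : Type*} [Fintype J] [Fintype M]

/-- The mean support function of the random set `O γ`, where `γ` has distribution `π`. -/
def meanSupport (π : M → ℝ) (O : M → Set (EuclideanSpace ℝ J)) (w : EuclideanSpace ℝ J) : ℝ :=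
  ∑ m, π m * support (O m) w

variable {π : M → ℝ} {O : M → Set (EuclideanSpace ℝ J)} {C : ℝ}

lemma meanSupport_zero (hne : ∀ m, (O m).Nonempty) : meanSupport π O 0 = 0 := by
  simp [meanSupport, support_zero (hne _)]

lemma continuous_meanSupport (hne : ∀ m, (O m).Nonempty) (hC : ∀ m, ∀ o ∈ O m, ‖o‖ ≤ C) :
    Continuous (meanSupport π O) :=
  continuous_finsetSum _ fun m _ =>
    continuous_const.mul (lipschitzWith_support (hne m) (hC m)).continuous

lemma meanSupport_le_add (hπ : ∀ m, 0 ≤ π m) (hsum : ∑ m, π m = 1)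
    (hne : ∀ m, (O m).Nonempty) (hC : ∀ m, ∀ o ∈ O m, ‖o‖ ≤ C) (v v' : EuclideanSpace ℝ J) :
    meanSupport π O v ≤ meanSupport π O v' + C * ‖v - v'‖ := by
  calc meanSupport π O v ≤ ∑ m, π m * (support (O m) v' + C * ‖v - v'‖) :=
        Finset.sum_le_sum fun m _ =>
          mul_le_mul_of_nonneg_left (support_le_add (hne m) (hC m) v v') (hπ m)
    _ = meanSupport π O v' + C * ‖v - v'‖ := by
        simp only [mul_add, Finset.sum_add_distrib, ← Finset.sum_mul, hsum, one_mul, meanSupport]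

lemma meanSupport_add_smul_le (hπ : ∀ m, 0 ≤ π m) (hne : ∀ m, (O m).Nonempty)
    (hC : ∀ m, ∀ o ∈ O m, ‖o‖ ≤ C) {s t : ℝ} (hs : 0 ≤ s) (ht : 0 ≤ t)
    (x y : EuclideanSpace ℝ J) :
    meanSupport π O (s • x + t • y) ≤ s * meanSupport π O x + t * meanSupport π O y := by
  simp only [meanSupport, Finset.mul_sum, ← Finset.sum_add_distrib]
  refine Finset.sum_le_sum fun m _ => ?_
  linarith [mul_le_mul_of_nonneg_left (support_add_smul_le (hne m) (hC m) hs ht x y) (hπ m)]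

/-- The nonnegative weights `y` for which services with random set `O γ` cannot exceed the mean
arrivals `b`, in the sense that `meanSupport π O y ≤ ⟪y, b⟫`. -/
def tightCone (π : M → ℝ) (O : M → Set (EuclideanSpace ℝ J)) (b : EuclideanSpace ℝ J) :
    Set (EuclideanSpace ℝ J) :=
  {y | (∀ j, 0 ≤ y j) ∧ meanSupport π O y ≤ inner ℝ y b}

variable {b : EuclideanSpace ℝ J}

lemma zero_mem_tightCone (hne : ∀ m, (O m).Nonempty) : 0 ∈ tightCone π O b := by
  simp [tightCone, meanSupport_zero hne]

lemma isClosed_tightCone (hne : ∀ m, (O m).Nonempty) (hC : ∀ m, ∀ o ∈ O m, ‖o‖ ≤ C) :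
    IsClosed (tightCone π O b) := by
  have hnonneg : IsClosed {y : EuclideanSpace ℝ J | ∀ j, 0 ≤ y j} := by
    simp only [Set.ofPred_forall]
    exact isClosed_iInter fun j => isClosed_le continuous_const (by fun_prop)
  exact hnonneg.inter (isClosed_le (continuous_meanSupport hne hC) (by fun_prop))

lemma convex_tightCone (hπ : ∀ m, 0 ≤ π m) (hne : ∀ m, (O m).Nonempty)
    (hC : ∀ m, ∀ o ∈ O m, ‖o‖ ≤ C) : Convex ℝ (tightCone π O b) := by
  rintro x ⟨hx, hxb⟩ y ⟨hy, hyb⟩ s t hs ht -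
  refine ⟨fun j => add_nonneg (mul_nonneg hs (hx j)) (mul_nonneg ht (hy j)), ?_⟩
  rw [inner_add_left, real_inner_smul_left, real_inner_smul_left]
  refine (meanSupport_add_smul_le hπ hne hC hs ht x y).trans ?_
  gcongr

end MeanSupport

section MaxWeight

variable {Ω : Type*} {mΩ : MeasurableSpace Ω} {J M : Type*} [Fintype J]
  [MeasurableSpace M]

/-- Queues `w` with arrivals `β` and services `c`, where `c` maximizes the weight `⟪w, c⟫` over the
set `O γ` of services possible in the current state `γ`. Arrivals have mean `b`, states have
distribution `π`, and `C` bounds arrivals and services. -/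
structure IsMaxWeight (Pr : Measure Ω) (O : M → Set (EuclideanSpace ℝ J)) (π : M → ℝ)
    (b : EuclideanSpace ℝ J) (C : ℝ) (w β c : ℕ → Ω → EuclideanSpace ℝ J) (γ : ℕ → Ω → M) :
    Prop where
  zero : ∀ ω, w 0 ω = 0
  succ : ∀ k ω, w (k + 1) ω = posVec (w k ω + (β k ω - c k ω))
  measurable : ∀ k, Measurable (w k)
  measurable_arrival : ∀ k, Measurable (β k)
  measurable_state : ∀ k, Measurable (γ k)
  indep : ∀ k, IndepFun (w k) (fun ω => (β k ω, γ k ω)) Pr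
  mean_arrival : ∀ k, ∫ ω, β k ω ∂Pr = b
  prob_state : ∀ k m, Pr.real {ω | γ k ω = m} = π m
  nonempty : ∀ m, (O m).Nonempty
  bound : ∀ m, ∀ o ∈ O m, ‖o‖ ≤ C
  bound_arrival : ∀ k ω, ‖β k ω‖ ≤ C
  mem : ∀ k ω, c k ω ∈ O (γ k ω)
  optimal : ∀ k ω, ∀ o ∈ O (γ k ω), inner ℝ (w k ω) o ≤ inner ℝ (w k ω) (c k ω)

/-- A bound for the change of the squared distance from a reference point `y` in one slot, in terms
of the current queues `x` and the pair `ξ` of the arrivals and the state. -/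
def driftBound (O : M → Set (EuclideanSpace ℝ J)) (C : ℝ) (x y : EuclideanSpace ℝ J)
    (ξ : EuclideanSpace ℝ J × M) : ℝ :=
  2 * inner ℝ (x - y) ξ.1 - 2 * support (O ξ.2) x + 2 * support (O ξ.2) y + 4 * C ^ 2

namespace IsMaxWeight

variable {Pr : Measure Ω} {O : M → Set (EuclideanSpace ℝ J)} {π : M → ℝ}
  {b : EuclideanSpace ℝ J} {C : ℝ} {w β c : ℕ → Ω → EuclideanSpace ℝ J} {γ : ℕ → Ω → M}

lemma nonneg (h : IsMaxWeight Pr O π b C w β c γ) (k : ℕ) (ω : Ω) (j : J) : 0 ≤ w k ω j := by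
  cases k with
  | zero => simp [h.zero]
  | succ k => simp [h.succ]

lemma norm_arrival_sub_service_le (h : IsMaxWeight Pr O π b C w β c γ) (k : ℕ) (ω : Ω) :
    ‖β k ω - c k ω‖ ≤ 2 * C := by
  linarith [norm_sub_le (β k ω) (c k ω), h.bound_arrival k ω, h.bound _ _ (h.mem k ω)]

lemma norm_succ_sub_le (h : IsMaxWeight Pr O π b C w β c γ) (k : ℕ) (ω : Ω) :
    ‖w (k + 1) ω - w k ω‖ ≤ 2 * C := by
  rw [h.succ]
  exact (norm_posVec_add_sub_le _ (h.nonneg k ω)).trans (h.norm_arrival_sub_service_le k ω)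

lemma norm_le (h : IsMaxWeight Pr O π b C w β c γ) (k : ℕ) (ω : Ω) : ‖w k ω‖ ≤ 2 * C * k :=
  norm_le_mul_of_norm_succ_sub_le (u := fun k => w k ω) (h.zero ω)
    (fun k => h.norm_succ_sub_le k ω) k

lemma integrable_norm_sq [IsFiniteMeasure Pr] (h : IsMaxWeight Pr O π b C w β c γ) (k : ℕ) :
    Integrable (fun ω => ‖w k ω‖ ^ 2) Pr :=
  Integrable.of_bound ((h.measurable k).norm.pow_const 2).aestronglyMeasurable ((2 * C * k) ^ 2)
    (ae_of_all _ fun ω => by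
      rw [Real.norm_of_nonneg (by positivity)]
      exact pow_le_pow_left₀ (norm_nonneg _) (h.norm_le k ω) 2)

lemma norm_sq_succ_sub_le (h : IsMaxWeight Pr O π b C w β c γ) (k : ℕ) (ω : Ω)
    {y : EuclideanSpace ℝ J} (hy : ∀ j, 0 ≤ y j) :
    ‖w (k + 1) ω - y‖ ^ 2 - ‖w k ω - y‖ ^ 2 ≤ driftBound O C (w k ω) y (β k ω, γ k ω) := by
  have hstep : ‖w (k + 1) ω - y‖ ^ 2 ≤ ‖(w k ω - y) + (β k ω - c k ω)‖ ^ 2 := by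
    refine pow_le_pow_left₀ (norm_nonneg _) ?_ 2
    rw [h.succ, sub_add_eq_add_sub]
    exact norm_posVec_sub_le _ hy
  have hsq : ‖β k ω - c k ω‖ ^ 2 ≤ (2 * C) ^ 2 :=
    pow_le_pow_left₀ (norm_nonneg _) (h.norm_arrival_sub_service_le k ω) 2
  have hopt : support (O (γ k ω)) (w k ω) ≤ inner ℝ (w k ω) (c k ω) :=
    support_le (h.nonempty _) (h.optimal k ω)
  have hy' := inner_le_support (h.bound _) y (h.mem k ω)
  rw [norm_add_sq_real, inner_sub_right, inner_sub_left _ _ (c k ω)] at hstep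
  rw [driftBound]
  linarith

lemma abs_driftBound_le (h : IsMaxWeight Pr O π b C w β c γ) (x y : EuclideanSpace ℝ J) (k : ℕ)
    (ω : Ω) : |driftBound O C x y (β k ω, γ k ω)| ≤ 4 * C * (‖x‖ + ‖y‖) + 4 * C ^ 2 := by
  have hinner : |inner ℝ (x - y) (β k ω)| ≤ C * (‖x‖ + ‖y‖) := by
    rw [mul_comm]
    exact (abs_real_inner_le_norm _ _).trans (mul_le_mul (norm_sub_le x y) (h.bound_arrival k ω)
      (norm_nonneg _) (by positivity))
  have hx := abs_le.1 (abs_support_le (h.nonempty (γ k ω)) (h.bound _) x)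
  have hy := abs_le.1 (abs_support_le (h.nonempty (γ k ω)) (h.bound _) y)
  have hinner := abs_le.1 hinner
  rw [driftBound, abs_le]
  constructor <;> nlinarith

lemma abs_infDist_succ_sub_le (h : IsMaxWeight Pr O π b C w β c γ)
    (K : Set (EuclideanSpace ℝ J)) (k : ℕ) (ω : Ω) :
    |Metric.infDist (w (k + 1) ω) K - Metric.infDist (w k ω) K| ≤ 2 * C := by
  have := (Metric.lipschitz_infDist_pt K).dist_le_mul (w (k + 1) ω) (w k ω)
  rw [Real.dist_eq, NNReal.coe_one, one_mul, dist_eq_norm] at this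
  exact this.trans (h.norm_succ_sub_le k ω)

lemma infDist_le (h : IsMaxWeight Pr O π b C w β c γ) {K : Set (EuclideanSpace ℝ J)}
    (h0 : 0 ∈ K) (k : ℕ) (ω : Ω) : Metric.infDist (w k ω) K ≤ 2 * C * k := by
  refine (Metric.infDist_le_dist_of_mem h0).trans ?_
  rw [dist_zero_right]
  exact h.norm_le k ω

lemma integrable_infDist [IsFiniteMeasure Pr] (h : IsMaxWeight Pr O π b C w β c γ)
    {K : Set (EuclideanSpace ℝ J)} (h0 : 0 ∈ K) (k : ℕ) :
    Integrable (fun ω => Metric.infDist (w k ω) K) Pr := by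
  refine Integrable.of_bound (h.measurable k).infDist.aestronglyMeasurable (2 * C * k)
    (ae_of_all _ fun ω => ?_)
  rw [Real.norm_of_nonneg Metric.infDist_nonneg]
  exact h.infDist_le h0 k ω

lemma integrable_exp_mul_infDist [IsFiniteMeasure Pr] (h : IsMaxWeight Pr O π b C w β c γ)
    {K : Set (EuclideanSpace ℝ J)} (h0 : 0 ∈ K) {θ : ℝ} (hθ : 0 ≤ θ) (k : ℕ) :
    Integrable (fun ω => Real.exp (θ * Metric.infDist (w k ω) K)) Pr := by
  refine Integrable.of_bound ((h.measurable k).infDist.const_mul θ).exp.aestronglyMeasurable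
    (Real.exp (θ * (2 * C * k))) (ae_of_all _ fun ω => ?_)
  rw [Real.norm_of_nonneg (Real.exp_nonneg _)]
  gcongr
  exact h.infDist_le h0 k ω

lemma integrableOn_exp_mul_infDist_div [IsFiniteMeasure Pr] (h : IsMaxWeight Pr O π b C w β c γ)
    {K : Set (EuclideanSpace ℝ J)} (h0 : 0 ∈ K) {θ U₀ : ℝ} (hU₀ : 0 < U₀) (hθ : 0 ≤ θ) (k : ℕ) :
    IntegrableOn (fun ω => Real.exp (θ * Metric.infDist (w k ω) K) /
      (2 * Metric.infDist (w k ω) K)) {ω | U₀ ≤ Metric.infDist (w k ω) K} Pr := by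
  have hd := (h.measurable k).infDist (s := K)
  refine ((h.integrable_exp_mul_infDist h0 hθ k).div_const (2 * U₀)).integrableOn.mono'
    ((hd.const_mul θ).exp.div (hd.const_mul 2)).aestronglyMeasurable
    (ae_restrict_of_forall_mem (measurableSet_le measurable_const hd) fun ω hω => ?_)
  rw [Real.norm_of_nonneg (div_nonneg (Real.exp_nonneg _) (by positivity [hU₀.trans_le hω]))]
  gcongr
  exact hω

section Measurability

variable [MeasurableSingletonClass M]

section Countable

variable [Countable M]

lemma measurable_support (h : IsMaxWeight Pr O π b C w β c γ) :
    Measurable fun z : EuclideanSpace ℝ J × M => support (O z.2) z.1 :=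
  measurable_from_prod_countable_left fun m =>
    (lipschitzWith_support (h.nonempty m) (h.bound m)).continuous.measurable

lemma measurable_driftBound (h : IsMaxWeight Pr O π b C w β c γ)
    {p : EuclideanSpace ℝ J → EuclideanSpace ℝ J} (hp : Measurable p) :
    Measurable fun z : EuclideanSpace ℝ J × EuclideanSpace ℝ J × M =>
      driftBound O C z.1 (p z.1) z.2 := by
  have hstate : Measurable fun z : EuclideanSpace ℝ J × EuclideanSpace ℝ J × M => z.2.2 :=
    measurable_snd.snd
  have hx := h.measurable_support.comp (measurable_fst.prodMk hstate)
  have hy := h.measurable_support.comp ((hp.comp measurable_fst).prodMk hstate)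
  have hinner : Measurable fun z : EuclideanSpace ℝ J × EuclideanSpace ℝ J × M =>
      inner ℝ (z.1 - p z.1) z.2.1 :=
    (measurable_fst.sub (hp.comp measurable_fst)).inner measurable_snd.fst
  exact (((hinner.const_mul 2).sub (hx.const_mul 2)).add (hy.const_mul 2)).add_const _

end Countable

variable [Fintype M] [IsProbabilityMeasure Pr]

lemma integral_support (h : IsMaxWeight Pr O π b C w β c γ) (x : EuclideanSpace ℝ J) (k : ℕ) :
    Integrable (fun ω => support (O (γ k ω)) x) Pr ∧
      ∫ ω, support (O (γ k ω)) x ∂Pr = meanSupport π O x := by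
  have hmeas : Measurable fun m => support (O m) x := measurable_of_finite _
  have : IsProbabilityMeasure (Pr.map (γ k)) :=
    Measure.isProbabilityMeasure_map (h.measurable_state k).aemeasurable
  have hint : Integrable (fun m => support (O m) x) (Pr.map (γ k)) := .of_finite
  refine ⟨hint.comp_measurable (h.measurable_state k), ?_⟩
  rw [← integral_map (h.measurable_state k).aemeasurable hmeas.aestronglyMeasurable,
    integral_fintype hint]
  refine Finset.sum_congr rfl fun m _ => ?_
  rw [map_measureReal_apply (h.measurable_state k) (measurableSet_singleton m), smul_eq_mul,
    ← h.prob_state k m]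
  rfl

lemma integral_driftBound (h : IsMaxWeight Pr O π b C w β c γ) (x y : EuclideanSpace ℝ J)
    (k : ℕ) : ∫ ω, driftBound O C x y (β k ω, γ k ω) ∂Pr =
      2 * (inner ℝ (x - y) b - meanSupport π O x + meanSupport π O y) + 4 * C ^ 2 := by
  have hβ : Integrable (β k) Pr :=
    Integrable.of_bound (h.measurable_arrival k).aestronglyMeasurable C
      (ae_of_all _ (h.bound_arrival k))
  have hinner : Integrable (fun ω => inner ℝ (x - y) (β k ω)) Pr := hβ.const_inner _
  obtain ⟨hx, hx_eq⟩ := h.integral_support x k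
  obtain ⟨hy, hy_eq⟩ := h.integral_support y k
  have hsub : Integrable (fun ω => inner ℝ (x - y) (β k ω) - support (O (γ k ω)) x) Pr :=
    hinner.sub hx
  have hadd : Integrable (fun ω =>
      2 * (inner ℝ (x - y) (β k ω) - support (O (γ k ω)) x + support (O (γ k ω)) y)) Pr :=
    (hsub.add hy).const_mul 2
  calc ∫ ω, driftBound O C x y (β k ω, γ k ω) ∂Pr
      = ∫ ω, (2 * (inner ℝ (x - y) (β k ω) - support (O (γ k ω)) x + support (O (γ k ω)) y)
          + 4 * C ^ 2) ∂Pr := by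
        congr 1 with ω
        rw [driftBound]
        ring
    _ = 2 * (inner ℝ (x - y) b - meanSupport π O x + meanSupport π O y) + 4 * C ^ 2 := by
        rw [integral_add hadd (integrable_const _), integral_const_mul, integral_add hsub hy,
          integral_sub hinner hx, integral_inner hβ, h.mean_arrival, hx_eq, hy_eq]
        simp

/-- Conditioning on the current queues, which are independent of the arrivals and the state, turns
the drift bound into its mean. -/
lemma integral_le_of_le_mul_driftBound (h : IsMaxWeight Pr O π b C w β c γ) (k : ℕ)
    {f g : EuclideanSpace ℝ J → ℝ} {p : EuclideanSpace ℝ J → EuclideanSpace ℝ J} {Z : Ω → ℝ}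
    (hf : Measurable f) (hfint : Integrable (fun ω => f (w k ω)) Pr) (hp : Measurable p)
    (hpnorm : ∀ x, ‖p x‖ ≤ ‖x‖) (hZ : Integrable Z Pr)
    (hZle : ∀ ω, Z ω ≤ f (w k ω) * driftBound O C (w k ω) (p (w k ω)) (β k ω, γ k ω))
    (hg : Integrable (fun ω => g (w k ω)) Pr)
    (hfg : ∀ᵐ ω ∂Pr, f (w k ω) * (2 * (inner ℝ (w k ω - p (w k ω)) b - meanSupport π O (w k ω)
      + meanSupport π O (p (w k ω))) + 4 * C ^ 2) ≤ g (w k ω)) :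
    ∫ ω, Z ω ∂Pr ≤ ∫ ω, g (w k ω) ∂Pr := by
  have hC : 0 ≤ C := by
    obtain ⟨ω⟩ := nonempty_of_isProbabilityMeasure Pr
    exact (norm_nonneg _).trans (h.bound_arrival 0 ω)
  have hpair := (h.measurable_arrival k).prodMk (h.measurable_state k)
  have hdrift := h.measurable_driftBound hp
  have hint : Integrable
      (fun ω => f (w k ω) * driftBound O C (w k ω) (p (w k ω)) (β k ω, γ k ω)) Pr := by
    refine hfint.mul_bdd (c := 4 * C * (2 * C * k + 2 * C * k) + 4 * C ^ 2)
      (hdrift.comp ((h.measurable k).prodMk hpair)).aestronglyMeasurable (ae_of_all _ fun ω => ?_)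
    refine (h.abs_driftBound_le _ _ k ω).trans ?_
    gcongr
    exacts [h.norm_le k ω, (hpnorm _).trans (h.norm_le k ω)]
  refine (integral_mono hZ hint hZle).trans (integral_comp_le_of_indepFun
    (F := fun x ξ => f x * driftBound O C x (p x) ξ) (h.measurable k) hpair (h.indep k)
    ((hf.comp measurable_fst).mul hdrift) hint hg ?_)
  filter_upwards [hfg] with ω hω
  rwa [integral_const_mul, h.integral_driftBound]

lemma setIntegral_le_of_le_mul_driftBound (h : IsMaxWeight Pr O π b C w β c γ) (k : ℕ)
    {S : Set (EuclideanSpace ℝ J)} {f g : EuclideanSpace ℝ J → ℝ}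
    {p : EuclideanSpace ℝ J → EuclideanSpace ℝ J} {Z : Ω → ℝ} (hS : MeasurableSet S)
    (hf : Measurable f) (hfint : IntegrableOn (fun ω => f (w k ω)) {ω | w k ω ∈ S} Pr)
    (hp : Measurable p) (hpnorm : ∀ x, ‖p x‖ ≤ ‖x‖) (hZ : IntegrableOn Z {ω | w k ω ∈ S} Pr)
    (hZle : ∀ ω, w k ω ∈ S →
      Z ω ≤ f (w k ω) * driftBound O C (w k ω) (p (w k ω)) (β k ω, γ k ω))
    (hg : IntegrableOn (fun ω => g (w k ω)) {ω | w k ω ∈ S} Pr)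
    (hfg : ∀ᵐ ω ∂Pr, w k ω ∈ S → f (w k ω) * (2 * (inner ℝ (w k ω - p (w k ω)) b
      - meanSupport π O (w k ω) + meanSupport π O (p (w k ω))) + 4 * C ^ 2) ≤ g (w k ω)) :
    ∫ ω in {ω | w k ω ∈ S}, Z ω ∂Pr ≤ ∫ ω in {ω | w k ω ∈ S}, g (w k ω) ∂Pr := by
  have hpre : MeasurableSet {ω | w k ω ∈ S} := h.measurable k hS
  rw [← integral_indicator hpre, ← integral_indicator hpre]
  refine h.integral_le_of_le_mul_driftBound k (f := S.indicator f) (g := S.indicator g)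
    (hf.indicator hS) ((integrable_indicator_iff hpre).2 hfint) hp hpnorm
    ((integrable_indicator_iff hpre).2 hZ) (fun ω => ?_) ((integrable_indicator_iff hpre).2 hg) ?_
  · by_cases hω : w k ω ∈ S
    · simpa [hω] using hZle ω hω
    · simp [hω]
  · filter_upwards [hfg] with ω hfgω
    by_cases hω : w k ω ∈ S
    · simpa [hω] using hfgω hω
    · simp [hω]

end Measurability

/-! ### Rate stability and bounded distance from the tight cone -/

section Stability

variable [Fintype M] [MeasurableSingletonClass M] [IsProbabilityMeasure Pr]

lemma integral_norm_sq_le (h : IsMaxWeight Pr O π b C w β c γ)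
    (hb : ∀ v : EuclideanSpace ℝ J, (∀ j, 0 ≤ v j) → inner ℝ v b ≤ meanSupport π O v) (k : ℕ) :
    ∫ ω, ‖w k ω‖ ^ 2 ∂Pr ≤ 4 * C ^ 2 * k := by
  induction k with
  | zero => simp [h.zero]
  | succ k ih =>
    have hdrift := h.integral_le_of_le_mul_driftBound k (f := fun _ => 1) (p := fun _ => 0)
      (g := fun _ => 4 * C ^ 2) (Z := fun ω => ‖w (k + 1) ω‖ ^ 2 - ‖w k ω‖ ^ 2) measurable_const
      (integrable_const _) measurable_const (by simp)
      ((h.integrable_norm_sq (k + 1)).sub (h.integrable_norm_sq k))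
      (fun ω => by simpa using h.norm_sq_succ_sub_le k ω (y := 0) (by simp))
      (integrable_const _) (ae_of_all _ fun ω => by
        simp only [sub_zero, meanSupport_zero h.nonempty, one_mul]
        linarith [hb (w k ω) (h.nonneg k ω)])
    rw [integral_sub (h.integrable_norm_sq (k + 1)) (h.integrable_norm_sq k)] at hdrift
    simp only [integral_const, probReal_univ, one_smul] at hdrift
    push_cast
    linarith

lemma ae_tendsto_div (h : IsMaxWeight Pr O π b C w β c γ)
    (hb : ∀ v : EuclideanSpace ℝ J, (∀ j, 0 ≤ v j) → inner ℝ v b ≤ meanSupport π O v) :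
    ∀ᵐ ω ∂Pr, ∀ j, Tendsto (fun k : ℕ => w k ω j / k) atTop (𝓝 0) := by
  have hsquares : ∀ᵐ ω ∂Pr,
      Tendsto (fun n : ℕ => ‖w (n ^ 2) ω‖ ^ 2 / ((n : ℝ) ^ 2) ^ 2) atTop (𝓝 0) := by
    refine ae_tendsto_zero_of_summable_integral (fun n => (h.integrable_norm_sq _).div_const _)
      (fun n ω => by positivity) (Summable.of_nonneg_of_le
        (fun n => integral_nonneg fun ω => by positivity) (fun n => ?_)
        ((Real.summable_one_div_nat_pow.2 one_lt_two).mul_left (4 * C ^ 2)))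
    rw [integral_div]
    obtain rfl | hn := eq_or_ne n 0
    · simp
    · have hmean := h.integral_norm_sq_le hb (n ^ 2)
      push_cast at hmean
      rw [div_le_iff₀ (by positivity)]
      refine hmean.trans (le_of_eq ?_)
      field_simp
  filter_upwards [hsquares] with ω hω j
  have hroot : Tendsto (fun n : ℕ => ‖w (n ^ 2) ω‖ / (n : ℝ) ^ 2) atTop (𝓝 0) := by
    have := hω.sqrt
    simp only [← div_pow, Real.sqrt_zero] at this
    exact this.congr fun n => Real.sqrt_sq (by positivity)
  have hnorm : Tendsto (fun k : ℕ => ‖w k ω‖ / k) atTop (𝓝 0) :=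
    tendsto_div_of_tendsto_squares (M := 2 * C) (fun k => by
      linarith [norm_le_norm_add_norm_sub' (w (k + 1) ω) (w k ω), h.norm_succ_sub_le k ω]) hroot
  refine squeeze_zero (fun k => div_nonneg (h.nonneg k ω j) k.cast_nonneg) (fun k => ?_) hnorm
  gcongr
  exact (Real.le_norm_self _).trans (PiLp.norm_apply_le _ j)

variable {K : Set (EuclideanSpace ℝ J)} {κ θ U₀ : ℝ}

lemma setIntegral_exp_mul_infDist_sub_le (h : IsMaxWeight Pr O π b C w β c γ)
    (hcl : IsClosed K) (hK : Convex ℝ K) (h0 : 0 ∈ K) (hKtight : K ⊆ tightCone π O b)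
    (hU₀ : 0 < U₀) (hκ : 4 * C ^ 2 ≤ κ * U₀) (hθ : 0 ≤ θ) (k : ℕ)
    (hslack : ∀ᵐ ω ∂Pr,
      κ * Metric.infDist (w k ω) K ≤ meanSupport π O (w k ω) - inner ℝ (w k ω) b) :
    ∫ ω in {ω | U₀ ≤ Metric.infDist (w k ω) K}, Real.exp (θ * Metric.infDist (w k ω) K) *
        (Metric.infDist (w (k + 1) ω) K - Metric.infDist (w k ω) K) ∂Pr ≤
      -(κ / 2) * ∫ ω in {ω | U₀ ≤ Metric.infDist (w k ω) K},
        Real.exp (θ * Metric.infDist (w k ω) K) ∂Pr := by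
  obtain ⟨p, hplip, hp⟩ := exists_metricProjection ⟨0, h0⟩ hcl hK
  have hpnorm : ∀ x, ‖p x‖ ≤ ‖x‖ := fun x => by
    have hp0 : p 0 = 0 := by simpa [Metric.infDist_zero_of_mem h0] using (hp 0).2
    simpa using hplip.norm_le_mul hp0 x
  have hd : Measurable fun x : EuclideanSpace ℝ J => Metric.infDist x K := measurable_id.infDist
  have hexp := h.integrable_exp_mul_infDist h0 hθ k
  have hdist : ∀ l, AEStronglyMeasurable (fun ω => Metric.infDist (w l ω) K) Pr :=
    fun l => (h.measurable l).infDist.aestronglyMeasurable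
  rw [← integral_const_mul]
  refine h.setIntegral_le_of_le_mul_driftBound k (S := {x | U₀ ≤ Metric.infDist x K})
    (p := p) (f := fun x => Real.exp (θ * Metric.infDist x K) / (2 * Metric.infDist x K))
    (g := fun x => -(κ / 2) * Real.exp (θ * Metric.infDist x K))
    (measurableSet_le measurable_const hd) ((hd.const_mul θ).exp.div (hd.const_mul 2))
    (h.integrableOn_exp_mul_infDist_div h0 hU₀ hθ k) hplip.continuous.measurable hpnorm
    (hexp.mul_bdd (c := 2 * C) ((hdist (k + 1)).sub (hdist k))
      (ae_of_all _ fun ω => h.abs_infDist_succ_sub_le K k ω)).integrableOn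
    (fun ω hω => ?_) (hexp.const_mul _).integrableOn ?_
  · have hpos : 0 < Metric.infDist (w k ω) K := hU₀.trans_le hω
    rw [div_mul_eq_mul_div, ← mul_div_assoc']
    exact mul_le_mul_of_nonneg_left ((infDist_sub_infDist_le (hp _).1 (hp _).2 hpos).trans
      (div_le_div_of_nonneg_right (h.norm_sq_succ_sub_le k ω (hKtight (hp _).1).1)
        (by positivity))) (Real.exp_nonneg _)
  · filter_upwards [hslack] with ω hω hfar
    have hpos : 0 < Metric.infDist (w k ω) K := hU₀.trans_le hfar
    have hκd : κ * U₀ ≤ κ * Metric.infDist (w k ω) K :=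
      mul_le_mul_of_nonneg_left hfar (nonneg_of_mul_nonneg_left (hκ.trans' (by positivity)) hU₀)
    have htight := (hKtight (hp (w k ω)).1).2
    rw [inner_sub_left, div_mul_eq_mul_div, div_le_iff₀ (by positivity)]
    refine (mul_le_mul_of_nonneg_left (c := -κ * Metric.infDist (w k ω) K) ?_
      (Real.exp_nonneg _)).trans (le_of_eq (by ring))
    linarith

lemma exists_integral_infDist_le (h : IsMaxWeight Pr O π b C w β c γ)
    (hcl : IsClosed K) (hK : Convex ℝ K) (h0 : 0 ∈ K) (hKtight : K ⊆ tightCone π O b)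
    (hκ : 0 < κ) (hslack : ∀ k, ∀ᵐ ω ∂Pr, κ * Metric.infDist (w k ω) K ≤
      meanSupport π O (w k ω) - inner ℝ (w k ω) b) :
    ∃ B : ℝ, ∀ k, ∫ ω, Metric.infDist (w k ω) K ∂Pr ≤ B := by
  refine exists_integral_le_of_drift (M := 2 * C) (η := κ / 2) (U₀ := (4 * C ^ 2 + 1) / κ)
    (fun k => (h.measurable k).infDist)
    (fun ω => by rw [h.zero]; exact Metric.infDist_zero_of_mem h0) (half_pos hκ)
    (h.abs_infDist_succ_sub_le K) fun θ hθ k =>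
      h.setIntegral_exp_mul_infDist_sub_le hcl hK h0 hKtight
        (by positivity) ?_ hθ.le k (hslack k)
  rw [mul_div_cancel₀ _ hκ.ne']
  exact (lt_add_one _).le

end Stability

end IsMaxWeight

end MaxWeight

/-! ### Slot outcomes as vectors -/

lemma rate_nonneg {p g : ℝ} (hp : 0 ≤ p) (hg : 0 ≤ g) : 0 ≤ rate p g :=
  Real.log_nonneg (by linarith [mul_nonneg hp hg])

lemma rate_le {p g : ℝ} (hp : 0 ≤ p) (hg : 0 ≤ g) : rate p g ≤ p * g := by
  have := Real.log_le_sub_one_of_pos (show 0 < 1 + p * g by linarith [mul_nonneg hp hg])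
  unfold rate
  linarith

lemma inner_le_of_frequently_le_average {J : Type*} [Fintype J] {u : ℕ → EuclideanSpace ℝ J}
    {v x : EuclideanSpace ℝ J} {σ : ℕ → ℝ} {s : ℝ} (hv : ∀ j, 0 ≤ v j)
    (hu : ∀ k, inner ℝ v (u k) ≤ σ k)
    (hσ : Tendsto (fun K : ℕ => (∑ k ∈ Finset.range K, σ k) / K) atTop (𝓝 s))
    (hx : ∀ e : ℝ, 0 < e →
      ∃ᶠ K : ℕ in atTop, ∀ j, x j - e ≤ (∑ k ∈ Finset.range K, u k j) / K) :
    inner ℝ v x ≤ s := by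
  have hlim : Tendsto (fun e : ℝ => inner ℝ v x - e * ∑ j, v j) (𝓝[>] 0) (𝓝 (inner ℝ v x)) :=
    (Continuous.tendsto' (by fun_prop) _ _ (by simp)).mono_left nhdsWithin_le_nhds
  refine le_of_tendsto hlim (eventually_mem_nhdsWithin.mono fun e he =>
    ge_of_tendsto_of_frequently hσ ((hx e he).mono fun K hK => ?_))
  calc inner ℝ v x - e * ∑ j, v j = ∑ j, v j * (x j - e) := by
        simp only [inner_eq_sum_mul, mul_sub, Finset.sum_sub_distrib, Finset.sum_mul, mul_comm e]
    _ ≤ ∑ j, v j * ((∑ k ∈ Finset.range K, u k j) / K) := by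
        gcongr with j
        exacts [hv j, hK j]
    _ = (∑ k ∈ Finset.range K, inner ℝ v (u k)) / K := by
        simp only [inner_eq_sum_mul, ← mul_div_assoc, ← Finset.sum_div, Finset.mul_sum]
        rw [Finset.sum_comm]
    _ ≤ (∑ k ∈ Finset.range K, σ k) / K := by
        gcongr with k
        exact hu k

lemma inner_le_of_le_average {J : Type*} [Fintype J] {u : ℕ → EuclideanSpace ℝ J}
    {v x : EuclideanSpace ℝ J} {s : ℝ} (hv : ∀ j, 0 ≤ v j) (hu : ∀ k, inner ℝ v (u k) ≤ s)
    (hx : ∀ j, ∀ e : ℝ, 0 < e →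
      ∀ᶠ K : ℕ in atTop, x j - e ≤ (∑ k ∈ Finset.range K, u k j) / K) :
    inner ℝ v x ≤ s := by
  refine inner_le_of_frequently_le_average hv hu (tendsto_const_nhds.congr' ?_)
    fun e he => (eventually_all.2 fun j => hx j e he).frequently
  filter_upwards [eventually_ne_atTop 0] with K hK
  rw [Finset.sum_const, Finset.card_range, nsmul_eq_mul,
    mul_div_cancel_left₀ _ (Nat.cast_ne_zero.2 hK)]

namespace System

variable {nR nN : ℕ} (S : System nR nN)

/-- Space of the queues: `none` is the power queue, `some i` the queue of user `i`. -/
abbrev QueueSpace (nR nN : ℕ) : Type := EuclideanSpace ℝ (Option (User nR nN))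

open Classical in
/-- The decrease of all queues in a slot with fading state `m` and allocation `(μ, P)`. Consumed
power counts as negative. -/
def outcome (m : S.State) (μ P : User nR nN → ℝ) : QueueSpace nR nN :=
  WithLp.toLp 2 fun
    | none => -((∑ i, P i * μ i) / S.Ts)
    | some (Sum.inl i) => if μ (Sum.inl i) = 0 then 0 else 1
    | some (Sum.inr i) => μ (Sum.inr i) * rate (P (Sum.inr i)) (m (Sum.inr i))

/-- The outcomes possible in state `m`. -/
def outcomes (m : S.State) : Set (QueueSpace nR nN) :=
  {o | ∃ μ P, S.IsSlotAllocation m μ P ∧ S.outcome m μ P = o}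

/-- The increase of all queues caused by the arrivals `a`. -/
def inflow (a : User nR nN → ℝ) : QueueSpace nR nN :=
  WithLp.toLp 2 fun
    | none => -S.Pavg
    | some (Sum.inl i) => a (Sum.inl i) * S.q i
    | some (Sum.inr i) => S.L * a (Sum.inr i)

/-- The mean inflow for the NRT rates `lam`. -/
def target (lam : Fin nN → ℝ) : QueueSpace nR nN := S.inflow (Sum.elim S.rateR lam)

@[simp] lemma outcome_none (m : S.State) (μ P : User nR nN → ℝ) :
    S.outcome m μ P none = -((∑ i, P i * μ i) / S.Ts) := rfl

open Classical in
@[simp] lemma outcome_inl (m : S.State) (μ P : User nR nN → ℝ) (i : Fin nR) :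
    S.outcome m μ P (some (Sum.inl i)) = if μ (Sum.inl i) = 0 then 0 else 1 := rfl

@[simp] lemma outcome_inr (m : S.State) (μ P : User nR nN → ℝ) (i : Fin nN) :
    S.outcome m μ P (some (Sum.inr i)) =
      μ (Sum.inr i) * rate (P (Sum.inr i)) (m (Sum.inr i)) := rfl

@[simp] lemma inflow_none (a : User nR nN → ℝ) : S.inflow a none = -S.Pavg := rfl

@[simp] lemma inflow_inl (a : User nR nN → ℝ) (i : Fin nR) :
    S.inflow a (some (Sum.inl i)) = a (Sum.inl i) * S.q i := rfl

@[simp] lemma inflow_inr (a : User nR nN → ℝ) (i : Fin nN) :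
    S.inflow a (some (Sum.inr i)) = S.L * a (Sum.inr i) := rfl

@[simp] lemma target_none (lam : Fin nN → ℝ) : S.target lam none = -S.Pavg := rfl

@[simp] lemma target_inl (lam : Fin nN → ℝ) (i : Fin nR) :
    S.target lam (some (Sum.inl i)) = S.rateR i * S.q i := rfl

@[simp] lemma target_inr (lam : Fin nN → ℝ) (i : Fin nN) :
    S.target lam (some (Sum.inr i)) = S.L * lam i := rfl

lemma gain_nonneg (m : S.State) (i : User nR nN) : 0 ≤ (m i : ℝ) :=
  S.gains_nonneg _ (m i).2

/-- A positive bound on the gains. -/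
def gainBound : ℝ := 1 + ∑ g ∈ S.gains, g

lemma gainBound_pos : 0 < S.gainBound :=
  add_pos_of_pos_of_nonneg one_pos (Finset.sum_nonneg S.gains_nonneg)

lemma gain_le (m : S.State) (i : User nR nN) : (m i : ℝ) ≤ S.gainBound := by
  have := Finset.single_le_sum (f := fun g => g) S.gains_nonneg (m i).2
  rw [gainBound]
  linarith

/-- A bound on the coordinates of the outcomes. -/
def outcomeBound : ℝ := 1 + S.Pmax + S.gainBound * (S.Pmax * S.Ts)

lemma zero_mem_outcomes (m : S.State) : (0 : QueueSpace nR nN) ∈ S.outcomes m := by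
  refine ⟨0, 0, ⟨by simp, by simpa using S.Ts_pos.le, by simp, fun _ => S.Pmax_pos.le,
    by simp⟩, ?_⟩
  ext j
  rcases j with _ | i | i <;> simp

lemma outcomes_nonempty (m : S.State) : (S.outcomes m).Nonempty := ⟨0, S.zero_mem_outcomes m⟩

namespace IsSlotAllocation

variable {S} {m : S.State} {μ P : User nR nN → ℝ} (h : S.IsSlotAllocation m μ P)

include h

lemma service_nonneg (i : User nR nN) : 0 ≤ μ i * rate (P i) (m i) :=
  mul_nonneg (h.time_nonneg i) (rate_nonneg (h.power_nonneg i) (S.gain_nonneg m i))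

lemma energy_nonneg (i : User nR nN) : 0 ≤ P i * μ i :=
  mul_nonneg (h.power_nonneg i) (h.time_nonneg i)

lemma service_le (i : User nR nN) : μ i * rate (P i) (m i) ≤ S.gainBound * (P i * μ i) := by
  calc μ i * rate (P i) (m i) ≤ μ i * (P i * S.gainBound) := by
        refine mul_le_mul_of_nonneg_left ?_ (h.time_nonneg i)
        exact (rate_le (h.power_nonneg i) (S.gain_nonneg m i)).trans
          (mul_le_mul_of_nonneg_left (S.gain_le m i) (h.power_nonneg i))
    _ = S.gainBound * (P i * μ i) := by ring

lemma sum_energy_le : ∑ i, P i * μ i ≤ S.Pmax * S.Ts := by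
  calc ∑ i, P i * μ i ≤ ∑ i, S.Pmax * μ i :=
        Finset.sum_le_sum fun i _ => mul_le_mul_of_nonneg_right (h.power_le i) (h.time_nonneg i)
    _ = S.Pmax * ∑ i, μ i := (Finset.mul_sum ..).symm
    _ ≤ S.Pmax * S.Ts := mul_le_mul_of_nonneg_left h.time_sum S.Pmax_pos.le

open Classical in
lemma service_eq (i : Fin nR) : μ (Sum.inl i) * rate (P (Sum.inl i)) (m (Sum.inl i)) =
    S.L * if μ (Sum.inl i) = 0 then 0 else 1 := by
  obtain h0 | hL := h.whole_packet i
  · simp [h0]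
  · have : μ (Sum.inl i) ≠ 0 := left_ne_zero_of_mul (hL ▸ S.L_pos.ne')
    simp [this, hL]

lemma abs_outcome_le (j : Option (User nR nN)) : |S.outcome m μ P j| ≤ S.outcomeBound := by
  have hG := S.gainBound_pos
  have hT := S.Ts_pos
  have hP := S.Pmax_pos
  have hprod : 0 ≤ S.gainBound * (S.Pmax * S.Ts) := by positivity
  rw [outcomeBound]
  rcases j with _ | i | i
  · have hdiv : (∑ i, P i * μ i) / S.Ts ≤ S.Pmax := (div_le_iff₀ hT).2 h.sum_energy_le
    rw [outcome_none, abs_neg, abs_of_nonneg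
      (div_nonneg (Finset.sum_nonneg fun i _ => h.energy_nonneg i) hT.le)]
    linarith
  · rw [outcome_inl]
    split_ifs
    · rw [abs_zero]
      linarith
    · rw [abs_one]
      linarith
  · have hle : P (Sum.inr i) * μ (Sum.inr i) ≤ S.Pmax * S.Ts :=
      (Finset.single_le_sum (fun i _ => h.energy_nonneg i) (Finset.mem_univ _)).trans
        h.sum_energy_le
    rw [outcome_inr, abs_of_nonneg (h.service_nonneg _)]
    linarith [h.service_le (Sum.inr i), mul_le_mul_of_nonneg_left hle hG.le]

end IsSlotAllocation

lemma abs_inflow_le {a : User nR nN → ℝ} (ha : ∀ i, a i ∈ Set.Icc (0 : ℝ) 1)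
    (j : Option (User nR nN)) : |S.inflow a j| ≤ 1 + S.Pavg + S.L := by
  have hL := S.L_pos
  have hP := S.Pavg_pos
  rcases j with _ | i | i
  · rw [inflow_none, abs_neg, abs_of_pos hP]
    linarith
  · obtain ⟨ha0, ha1⟩ := ha (Sum.inl i)
    obtain ⟨hq0, hq1⟩ := S.q_mem i
    rw [inflow_inl, abs_of_nonneg (mul_nonneg ha0 hq0)]
    linarith [mul_le_one₀ ha1 hq0 hq1]
  · obtain ⟨ha0, ha1⟩ := ha (Sum.inr i)
    rw [inflow_inr, abs_of_nonneg (mul_nonneg hL.le ha0)]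
    linarith [mul_le_of_le_one_right hL.le ha1]

lemma exists_norm_bound : ∃ C : ℝ, (∀ m, ∀ o ∈ S.outcomes m, ‖o‖ ≤ C) ∧
    ∀ a : User nR nN → ℝ, (∀ i, a i ∈ Set.Icc (0 : ℝ) 1) → ‖S.inflow a‖ ≤ C := by
  refine ⟨max (∑ _ : Option (User nR nN), S.outcomeBound)
    (∑ _ : Option (User nR nN), (1 + S.Pavg + S.L)), ?_, fun a ha => ?_⟩
  · rintro m _ ⟨μ, P, h, rfl⟩
    exact (norm_le_sum_abs _).trans
      ((Finset.sum_le_sum fun j _ => h.abs_outcome_le j).trans (le_max_left _ _))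
  · exact (norm_le_sum_abs _).trans
      ((Finset.sum_le_sum fun j _ => S.abs_inflow_le ha j).trans (le_max_right _ _))

/-! ### Mean outcomes of state-dependent allocations -/

/-- The outcome of a state-dependent allocation, averaged over the fading states. -/
def meanOutcome (μ P : S.State → User nR nN → ℝ) : QueueSpace nR nN :=
  ∑ m, S.prob m • S.outcome m (μ m) (P m)

lemma meanOutcome_apply (μ P : S.State → User nR nN → ℝ) (j : Option (User nR nN)) :
    S.meanOutcome μ P j = ∑ m, S.prob m * S.outcome m (μ m) (P m) j := by
  simp [meanOutcome]

lemma meanOutcome_none (μ P : S.State → User nR nN → ℝ) :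
    S.meanOutcome μ P none = -S.meanPower μ P := by
  rw [meanOutcome_apply, meanPower, Finset.sum_div, ← Finset.sum_neg_distrib]
  refine Finset.sum_congr rfl fun m _ => ?_
  simp only [outcome_none, mul_comm (P m _)]
  ring

lemma meanOutcome_inr (μ P : S.State → User nR nN → ℝ) (i : Fin nN) :
    S.meanOutcome μ P (some (Sum.inr i)) = S.L * S.meanService μ P (Sum.inr i) := by
  rw [meanOutcome_apply, meanService, mul_div_cancel₀ _ S.L_pos.ne']
  exact Finset.sum_congr rfl fun m _ => by rw [outcome_inr, mul_comm]

section Allocation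

variable {S} {μ P : S.State → User nR nN → ℝ} (h : ∀ m, S.IsSlotAllocation m (μ m) (P m))

include h

lemma meanOutcome_inl (i : Fin nR) :
    S.meanOutcome μ P (some (Sum.inl i)) = S.meanService μ P (Sum.inl i) := by
  rw [meanOutcome_apply, meanService, Finset.sum_div]
  refine Finset.sum_congr rfl fun m _ => ?_
  rw [outcome_inl, (h m).service_eq i]
  field_simp [S.L_pos.ne']

lemma norm_meanOutcome_le {C : ℝ} (hC : ∀ m, ∀ o ∈ S.outcomes m, ‖o‖ ≤ C) :
    ‖S.meanOutcome μ P‖ ≤ C := by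
  calc ‖S.meanOutcome μ P‖ ≤ ∑ m, S.prob m * C := by
        refine norm_sum_le_of_le _ fun m _ => ?_
        rw [norm_smul, Real.norm_of_nonneg (S.prob_nonneg m)]
        exact mul_le_mul_of_nonneg_left (hC m _ ⟨_, _, h m, rfl⟩) (S.prob_nonneg m)
    _ = C := by rw [← Finset.sum_mul, S.prob_sum, one_mul]

lemma abs_meanOutcome_le (j : Option (User nR nN)) : |S.meanOutcome μ P j| ≤ S.outcomeBound := by
  rw [meanOutcome_apply]
  calc |∑ m, S.prob m * S.outcome m (μ m) (P m) j| ≤ ∑ m, S.prob m * S.outcomeBound := by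
        refine (Finset.abs_sum_le_sum_abs _ _).trans (Finset.sum_le_sum fun m _ => ?_)
        rw [abs_mul, abs_of_nonneg (S.prob_nonneg m)]
        exact mul_le_mul_of_nonneg_left ((h m).abs_outcome_le j) (S.prob_nonneg m)
    _ = S.outcomeBound := by rw [← Finset.sum_mul, S.prob_sum, one_mul]

lemma abs_meanService_le (i : Fin nR) : |S.meanService μ P (Sum.inl i)| ≤ S.outcomeBound := by
  rw [← meanOutcome_inl h i]
  exact abs_meanOutcome_le h _

lemma abs_meanPower_le : |S.meanPower μ P| ≤ S.outcomeBound := by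
  rw [← abs_neg, ← S.meanOutcome_none]
  exact abs_meanOutcome_le h _

lemma meanService_nonneg (i : User nR nN) : 0 ≤ S.meanService μ P i :=
  div_nonneg (Finset.sum_nonneg fun m _ => mul_nonneg ((h m).service_nonneg i) (S.prob_nonneg m))
    S.L_pos.le

lemma inner_meanOutcome_le (v : QueueSpace nR nN) :
    inner ℝ v (S.meanOutcome μ P) ≤ meanSupport S.prob S.outcomes v := by
  obtain ⟨C, hC, -⟩ := S.exists_norm_bound
  rw [meanOutcome, inner_sum]
  refine Finset.sum_le_sum fun m _ => ?_
  rw [inner_smul_right]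
  exact mul_le_mul_of_nonneg_left (inner_le_support (hC m) v ⟨_, _, h m, rfl⟩) (S.prob_nonneg m)

end Allocation

lemma exists_meanSupport_le_inner_meanOutcome_add (v : QueueSpace nR nN) {e : ℝ} (he : 0 < e) :
    ∃ μ P : S.State → User nR nN → ℝ, (∀ m, S.IsSlotAllocation m (μ m) (P m)) ∧
      meanSupport S.prob S.outcomes v ≤ inner ℝ v (S.meanOutcome μ P) + e := by
  have hex : ∀ m, ∃ μ P, S.IsSlotAllocation m μ P ∧
      support (S.outcomes m) v - e < inner ℝ v (S.outcome m μ P) := fun m => by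
    obtain ⟨_, ⟨μ, P, hall, rfl⟩, hlt⟩ := exists_support_sub_lt (S.outcomes_nonempty m) v he
    exact ⟨μ, P, hall, hlt⟩
  choose μ P hall hlt using hex
  refine ⟨μ, P, hall, ?_⟩
  calc meanSupport S.prob S.outcomes v
      ≤ ∑ m, S.prob m * (inner ℝ v (S.outcome m (μ m) (P m)) + e) :=
        Finset.sum_le_sum fun m _ =>
          mul_le_mul_of_nonneg_left (by linarith [hlt m]) (S.prob_nonneg m)
    _ = inner ℝ v (S.meanOutcome μ P) + e := by
        simp only [mul_add, Finset.sum_add_distrib, ← Finset.sum_mul, S.prob_sum, one_mul,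
          meanOutcome, inner_sum, inner_smul_right]

/-! ### Shortening the NRT transmissions -/

/-- Multiply the durations of the NRT users by `ρ`. -/
def scaleNRT (ρ : Fin nN → ℝ) (μ : User nR nN → ℝ) : User nR nN → ℝ :=
  Sum.elim (fun i => μ (Sum.inl i)) fun i => ρ i * μ (Sum.inr i)

lemma IsSlotAllocation.scaleNRT {S : System nR nN} {m : S.State} {μ P : User nR nN → ℝ}
    (h : S.IsSlotAllocation m μ P) {ρ : Fin nN → ℝ} (h0 : ∀ i, 0 ≤ ρ i) (h1 : ∀ i, ρ i ≤ 1) :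
    S.IsSlotAllocation m (scaleNRT ρ μ) P := by
  have hle : ∀ i, System.scaleNRT ρ μ i ≤ μ i := by
    rintro (i | i)
    · exact le_rfl
    · exact mul_le_of_le_one_left (h.time_nonneg _) (h1 i)
  refine ⟨?_, (Finset.sum_le_sum fun i _ => hle i).trans h.time_sum, h.power_nonneg, h.power_le,
    h.whole_packet⟩
  rintro (i | i)
  · exact h.time_nonneg _
  · exact mul_nonneg (h0 i) (h.time_nonneg _)

lemma meanService_scaleNRT_inr (ρ : Fin nN → ℝ) (μ P : S.State → User nR nN → ℝ) (i : Fin nN) :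
    S.meanService (fun m => scaleNRT ρ (μ m)) P (Sum.inr i) =
      ρ i * S.meanService μ P (Sum.inr i) := by
  simp only [meanService, scaleNRT, Sum.elim_inr, mul_assoc, ← Finset.mul_sum, mul_div_assoc]

/-- The part of the mean power that user `i` consumes. -/
def meanUserPower (μ P : S.State → User nR nN → ℝ) (i : User nR nN) : ℝ :=
  (∑ m, μ m i * P m i * S.prob m) / S.Ts

lemma meanPower_eq_sum_meanUserPower (μ P : S.State → User nR nN → ℝ) :
    S.meanPower μ P = ∑ i, S.meanUserPower μ P i := by
  simp only [meanPower, meanUserPower, Finset.sum_mul, ← Finset.sum_div]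
  rw [Finset.sum_comm]

lemma meanPower_scaleNRT (ρ : Fin nN → ℝ) (μ P : S.State → User nR nN → ℝ) :
    S.meanPower (fun m => scaleNRT ρ (μ m)) P =
      S.meanPower μ P - ∑ i, (1 - ρ i) * S.meanUserPower μ P (Sum.inr i) := by
  have hinr : ∀ i, S.meanUserPower (fun m => scaleNRT ρ (μ m)) P (Sum.inr i) =
      ρ i * S.meanUserPower μ P (Sum.inr i) := fun i => by
    simp only [meanUserPower, scaleNRT, Sum.elim_inr, mul_assoc, ← Finset.mul_sum, mul_div_assoc]
  have hinl : ∀ i, S.meanUserPower (fun m => scaleNRT ρ (μ m)) P (Sum.inl i) =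
      S.meanUserPower μ P (Sum.inl i) := fun i => rfl
  simp only [meanPower_eq_sum_meanUserPower, Fintype.sum_sum_type, hinl, hinr, sub_mul, one_mul,
    Finset.sum_sub_distrib]
  ring

section Allocation

variable {S} {μ P : S.State → User nR nN → ℝ} (h : ∀ m, S.IsSlotAllocation m (μ m) (P m))

include h

lemma meanUserPower_nonneg (i : User nR nN) : 0 ≤ S.meanUserPower μ P i :=
  div_nonneg (Finset.sum_nonneg fun m _ => mul_nonneg
    (mul_nonneg ((h m).time_nonneg i) ((h m).power_nonneg i)) (S.prob_nonneg m)) S.Ts_pos.le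

lemma meanService_le_meanUserPower (i : User nR nN) :
    S.L * S.meanService μ P i ≤ S.gainBound * S.Ts * S.meanUserPower μ P i := by
  rw [meanService, meanUserPower, mul_div_cancel₀ _ S.L_pos.ne', mul_assoc,
    mul_div_cancel₀ _ S.Ts_pos.ne', Finset.mul_sum]
  refine Finset.sum_le_sum fun m _ => ?_
  rw [← mul_assoc, mul_comm (μ m i) (P m i)]
  exact mul_le_mul_of_nonneg_right ((h m).service_le i) (S.prob_nonneg m)

lemma exists_reduce_meanService {u : Fin nN → ℝ} (hu0 : ∀ i, 0 ≤ u i)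
    (hu : ∀ i, u i ≤ S.meanService μ P (Sum.inr i)) :
    ∃ μ' : S.State → User nR nN → ℝ, (∀ m, S.IsSlotAllocation m (μ' m) (P m)) ∧
      (∀ i, S.meanService μ' P (Sum.inl i) = S.meanService μ P (Sum.inl i)) ∧
      (∀ i, S.meanService μ' P (Sum.inr i) = u i) ∧ S.meanPower μ' P ≤ S.meanPower μ P := by
  set ρ : Fin nN → ℝ := fun i => u i / S.meanService μ P (Sum.inr i) with hρ
  have hρ0 : ∀ i, 0 ≤ ρ i := fun i => div_nonneg (hu0 i) (meanService_nonneg h _)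
  have hρ1 : ∀ i, ρ i ≤ 1 := fun i => div_le_one_of_le₀ (hu i) (meanService_nonneg h _)
  refine ⟨fun m => scaleNRT ρ (μ m), fun m => (h m).scaleNRT hρ0 hρ1, fun i => rfl, fun i => ?_, ?_⟩
  · rw [meanService_scaleNRT_inr, hρ]
    refine div_mul_cancel_of_imp fun h0 => le_antisymm ?_ (hu0 i)
    rw [← h0]
    exact hu i
  · rw [meanPower_scaleNRT]
    exact sub_le_self _ (Finset.sum_nonneg fun i _ =>
      mul_nonneg (sub_nonneg.2 (hρ1 i)) (meanUserPower_nonneg h _))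

end Allocation

end System

/-! ### The Lambert region in terms of support functions -/

section GreedyQueue

variable {J : Type*} [Fintype J] {b : EuclideanSpace ℝ J}
  {d : EuclideanSpace ℝ J → EuclideanSpace ℝ J} {C : ℝ}

/-- Queues with constant arrivals `b` whose departures `d` depend on the queues only. -/
def greedyQueue (b : EuclideanSpace ℝ J) (d : EuclideanSpace ℝ J → EuclideanSpace ℝ J) :
    ℕ → EuclideanSpace ℝ J
  | 0 => 0
  | k + 1 => posVec (greedyQueue b d k + (b - d (greedyQueue b d k)))

omit [Fintype J] in
lemma greedyQueue_nonneg (k : ℕ) (j : J) : 0 ≤ greedyQueue b d k j := by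
  cases k with
  | zero => exact le_rfl
  | succ k => exact le_max_right _ _

lemma sq_norm_greedyQueue_le (hd : ∀ v, ‖d v‖ ≤ C)
    (hb : ∀ v : EuclideanSpace ℝ J, (∀ j, 0 ≤ v j) → inner ℝ v b ≤ inner ℝ v (d v) + 1) (k : ℕ) :
    ‖greedyQueue b d k‖ ^ 2 ≤ ((‖b‖ + C) ^ 2 + 2) * k := by
  induction k with
  | zero => simp [greedyQueue]
  | succ k ih =>
    set w := greedyQueue b d k
    have hsucc : ‖greedyQueue b d (k + 1)‖ ^ 2 ≤ ‖w + (b - d w)‖ ^ 2 := by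
      refine pow_le_pow_left₀ (norm_nonneg _) ?_ 2
      have := norm_posVec_sub_le (w + (b - d w)) (y := 0) fun _ => le_rfl
      rwa [sub_zero, sub_zero] at this
    have hstep : ‖b - d w‖ ^ 2 ≤ (‖b‖ + C) ^ 2 :=
      pow_le_pow_left₀ (norm_nonneg _) ((norm_sub_le _ _).trans (by linarith [hd w])) 2
    rw [norm_add_sq_real, inner_sub_right] at hsucc
    push_cast
    linarith [hb w (greedyQueue_nonneg k)]

lemma tendsto_greedyQueue_div (hd : ∀ v, ‖d v‖ ≤ C)
    (hb : ∀ v : EuclideanSpace ℝ J, (∀ j, 0 ≤ v j) → inner ℝ v b ≤ inner ℝ v (d v) + 1) (j : J) :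
    Tendsto (fun k : ℕ => greedyQueue b d k j / k) atTop (𝓝 0) := by
  refine tendsto_div_of_sq_le (B := (‖b‖ + C) ^ 2 + 2) (greedyQueue_nonneg · j) fun k => ?_
  refine le_trans ?_ (sq_norm_greedyQueue_le hd hb k)
  exact pow_le_pow_left₀ (greedyQueue_nonneg k j)
    ((Real.le_norm_self _).trans (PiLp.norm_apply_le _ j)) 2

lemma exists_departures_tendsto (hd : ∀ v, ‖d v‖ ≤ C)
    (hb : ∀ v : EuclideanSpace ℝ J, (∀ j, 0 ≤ v j) → inner ℝ v b ≤ inner ℝ v (d v) + 1) :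
    ∃ w u : ℕ → EuclideanSpace ℝ J, (∀ k j, u k j ≤ d (w k) j) ∧
      (∀ k j, 0 ≤ b j → 0 ≤ d (w k) j → 0 ≤ u k j) ∧
      ∀ j, Tendsto (fun K : ℕ => (∑ k ∈ Finset.range K, u k j) / K) atTop (𝓝 (b j)) := by
  set w := greedyQueue b d
  have hsucc : ∀ k j, w (k + 1) j = max (w k j + (b j - d (w k) j)) 0 := fun k j => rfl
  refine ⟨w, fun k => b + w k - w (k + 1), fun k j => ?_, fun k j hbj hdj => ?_, fun j => ?_⟩
  · simp only [PiLp.sub_apply, PiLp.add_apply, hsucc]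
    linarith [le_max_left (w k j + (b j - d (w k) j)) 0]
  · simp only [PiLp.sub_apply, PiLp.add_apply, hsucc, sub_nonneg]
    exact max_le (by linarith) (add_nonneg hbj (greedyQueue_nonneg k j))
  · have hsum : ∀ K, ∑ k ∈ Finset.range K, (b + w k - w (k + 1)) j = K * b j - w K j := fun K => by
      induction K with
      | zero => simp [w, greedyQueue]
      | succ K ih =>
        rw [Finset.sum_range_succ, ih]
        simp only [PiLp.sub_apply, PiLp.add_apply]
        push_cast
        ring
    have hlim := (tendsto_greedyQueue_div hd hb j).const_sub (b j)
    rw [sub_zero] at hlim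
    refine hlim.congr' ((eventually_ne_atTop 0).mono fun K hK => ?_)
    have : (K : ℝ) ≠ 0 := by exact_mod_cast hK
    simp only [hsum, sub_div, mul_div_cancel_left₀ _ this]
    rfl

end GreedyQueue

namespace System

variable {nR nN : ℕ} (S : System nR nN) {lam : Fin nN → ℝ}

lemma nonneg_of_mem_lambertRegion (h : lam ∈ S.lambertRegion) (i : Fin nN) : 0 ≤ lam i := by
  obtain ⟨μ, P, hall, hN, -, -⟩ := h
  exact ge_of_tendsto' (hN i) fun K =>
    div_nonneg (Finset.sum_nonneg fun k _ => meanService_nonneg (hall k) _) (Nat.cast_nonneg K)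

lemma meanPower_scaleNRT_const_le {μ P : S.State → User nR nN → ℝ}
    (h : ∀ m, S.IsSlotAllocation m (μ m) (P m)) {r : ℝ} (hr : r ≤ 1) :
    S.meanPower (fun m => scaleNRT (fun _ => r) (μ m)) P ≤ S.meanPower μ P -
      (1 - r) * S.L / (S.gainBound * S.Ts) * ∑ i, S.meanService μ P (Sum.inr i) := by
  rw [meanPower_scaleNRT, Finset.mul_sum]
  refine sub_le_sub_left (Finset.sum_le_sum fun i _ => ?_) _
  rw [div_mul_eq_mul_div, div_le_iff₀ (mul_pos S.gainBound_pos S.Ts_pos), mul_assoc, mul_assoc]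
  refine mul_le_mul_of_nonneg_left ?_ (sub_nonneg.2 hr)
  linarith [meanService_le_meanUserPower h (Sum.inr i)]

/-- Shortening all NRT transmissions by the factor `r` saves power in proportion to the bits that
are given up. -/
lemma inner_target_smul_add_le_of_mem (h : lam ∈ S.lambertRegion) {r : ℝ} (hr0 : 0 ≤ r)
    (hr1 : r ≤ 1) {v : QueueSpace nR nN} (hv : ∀ j, 0 ≤ v j) :
    inner ℝ v (S.target (r • lam)) +
        (1 - r) * S.L / (S.gainBound * S.Ts) * (∑ i, lam i) * v none ≤
      meanSupport S.prob S.outcomes v := by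
  obtain ⟨μ, P, hall, hN, hR, hP⟩ := h
  set c := (1 - r) * S.L / (S.gainBound * S.Ts)
  set μ' : ℕ → S.State → User nR nN → ℝ := fun k m => scaleNRT (fun _ => r) (μ k m)
  have hall' : ∀ k m, S.IsSlotAllocation m (μ' k m) (P k m) := fun k m =>
    (hall k m).scaleNRT (fun _ => hr0) fun _ => hr1
  have hadd : inner ℝ v (S.target (r • lam)) + c * (∑ i, lam i) * v none =
      inner ℝ v (S.target (r • lam) + EuclideanSpace.single none (c * ∑ i, lam i)) := by
    rw [inner_add_right, EuclideanSpace.inner_single_right]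
    rfl
  rw [hadd]
  refine inner_le_of_le_average hv (fun k => inner_meanOutcome_le (hall' k) v) fun j e he => ?_
  rcases j with _ | i | i
  · have hpower := eventually_le_add_of_limsup_le
      (abs_average_le fun k => abs_meanPower_le (hall k)) hP (half_pos he)
    have hservice := ((tendsto_finsetSum Finset.univ fun i _ => hN i).const_mul c).eventually
      (lt_mem_nhds (sub_lt_self _ (half_pos he)))
    filter_upwards [hpower, hservice] with K hKpower hKservice
    have havg : c * ∑ i, (∑ k ∈ Finset.range K, S.meanService (μ k) (P k) (Sum.inr i)) / K -
        (∑ k ∈ Finset.range K, S.meanPower (μ k) (P k)) / K ≤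
          (∑ k ∈ Finset.range K, S.meanOutcome (μ' k) (P k) none) / K := by
      rw [← Finset.sum_div, ← mul_div_assoc, ← sub_div, Finset.sum_comm, Finset.mul_sum,
        ← Finset.sum_sub_distrib]
      gcongr with k
      rw [meanOutcome_none]
      linarith [S.meanPower_scaleNRT_const_le (hall k) hr1]
    simp only [PiLp.add_apply, target_none, PiLp.single_apply, ↓reduceIte]
    linarith
  · filter_upwards [eventually_sub_le_of_le_liminf
      (abs_average_le fun k => abs_meanService_le (hall' k) i) (hR i) he] with K hK
    simp only [meanOutcome_inl (hall' _)]
    simpa [mul_comm (S.rateR i)] using hK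
  · have hlim : Tendsto (fun K : ℕ => (∑ k ∈ Finset.range K,
        S.meanOutcome (μ' k) (P k) (some (Sum.inr i))) / K) atTop (𝓝 (S.L * (r * lam i))) := by
      simp only [meanOutcome_inr, μ', meanService_scaleNRT_inr, ← Finset.mul_sum, mul_div_assoc]
      exact ((hN i).const_mul r).const_mul S.L
    simpa using (hlim.eventually (lt_mem_nhds (sub_lt_self _ he))).mono fun K hK => hK.le

lemma inner_target_le_of_mem (h : lam ∈ S.lambertRegion) {v : QueueSpace nR nN}
    (hv : ∀ j, 0 ≤ v j) : inner ℝ v (S.target lam) ≤ meanSupport S.prob S.outcomes v := by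
  simpa using S.inner_target_smul_add_le_of_mem h zero_le_one le_rfl hv

/-- The slack in the NRT coordinates comes from the factor `1 + ε`, the slack in the power
coordinate from shortening the transmissions to the rates `lam`. -/
lemma exists_slack_of_mem {ε : ℝ} (hε : 0 < ε) (h : (1 + ε) • lam ∈ S.lambertRegion)
    (hlam : lam ≠ 0) :
    ∃ δ : ℝ, 0 < δ ∧ ∀ v : QueueSpace nR nN, (∀ j, 0 ≤ v j) →
      inner ℝ v (S.target lam) + δ * (∑ i, lam i * v (some (Sum.inr i)) + v none) ≤
        meanSupport S.prob S.outcomes v := by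
  have hε1 : 0 < 1 + ε := by linarith
  have hlam0 : ∀ i, 0 ≤ lam i := fun i =>
    nonneg_of_mul_nonneg_right (S.nonneg_of_mem_lambertRegion h i) hε1
  have hr1 : (1 + ε)⁻¹ < 1 := inv_lt_one_of_one_lt₀ (by linarith)
  obtain ⟨i₀, hi₀⟩ := Function.ne_iff.1 hlam
  have hsum : 0 < ∑ i, ((1 + ε) • lam) i :=
    Finset.sum_pos' (fun i _ => mul_nonneg hε1.le (hlam0 i))
      ⟨i₀, Finset.mem_univ _, mul_pos hε1 ((hlam0 i₀).lt_of_ne' hi₀)⟩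
  set c := (1 - (1 + ε)⁻¹) * S.L / (S.gainBound * S.Ts) * ∑ i, ((1 + ε) • lam) i
  have hc : 0 < c := mul_pos (div_pos (mul_pos (sub_pos.2 hr1) S.L_pos)
    (mul_pos S.gainBound_pos S.Ts_pos)) hsum
  refine ⟨min (ε * S.L) c / 2, half_pos (lt_min (mul_pos hε S.L_pos) hc), fun v hv => ?_⟩
  have hscaled := S.inner_target_le_of_mem h hv
  have hshortened := S.inner_target_smul_add_le_of_mem h (inv_nonneg.2 hε1.le) hr1.le hv
  rw [inv_smul_smul₀ hε1.ne'] at hshortened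
  have htarget : inner ℝ v (S.target ((1 + ε) • lam)) =
      inner ℝ v (S.target lam) + ε * S.L * ∑ i, lam i * v (some (Sum.inr i)) := by
    simp only [inner_eq_sum_mul, Fintype.sum_option, Fintype.sum_sum_type, target_none, target_inl,
      target_inr, Pi.smul_apply, smul_eq_mul, add_assoc, Finset.mul_sum, ← Finset.sum_add_distrib]
    congr! 3 with i
    ring
  have hs : 0 ≤ ∑ i, lam i * v (some (Sum.inr i)) :=
    Finset.sum_nonneg fun i _ => mul_nonneg (hlam0 i) (hv _)
  have hN := mul_le_mul_of_nonneg_right (min_le_left (ε * S.L) c) hs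
  have hX := mul_le_mul_of_nonneg_right (min_le_right (ε * S.L) c) (hv none)
  linarith

lemma mem_lambertRegion_of_departures {μ P : ℕ → S.State → User nR nN → ℝ}
    {u : ℕ → QueueSpace nR nN} (hall : ∀ k m, S.IsSlotAllocation m (μ k m) (P k m))
    (hle : ∀ k j, u k j ≤ S.meanOutcome (μ k) (P k) j) (hu : ∀ k i, 0 ≤ u k (some (Sum.inr i)))
    (hlim : ∀ j, Tendsto (fun K : ℕ => (∑ k ∈ Finset.range K, u k j) / K) atTop
      (𝓝 (S.target lam j))) : lam ∈ S.lambertRegion := by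
  have hu0 : ∀ k i, 0 ≤ u k (some (Sum.inr i)) / S.L := fun k i => div_nonneg (hu k i) S.L_pos.le
  have hule : ∀ k i, u k (some (Sum.inr i)) / S.L ≤ S.meanService (μ k) (P k) (Sum.inr i) :=
    fun k i => by
      rw [div_le_iff₀' S.L_pos, ← meanOutcome_inr]
      exact hle k _
  choose μ' hall' hR hN hP using fun k => exists_reduce_meanService (hall k) (hu0 k) (hule k)
  refine ⟨μ', P, hall', fun i => ?_, fun i => ?_, ?_⟩
  · have := (hlim (some (Sum.inr i))).div_const S.L
    rw [target_inr, mul_div_cancel_left₀ _ S.L_pos.ne'] at this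
    refine this.congr fun K => ?_
    simp only [hN]
    rw [← Finset.sum_div, div_right_comm]
  · have := hlim (some (Sum.inl i))
    rw [target_inl, mul_comm] at this
    refine le_liminf_of_tendsto (abs_average_le fun k => abs_meanService_le (hall' k) i) this
      (Eventually.of_forall fun K => ?_)
    gcongr with k
    rw [hR, ← meanOutcome_inl (hall k)]
    exact hle k _
  · have := (hlim none).neg
    rw [target_none, neg_neg] at this
    refine limsup_le_of_tendsto (abs_average_le fun k => abs_meanPower_le (hall' k)) this
      (Eventually.of_forall fun K => ?_)
    rw [← neg_div, ← Finset.sum_neg_distrib]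
    gcongr with k
    have := hle k none
    rw [meanOutcome_none] at this
    linarith [hP k]

lemma mem_lambertRegion_iff : lam ∈ S.lambertRegion ↔
    (∀ i, 0 ≤ lam i) ∧ ∀ v : QueueSpace nR nN, (∀ j, 0 ≤ v j) →
      inner ℝ v (S.target lam) ≤ meanSupport S.prob S.outcomes v := by
  refine ⟨fun h => ⟨S.nonneg_of_mem_lambertRegion h, fun v hv => S.inner_target_le_of_mem h hv⟩,
    fun ⟨h0, h⟩ => ?_⟩
  obtain ⟨C, hC, -⟩ := S.exists_norm_bound
  choose μ P hall hopt using fun v : QueueSpace nR nN =>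
    S.exists_meanSupport_le_inner_meanOutcome_add v one_pos
  obtain ⟨w, u, hle, hnonneg, hlim⟩ := exists_departures_tendsto (b := S.target lam)
    (d := fun v => S.meanOutcome (μ v) (P v)) (fun v => norm_meanOutcome_le (hall v) hC)
    fun v hv => (h v hv).trans (hopt v)
  refine S.mem_lambertRegion_of_departures (fun k => hall (w k)) hle (fun k i => ?_) hlim
  refine hnonneg k _ (mul_nonneg S.L_pos.le (h0 i)) ?_
  rw [meanOutcome_inr]
  exact mul_nonneg S.L_pos.le (meanService_nonneg (hall _) _)

lemma continuous_target : Continuous (S.target : (Fin nN → ℝ) → QueueSpace nR nN) := by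
  refine (PiLp.continuous_toLp 2 fun _ : Option (User nR nN) => ℝ).comp (continuous_pi fun j => ?_)
  rcases j with _ | i | i <;> simp only [Sum.elim_inl, Sum.elim_inr] <;> fun_prop

lemma isClosed_lambertRegion : IsClosed S.lambertRegion := by
  have hregion : S.lambertRegion = {lam | (∀ i, 0 ≤ lam i) ∧ ∀ v : QueueSpace nR nN,
      (∀ j, 0 ≤ v j) → inner ℝ v (S.target lam) ≤ meanSupport S.prob S.outcomes v} := by
    ext lam
    exact S.mem_lambertRegion_iff
  have := S.continuous_target
  simp only [hregion, Set.ofPred_and, Set.ofPred_forall]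
  exact (isClosed_iInter fun i => isClosed_le continuous_const (continuous_apply i)).inter
    (isClosed_iInter fun v => isClosed_iInter fun _ => isClosed_le (by fun_prop) continuous_const)

end System

/-! ### The Lambert ratio -/

lemma sub_le_mul_log_sub_log {u v : ℝ} (hu : 0 < u) (hv : 0 < v) :
    v - u ≤ v * (Real.log v - Real.log u) := by
  have h := mul_le_mul_of_nonneg_left (Real.log_le_sub_one_of_pos (div_pos hu hv)) hv.le
  rw [Real.log_div hu.ne' hv.ne', mul_sub, mul_sub, mul_div_cancel₀ _ hv.ne'] at h
  linarith

lemma strictMonoOn_mul_log_sub_self :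
    StrictMonoOn (fun u : ℝ => u * Real.log u - u) (Set.Ici 1) := by
  refine strictMonoOn_of_deriv_pos (convex_Ici 1)
    (Real.continuous_mul_log.sub continuous_id).continuousOn fun u hu => ?_
  rw [interior_Ici, Set.mem_Ioi] at hu
  have hderiv := (Real.hasDerivAt_mul_log (one_pos.trans hu).ne').sub (hasDerivAt_id u)
  rw [add_sub_cancel_right] at hderiv
  exact hderiv.deriv ▸ Real.log_pos hu

lemma neg_one_le_mul_log_sub_self {u : ℝ} (hu : 1 ≤ u) : -1 ≤ u * Real.log u - u := by
  simpa using strictMonoOn_mul_log_sub_self.monotoneOn (Set.mem_Ici.2 le_rfl) hu hu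

lemma rate_pos {p g : ℝ} (hp : 0 < p) (hg : 0 < g) : 0 < rate p g :=
  Real.log_pos (by linarith [mul_pos hp hg])

lemma rate_le_rate {p p' g : ℝ} (hp : 0 ≤ p) (hg : 0 ≤ g) (h : p ≤ p') : rate p g ≤ rate p' g :=
  Real.log_le_log (by linarith [mul_nonneg hp hg]) (by linarith [mul_le_mul_of_nonneg_right h hg])

lemma rate_sub_rate_le {p p' g : ℝ} (hp : 0 ≤ p) (hp' : 0 ≤ p') (hg : 0 ≤ g) :
    rate p g - rate p' g ≤ (p - p') * g / (1 + p' * g) := by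
  have hu : 0 < 1 + p * g := by positivity
  have hv : 0 < 1 + p' * g := by positivity
  have hlog := Real.log_le_sub_one_of_pos (div_pos hu hv)
  rw [Real.log_div hu.ne' hv.ne'] at hlog
  refine hlog.trans_eq ?_
  field_simp
  ring

lemma sub_min_max_mul_sub_nonpos {M a p : ℝ} (hp : 0 ≤ p) (hpM : p ≤ M) :
    (p - min (max a 0) M) * (a - min (max a 0) M) ≤ 0 := by
  rcases le_total a 0 with ha | ha
  · rw [max_eq_right ha, min_eq_left (hp.trans hpM)]
    exact mul_nonpos_of_nonneg_of_nonpos (by linarith) (by linarith)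
  rw [max_eq_left ha]
  rcases le_total a M with hM | hM
  · simp [min_eq_left hM]
  · rw [min_eq_right hM]
    exact mul_nonpos_of_nonpos_of_nonneg (by linarith) (by linarith)

namespace System

lemma lambertW0_spec {z : ℝ} (hz : -1 ≤ z) : -1 ≤ lambertW0 (z / Real.exp 1) ∧
    lambertW0 (z / Real.exp 1) * Real.exp (lambertW0 (z / Real.exp 1)) = z / Real.exp 1 := by
  have hex : ∃ w ∈ Set.Ici (-1 : ℝ), w * Real.exp w = z / Real.exp 1 := by
    set y := max (z / Real.exp 1) 0
    have hy : 0 ≤ y := le_max_right _ _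
    have hlow : -1 * Real.exp (-1) ≤ z / Real.exp 1 := by
      rw [Real.exp_neg, div_eq_mul_inv]
      gcongr
    have hhigh : z / Real.exp 1 ≤ y * Real.exp y :=
      (le_max_left _ 0).trans (le_mul_of_one_le_right hy (Real.one_le_exp hy))
    exact isPreconnected_Ici.intermediate_value Set.self_mem_Ici
      (Set.mem_Ici.2 (by linarith)) (by fun_prop) ⟨hlow, hhigh⟩
  exact ⟨Function.invFunOn_mem hex, Function.invFunOn_eq hex⟩

/-- The Lambert ratio inverts `u ↦ u log u - u` on `[1, ∞)`: it equals `exp (1 + w)`, where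
`w * exp w = z / e`. -/
lemma lambertRatio_spec {z : ℝ} (hz : -1 ≤ z) :
    1 ≤ lambertRatio z ∧ lambertRatio z * Real.log (lambertRatio z) - lambertRatio z = z := by
  by_cases h0 : z = 0
  · simp [lambertRatio, h0]
  obtain ⟨hw, hwz⟩ := lambertW0_spec hz
  set w := lambertW0 (z / Real.exp 1) with hwdef
  have hzw : z = w * Real.exp (1 + w) := by
    rw [eq_div_iff (Real.exp_pos 1).ne'] at hwz
    rw [Real.exp_add, ← hwz]
    ring
  have hr : lambertRatio z = Real.exp (1 + w) := by
    rw [lambertRatio, if_neg h0, ← hwdef, div_eq_iff (left_ne_zero_of_mul (hzw ▸ h0)), mul_comm]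
    exact hzw
  rw [hr, Real.log_exp]
  exact ⟨Real.one_le_exp (by linarith), by linarith⟩

lemma lambertRatio_mul_log_sub_self {u : ℝ} (hu : 1 ≤ u) :
    lambertRatio (u * Real.log u - u) = u := by
  obtain ⟨hone, heq⟩ := lambertRatio_spec (neg_one_le_mul_log_sub_self hu)
  exact strictMonoOn_mul_log_sub_self.injOn hone hu heq

lemma lambertRatio_neg_one : lambertRatio (-1) = 1 := by
  simpa using lambertRatio_mul_log_sub_self le_rfl

lemma le_lambertRatio_iff {u z : ℝ} (hz : -1 ≤ z) (hu : 1 ≤ u) :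
    u ≤ lambertRatio z ↔ u * Real.log u - u ≤ z := by
  obtain ⟨hone, heq⟩ := lambertRatio_spec hz
  rw [← strictMonoOn_mul_log_sub_self.le_iff_le hu hone, heq]

lemma continuousOn_lambertRatio : ContinuousOn lambertRatio (Set.Ici (-1)) := by
  have hmaps : Set.MapsTo lambertRatio (Set.Ici (-1)) (Set.Ici 1) := fun z hz =>
    (lambertRatio_spec hz).1
  have hmono : Monotone hmaps.restrict := fun x y hxy => by
    obtain ⟨hone, heq⟩ := lambertRatio_spec x.2
    exact (le_lambertRatio_iff y.2 hone).2 (heq.trans_le hxy)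
  have hsurj : Function.Surjective hmaps.restrict := fun ⟨u, hu⟩ =>
    ⟨⟨u * Real.log u - u, neg_one_le_mul_log_sub_self hu⟩,
      Subtype.ext (lambertRatio_mul_log_sub_self hu)⟩
  exact continuousOn_iff_continuous_domRestrict.2
    (continuous_subtype_val.comp (hmono.continuous_of_surjective hsurj))

/-- On `(1, M]`, the quotient `(u + z) / log u` is minimal at the truncated Lambert ratio. -/
lemma min_lambertRatio_add_mul_log_le {z u M : ℝ} (hz : -1 ≤ z) (hu : 0 < u) (huM : u ≤ M)
    (hM : 1 ≤ M) :
    (min (lambertRatio z) M + z) * Real.log u ≤ (u + z) * Real.log (min (lambertRatio z) M) := by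
  obtain ⟨hone, heq⟩ := lambertRatio_spec hz
  set v := min (lambertRatio z) M with hv
  have hv1 : 1 ≤ v := le_min hone hM
  have hv0 : 0 < v := one_pos.trans_le hv1
  have htangent := mul_nonneg (Real.log_nonneg hv1)
    (sub_nonneg.2 (sub_le_mul_log_sub_log hu hv0))
  have hexcess : 0 ≤ (z - (v * Real.log v - v)) * (Real.log v - Real.log u) := by
    rcases le_total (lambertRatio z) M with h | h
    · rw [hv, min_eq_left h, heq, sub_self, zero_mul]
    · refine mul_nonneg (sub_nonneg.2 ((le_lambertRatio_iff hz hv1).1 (min_le_left _ _)))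
        (sub_nonneg.2 (Real.log_le_log hu ?_))
      rwa [hv, min_eq_right h]
  linarith

variable {nR nN : ℕ} (S : System nR nN)

/-! ### Lambert power -/

lemma neg_one_le_lambertArg {X c g : ℝ} (hX : 0 ≤ X) (hc : 0 ≤ c) (hg : 0 ≤ g) :
    -1 ≤ c * S.Ts / X * g - 1 := by
  have := S.Ts_pos
  have : 0 ≤ c * S.Ts / X * g := by positivity
  linarith

lemma one_add_lambertPower_mul {X g : ℝ} (ψ φ : ℝ) (hX : X ≠ 0) (hg : 0 < g) :
    1 + S.lambertPower X ψ φ g * g =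
      min (lambertRatio ((ψ + φ) * S.Ts / X * g - 1)) (1 + S.Pmax * g) := by
  rw [lambertPower, if_neg hX, min_mul_of_nonneg _ _ hg.le, ← min_add_add_left]
  congr 1
  field_simp
  ring

lemma lambertPower_nonneg {X ψ φ g : ℝ} (hX : 0 ≤ X) (hc : 0 ≤ ψ + φ) (hg : 0 ≤ g) :
    0 ≤ S.lambertPower X ψ φ g := by
  unfold lambertPower
  split_ifs
  · exact S.Pmax_pos.le
  · refine le_min (mul_nonneg (by positivity) (sub_nonneg.2 ?_)) S.Pmax_pos.le
    exact (lambertRatio_spec (S.neg_one_le_lambertArg hX hc hg)).1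

lemma lambertPower_le (X ψ φ g : ℝ) : S.lambertPower X ψ φ g ≤ S.Pmax := by
  unfold lambertPower
  split_ifs
  · exact le_rfl
  · exact min_le_right _ _

/-- Of all powers, the Lambert power has the smallest cost per bit, `(X p / Ts + ψ + φ) / rate p g`.
-/
lemma lambertPower_cost_mul_rate_le {X ψ φ g p : ℝ} (hX : 0 ≤ X) (hc : 0 ≤ ψ + φ) (hg : 0 < g)
    (hp : 0 ≤ p) (hpm : p ≤ S.Pmax) :
    (X * S.lambertPower X ψ φ g / S.Ts + (ψ + φ)) * rate p g ≤
      (X * p / S.Ts + (ψ + φ)) * rate (S.lambertPower X ψ φ g) g := by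
  obtain rfl | hXpos := hX.eq_or_lt
  · simp only [lambertPower, if_true, zero_mul, zero_div, zero_add]
    exact mul_le_mul_of_nonneg_left (rate_le_rate hp hg.le hpm) hc
  have hT := S.Ts_pos
  have hP := S.Pmax_pos
  set z := (ψ + φ) * S.Ts / X * g - 1 with hz
  have hcost : ∀ x : ℝ, X * x / S.Ts + (ψ + φ) = X / (S.Ts * g) * (1 + x * g + z) := fun x => by
    rw [hz]
    field_simp
    ring
  rw [hcost, hcost, mul_assoc, mul_assoc, rate, rate, S.one_add_lambertPower_mul ψ φ hXpos.ne' hg]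
  refine mul_le_mul_of_nonneg_left (min_lambertRatio_add_mul_log_le
    (S.neg_one_le_lambertArg hX hc hg.le) ?_ ?_ ?_) (by positivity)
  · positivity
  · gcongr
  · linarith [mul_pos hP hg]

lemma lambertPower_pos {X ψ φ g : ℝ} (hX : 0 ≤ X) (hc : 0 < ψ + φ) (hg : 0 < g) :
    0 < S.lambertPower X ψ φ g := by
  have hT := S.Ts_pos
  obtain rfl | hXpos := hX.eq_or_lt
  · simpa [lambertPower] using S.Pmax_pos
  obtain ⟨hone, heq⟩ := lambertRatio_spec (S.neg_one_le_lambertArg hX hc.le hg.le)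
  have hz : 0 < (ψ + φ) * S.Ts / X * g := by positivity
  have hne : 1 ≠ lambertRatio ((ψ + φ) * S.Ts / X * g - 1) := fun h => by
    rw [← h, Real.log_one] at heq
    linarith
  rw [lambertPower, if_neg hXpos.ne']
  exact lt_min (mul_pos (by positivity) (sub_pos.2 (hone.lt_of_ne hne))) S.Pmax_pos

lemma lambertPower_zero_zero {X : ℝ} (hX : X ≠ 0) (g : ℝ) : S.lambertPower X 0 0 g = 0 := by
  simp [lambertPower, hX, lambertRatio_neg_one, S.Pmax_pos.le]

lemma continuousOn_lambertPower {X ψ g : ℝ} (hX : 0 ≤ X) (hψ : 0 ≤ ψ) (hg : 0 ≤ g) :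
    ContinuousOn (fun φ => S.lambertPower X ψ φ g) (Set.Ici 0) := by
  unfold lambertPower
  split_ifs
  · exact continuousOn_const
  · have hratio : ContinuousOn (fun φ => lambertRatio ((ψ + φ) * S.Ts / X * g - 1)) (Set.Ici 0) :=
      continuousOn_lambertRatio.comp (by fun_prop) fun φ hφ =>
        S.neg_one_le_lambertArg hX (add_nonneg hψ hφ) hg
    fun_prop

lemma eventually_lambertPower_eq_Pmax {X g : ℝ} (ψ : ℝ) (hX : 0 ≤ X) (hg : 0 < g) :
    ∀ᶠ φ in atTop, S.lambertPower X ψ φ g = S.Pmax := by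
  obtain rfl | hXpos := hX.eq_or_lt
  · simp [lambertPower]
  have hT := S.Ts_pos
  set M := 1 + S.Pmax * g
  have hM1 : 1 ≤ M := by linarith [mul_pos S.Pmax_pos hg]
  have hlim : Tendsto (fun φ => (ψ + φ) * S.Ts / X * g - 1) atTop atTop := by
    have : Tendsto (fun φ => (ψ + φ) * (S.Ts / X * g)) atTop atTop :=
      (tendsto_atTop_add_const_left _ ψ tendsto_id).atTop_mul_const (by positivity)
    exact (tendsto_atTop_add_const_right _ (-1) this).congr fun φ => by ring
  filter_upwards [hlim.eventually_ge_atTop (M * Real.log M - M)] with φ hφ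
  have hle := (le_lambertRatio_iff ((neg_one_le_mul_log_sub_self hM1).trans hφ) hM1).2 hφ
  have heq := S.one_add_lambertPower_mul ψ φ hXpos.ne' hg
  rw [min_eq_right hle, add_right_inj] at heq
  exact mul_right_cancel₀ hg.ne' heq

/-! ### Water-filling -/

lemma waterFilling_nonneg (X Q g : ℝ) : 0 ≤ S.waterFilling X Q g := by
  have := S.Pmax_pos.le
  unfold waterFilling
  split_ifs
  · exact le_rfl
  · exact le_rfl
  · exact this
  · exact le_min (le_max_right _ _) this

lemma waterFilling_le (X Q g : ℝ) : S.waterFilling X Q g ≤ S.Pmax := by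
  have := S.Pmax_pos.le
  unfold waterFilling
  split_ifs
  · exact this
  · exact this
  · exact le_rfl
  · exact min_le_right _ _

lemma le_psiN {X Q g p : ℝ} (hX : 0 ≤ X) (hQ : 0 ≤ Q) (hg : 0 ≤ g) (hp : 0 ≤ p)
    (hpm : p ≤ S.Pmax) : Q * rate p g - X * p / S.Ts ≤ S.psiN X Q g := by
  have hT := S.Ts_pos
  obtain rfl | hgpos := hg.eq_or_lt
  · have : 0 ≤ X * p / S.Ts := by positivity
    simpa [psiN, waterFilling, rate] using this
  obtain rfl | hXpos := hX.eq_or_lt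
  · by_cases hQ0 : Q = 0
    · simp [psiN, hQ0]
    · simp only [psiN, waterFilling, hgpos.ne', hQ0, if_true, if_false, zero_mul, zero_div,
        sub_zero]
      exact mul_le_mul_of_nonneg_left (rate_le_rate hp hg hpm) hQ
  have hw0 := S.waterFilling_nonneg X Q g
  have hw : S.waterFilling X Q g = min (max (S.Ts * Q / X - 1 / g) 0) S.Pmax := by
    simp [waterFilling, hgpos.ne', hXpos.ne']
  rw [psiN]
  set p' := S.waterFilling X Q g
  have : 0 < 1 + p' * g := by positivity
  have hproj : (p - p') * (S.Ts * Q / X - 1 / g - p') ≤ 0 :=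
    hw ▸ sub_min_max_mul_sub_nonpos hp hpm
  suffices h : Q * ((p - p') * g / (1 + p' * g)) - (X * p / S.Ts - X * p' / S.Ts) ≤ 0 by
    linarith [mul_le_mul_of_nonneg_left (rate_sub_rate_le hp hw0 hg) hQ]
  calc Q * ((p - p') * g / (1 + p' * g)) - (X * p / S.Ts - X * p' / S.Ts)
      = X * g / ((1 + p' * g) * S.Ts) * ((p - p') * (S.Ts * Q / X - 1 / g - p')) := by
        field_simp
        ring
    _ ≤ 0 := mul_nonpos_of_nonneg_of_nonpos (by positivity) hproj

lemma psiN_nonneg {X Q g : ℝ} (hX : 0 ≤ X) (hQ : 0 ≤ Q) (hg : 0 ≤ g) : 0 ≤ S.psiN X Q g := by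
  simpa [rate] using S.le_psiN hX hQ hg le_rfl S.Pmax_pos.le

end System

/-! ### Optimality of the Lambert-Strict allocation -/

namespace System

variable {nR nN : ℕ} (S : System nR nN)

/-- A way to send the packets of the RT users in `A` within one slot: powers `p` and durations `t`,
whose values outside `A` are irrelevant. -/
structure IsSchedule (g : Fin nR → ℝ) (A : Finset (Fin nR)) (p t : Fin nR → ℝ) : Prop where
  power_nonneg : ∀ i ∈ A, 0 ≤ p i
  power_le : ∀ i ∈ A, p i ≤ S.Pmax
  packet : ∀ i ∈ A, t i * rate (p i) (g i) = S.L
  sum_time_le : ∑ i ∈ A, t i ≤ S.Ts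

/-- The conditions of `IsCandidate` apart from the exclusion of sets. -/
structure IsPlan (X ψ : ℝ) (g : Fin nR → ℝ) (A : Finset (Fin nR)) (p t : Fin nR → ℝ)
    (tN : ℝ) : Prop where
  power : ∃ φ : ℝ, 0 ≤ φ ∧ φ * tN = 0 ∧ ∀ i ∈ A, p i = S.lambertPower X ψ φ (g i)
  packet : ∀ i ∈ A, t i * rate (p i) (g i) = S.L
  unscheduled : ∀ i, i ∉ A → p i = 0 ∧ t i = 0
  remaining : tN = S.Ts - ∑ i, t i
  remaining_nonneg : 0 ≤ tN

/-- The weight of scheduling `A` with powers `p` and durations `t` and giving the remaining time to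
an NRT user of weight `ψ` per second. -/
def planValue (X ψ : ℝ) (Y : Fin nR → ℝ) (A : Finset (Fin nR)) (p t : Fin nR → ℝ) : ℝ :=
  ∑ i ∈ A, (Y i - X * p i * t i / S.Ts) + ψ * (S.Ts - ∑ i ∈ A, t i)

/-- The packets of the users in `A` fit into one slot at peak power. -/
def IsFeasible (g : Fin nR → ℝ) (A : Finset (Fin nR)) : Prop :=
  (∀ i ∈ A, 0 < g i) ∧ ∑ i ∈ A, S.L / rate S.Pmax (g i) ≤ S.Ts

/-- The duration of a packet sent with the Lambert power. -/
def packetTime (X ψ φ g : ℝ) : ℝ := S.L / rate (S.lambertPower X ψ φ g) g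

lemma planValue_eq_sub (X ψ φ : ℝ) (Y : Fin nR → ℝ) (A : Finset (Fin nR)) (p t : Fin nR → ℝ) :
    S.planValue X ψ Y A p t = ∑ i ∈ A, Y i + ψ * S.Ts + φ * ∑ i ∈ A, t i
      - ∑ i ∈ A, (X * p i / S.Ts + (ψ + φ)) * t i := by
  have hsum : ∑ i ∈ A, (X * p i / S.Ts + (ψ + φ)) * t i =
      ∑ i ∈ A, X * p i * t i / S.Ts + (ψ + φ) * ∑ i ∈ A, t i := by
    rw [Finset.mul_sum, ← Finset.sum_add_distrib]
    exact Finset.sum_congr rfl fun i _ => by ring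
  rw [planValue, hsum, Finset.sum_sub_distrib]
  ring

variable {S}

lemma gain_pos_of_packet {p g t : ℝ} (hg : 0 ≤ g) (h : t * rate p g = S.L) : 0 < g := by
  refine hg.lt_of_ne fun h0 => S.L_pos.ne ?_
  rw [← h, ← h0]
  simp [rate]

lemma time_nonneg_of_packet {p g t : ℝ} (hp : 0 ≤ p) (hg : 0 ≤ g) (h : t * rate p g = S.L) :
    0 ≤ t :=
  (pos_of_mul_pos_left (h ▸ S.L_pos) (rate_nonneg hp hg)).le

variable {X ψ : ℝ} {Y g : Fin nR → ℝ} {A : Finset (Fin nR)} {p t : Fin nR → ℝ} {tN : ℝ}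

lemma IsSchedule.isFeasible (h : S.IsSchedule g A p t) (hg : ∀ i, 0 ≤ g i) :
    S.IsFeasible g A := by
  have hpos : ∀ i ∈ A, 0 < g i := fun i hi => gain_pos_of_packet (hg i) (h.packet i hi)
  refine ⟨hpos, (Finset.sum_le_sum fun i hi => ?_).trans h.sum_time_le⟩
  rw [div_le_iff₀ (rate_pos S.Pmax_pos (hpos i hi)), ← h.packet i hi]
  exact mul_le_mul_of_nonneg_left (rate_le_rate (h.power_nonneg i hi) (hg i) (h.power_le i hi))
    (time_nonneg_of_packet (h.power_nonneg i hi) (hg i) (h.packet i hi))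

lemma IsCandidate.isPlan (h : S.IsCandidate X ψ Y g A p t tN) : S.IsPlan X ψ g A p t tN :=
  ⟨h.power, h.packet, h.unscheduled, h.remaining, h.remaining_nonneg⟩

namespace IsPlan

variable (h : S.IsPlan X ψ g A p t tN)

include h

lemma sum_time : ∑ i, t i = ∑ i ∈ A, t i :=
  (Finset.sum_subset (Finset.subset_univ A) fun i _ hi => (h.unscheduled i hi).2).symm

lemma candidateValue_eq (Y : Fin nR → ℝ) :
    S.candidateValue X ψ Y A p t tN = S.planValue X ψ Y A p t := by
  rw [candidateValue, planValue, h.remaining, h.sum_time]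

lemma power_nonneg (hX : 0 ≤ X) (hψ : 0 ≤ ψ) (hg : ∀ i, 0 ≤ g i) (i : Fin nR) : 0 ≤ p i := by
  obtain ⟨φ, hφ, -, hp⟩ := h.power
  by_cases hi : i ∈ A
  · rw [hp i hi]
    exact S.lambertPower_nonneg hX (add_nonneg hψ hφ) (hg i)
  · rw [(h.unscheduled i hi).1]

lemma power_le (i : Fin nR) : p i ≤ S.Pmax := by
  obtain ⟨φ, -, -, hp⟩ := h.power
  by_cases hi : i ∈ A
  · rw [hp i hi]
    exact S.lambertPower_le _ _ _ _
  · rw [(h.unscheduled i hi).1]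
    exact S.Pmax_pos.le

lemma isSchedule (hX : 0 ≤ X) (hψ : 0 ≤ ψ) (hg : ∀ i, 0 ≤ g i) : S.IsSchedule g A p t := by
  refine ⟨fun i _ => h.power_nonneg hX hψ hg i, fun i _ => h.power_le i, h.packet, ?_⟩
  have := h.remaining_nonneg
  rw [h.remaining, h.sum_time] at this
  linarith

lemma time_nonneg (hX : 0 ≤ X) (hψ : 0 ≤ ψ) (hg : ∀ i, 0 ≤ g i) (i : Fin nR) : 0 ≤ t i := by
  by_cases hi : i ∈ A
  · exact time_nonneg_of_packet (h.power_nonneg hX hψ hg i) (hg i) (h.packet i hi)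
  · rw [(h.unscheduled i hi).2]

/-- The multiplier `φ` prices the time limit; for a fixed price of time, every user separately has
the cheapest power. -/
lemma planValue_le (hX : 0 ≤ X) (hψ : 0 ≤ ψ) (hg : ∀ i, 0 ≤ g i) {p' t' : Fin nR → ℝ}
    (h' : S.IsSchedule g A p' t') : S.planValue X ψ Y A p' t' ≤ S.planValue X ψ Y A p t := by
  obtain ⟨φ, hφ, hcompl, hp⟩ := h.power
  have hcost : ∀ i ∈ A, (X * p i / S.Ts + (ψ + φ)) * t i ≤
      (X * p' i / S.Ts + (ψ + φ)) * t' i := by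
    intro i hi
    have ht := h.time_nonneg hX hψ hg i
    have ht' := time_nonneg_of_packet (h'.power_nonneg i hi) (hg i) (h'.packet i hi)
    have hperBit := S.lambertPower_cost_mul_rate_le hX (add_nonneg hψ hφ)
      (gain_pos_of_packet (hg i) (h.packet i hi)) (h'.power_nonneg i hi) (h'.power_le i hi)
    rw [← hp i hi] at hperBit
    refine le_of_mul_le_mul_right ?_ S.L_pos
    calc (X * p i / S.Ts + (ψ + φ)) * t i * S.L
        = t i * t' i * ((X * p i / S.Ts + (ψ + φ)) * rate (p' i) (g i)) := by
          rw [← h'.packet i hi]; ring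
      _ ≤ t i * t' i * ((X * p' i / S.Ts + (ψ + φ)) * rate (p i) (g i)) :=
          mul_le_mul_of_nonneg_left hperBit (mul_nonneg ht ht')
      _ = (X * p' i / S.Ts + (ψ + φ)) * t' i * S.L := by
          rw [← h.packet i hi]; ring
  have htight : φ * ∑ i ∈ A, t i = φ * S.Ts := by
    rw [h.remaining, h.sum_time] at hcompl
    linarith
  rw [S.planValue_eq_sub X ψ φ Y A p' t', S.planValue_eq_sub X ψ φ Y A p t]
  linarith [Finset.sum_le_sum hcost, mul_le_mul_of_nonneg_left h'.sum_time_le hφ]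

end IsPlan

lemma exists_isPlan_of_multiplier {φ : ℝ} (hφ : 0 ≤ φ)
    (hr : ∀ i ∈ A, 0 < rate (S.lambertPower X ψ φ (g i)) (g i))
    (hle : ∑ i ∈ A, S.packetTime X ψ φ (g i) ≤ S.Ts)
    (hcompl : φ = 0 ∨ ∑ i ∈ A, S.packetTime X ψ φ (g i) = S.Ts) :
    ∃ p t tN, S.IsPlan X ψ g A p t tN := by
  classical
  have hsum : ∑ i, (if i ∈ A then S.packetTime X ψ φ (g i) else 0) =
      ∑ i ∈ A, S.packetTime X ψ φ (g i) := by simp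
  refine ⟨fun i => if i ∈ A then S.lambertPower X ψ φ (g i) else 0,
    fun i => if i ∈ A then S.packetTime X ψ φ (g i) else 0,
    S.Ts - ∑ i ∈ A, S.packetTime X ψ φ (g i), ⟨φ, hφ, ?_, fun i hi => if_pos hi⟩, fun i hi => ?_,
    fun i hi => ⟨if_neg hi, if_neg hi⟩, by rw [hsum], sub_nonneg.2 hle⟩
  · rcases hcompl with h | h <;> simp [h]
  · simp only [if_pos hi]
    exact div_mul_cancel₀ _ (hr i hi).ne'

section PacketTime

variable {γ : ℝ}

lemma rate_lambertPower_pos {φ : ℝ} (hX : 0 ≤ X) (hc : 0 < ψ + φ) (hγ : 0 < γ) :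
    0 < rate (S.lambertPower X ψ φ γ) γ :=
  rate_pos (S.lambertPower_pos hX hc hγ) hγ

lemma packetTime_nonneg {φ : ℝ} (hX : 0 ≤ X) (hc : 0 ≤ ψ + φ) (hγ : 0 ≤ γ) :
    0 ≤ S.packetTime X ψ φ γ :=
  div_nonneg S.L_pos.le (rate_nonneg (S.lambertPower_nonneg hX hc hγ) hγ)

lemma continuousOn_rate_lambertPower (hX : 0 ≤ X) (hψ : 0 ≤ ψ) (hγ : 0 ≤ γ) :
    ContinuousOn (fun φ => rate (S.lambertPower X ψ φ γ) γ) (Set.Ici 0) := by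
  refine ContinuousOn.log (continuousOn_const.add
    ((S.continuousOn_lambertPower hX hψ hγ).mul continuousOn_const)) fun φ hφ => ?_
  have := S.lambertPower_nonneg hX (add_nonneg hψ hφ) hγ
  positivity

lemma continuousOn_packetTime {φ₀ : ℝ} (hX : 0 ≤ X) (hψ : 0 ≤ ψ) (hγ : 0 < γ) (hφ₀ : 0 ≤ φ₀)
    (hc : 0 < ψ + φ₀) : ContinuousOn (fun φ => S.packetTime X ψ φ γ) (Set.Ici φ₀) :=
  continuousOn_const.div
    ((continuousOn_rate_lambertPower hX hψ hγ.le).mono (Set.Ici_subset_Ici.2 hφ₀)) fun φ hφ =>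
      (rate_lambertPower_pos hX (by linarith [Set.mem_Ici.1 hφ]) hγ).ne'

/-- Without an NRT weight the Lambert power vanishes together with the multiplier. -/
lemma tendsto_packetTime_zero (hX : 0 < X) (hγ : 0 < γ) :
    Tendsto (fun φ => S.packetTime X 0 φ γ) (𝓝[>] 0) atTop := by
  have hrate : Tendsto (fun φ => rate (S.lambertPower X 0 φ γ) γ) (𝓝[>] 0) (𝓝[>] 0) := by
    refine tendsto_nhdsWithin_iff.2 ⟨?_, eventually_mem_nhdsWithin.mono fun φ hφ =>
      rate_lambertPower_pos hX.le (by simpa using hφ) hγ⟩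
    have hcont := (continuousOn_rate_lambertPower (S := S) hX.le le_rfl hγ.le) 0 Set.self_mem_Ici
    simpa [ContinuousWithinAt, S.lambertPower_zero_zero hX.ne', rate] using
      hcont.tendsto.mono_left (nhdsWithin_mono _ Set.Ioi_subset_Ici_self)
  exact hrate.inv_tendsto_nhdsGT_zero.const_mul_atTop S.L_pos

end PacketTime

lemma IsFeasible.exists_le_sum_packetTime (h : S.IsFeasible g A) (hX : 0 ≤ X) (hψ : 0 ≤ ψ)
    (hzero : ¬ ((∀ i ∈ A, 0 < rate (S.lambertPower X ψ 0 (g i)) (g i)) ∧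
      ∑ i ∈ A, S.packetTime X ψ 0 (g i) ≤ S.Ts)) :
    ∃ φ, 0 ≤ φ ∧ 0 < ψ + φ ∧ S.Ts ≤ ∑ i ∈ A, S.packetTime X ψ φ (g i) := by
  obtain rfl | hψpos := hψ.eq_or_lt
  · obtain rfl | hXpos := hX.eq_or_lt
    · refine absurd ⟨fun i hi => ?_, ?_⟩ hzero
      · simpa [lambertPower] using rate_pos S.Pmax_pos (h.1 i hi)
      · simpa [packetTime, lambertPower] using h.2
    obtain ⟨i₀, hi₀⟩ : A.Nonempty := by
      by_contra hA
      exact hzero (by simp [Finset.not_nonempty_iff_eq_empty.1 hA, S.Ts_pos.le])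
    obtain ⟨φ, hle, hφ⟩ := (((tendsto_packetTime_zero (S := S) hXpos
      (h.1 i₀ hi₀)).eventually_ge_atTop S.Ts).and self_mem_nhdsWithin).exists
    have hφ0 : 0 < φ := hφ
    exact ⟨φ, hφ0.le, by linarith, hle.trans (Finset.single_le_sum (fun i hi =>
      packetTime_nonneg hX (by linarith) (h.1 i hi).le) hi₀)⟩
  · have hc : 0 < ψ + 0 := by linarith
    exact ⟨0, le_rfl, hc, le_of_not_ge fun hle =>
      hzero ⟨fun i hi => rate_lambertPower_pos hX hc (h.1 i hi), hle⟩⟩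

/-- If the multiplier `0` does not work, a larger one makes the packets fill the slot exactly. -/
lemma IsFeasible.exists_isPlan (h : S.IsFeasible g A) (hX : 0 ≤ X) (hψ : 0 ≤ ψ) :
    ∃ p t tN, S.IsPlan X ψ g A p t tN := by
  by_cases hzero : (∀ i ∈ A, 0 < rate (S.lambertPower X ψ 0 (g i)) (g i)) ∧
      ∑ i ∈ A, S.packetTime X ψ 0 (g i) ≤ S.Ts
  · exact exists_isPlan_of_multiplier le_rfl hzero.1 hzero.2 (Or.inl rfl)
  obtain ⟨φ₁, hφ₁, hc₁, hlarge⟩ := h.exists_le_sum_packetTime hX hψ hzero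
  obtain ⟨φ₂, hPmax, hle⟩ := (((Finset.eventually_all A).2 fun i hi =>
    S.eventually_lambertPower_eq_Pmax ψ hX (h.1 i hi)).and (eventually_ge_atTop φ₁)).exists
  have hsmall : ∑ i ∈ A, S.packetTime X ψ φ₂ (g i) ≤ S.Ts :=
    (Finset.sum_congr rfl fun i hi => by rw [packetTime, hPmax i hi]).trans_le h.2
  have hcont : ContinuousOn (fun φ => ∑ i ∈ A, S.packetTime X ψ φ (g i)) (Set.Icc φ₁ φ₂) :=
    continuousOn_finsetSum _ fun i hi => (continuousOn_packetTime hX hψ (h.1 i hi) hφ₁ hc₁).mono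
      Set.Icc_subset_Ici_self
  obtain ⟨φ, hφ, hfull⟩ := intermediate_value_Icc' hle hcont ⟨hsmall, hlarge⟩
  exact exists_isPlan_of_multiplier (hφ₁.trans hφ.1)
    (fun i hi => rate_lambertPower_pos hX (by linarith [hφ.1]) (h.1 i hi)) hfull.le (Or.inr hfull)

/-- User `i` takes over the time of user `j` and, thanks to its larger gain, needs less power. -/
lemma IsSchedule.exists_better_of_swap (h : S.IsSchedule g A p t) (hX : 0 ≤ X) (hg : ∀ i, 0 ≤ g i)
    {i j : Fin nR} (hi : i ∉ A) (hj : j ∈ A) (hY : Y j < Y i) (hgij : g j < g i) :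
    ∃ A' p' t', S.IsSchedule g A' p' t' ∧
      S.planValue X ψ Y A p t < S.planValue X ψ Y A' p' t' := by
  classical
  have hT := S.Ts_pos
  have hgi : 0 < g i := (hg j).trans_lt hgij
  have hpj : p j * g j / g i ≤ p j := by
    rw [div_le_iff₀ hgi]
    exact mul_le_mul_of_nonneg_left hgij.le (h.power_nonneg j hj)
  have htj : 0 ≤ t j := time_nonneg_of_packet (h.power_nonneg j hj) (hg j) (h.packet j hj)
  set p' := Function.update p i (p j * g j / g i) with hp'
  set t' := Function.update t i (t j) with ht'
  have hne : ∀ l ∈ A.erase j, l ≠ i := fun l hl hli => hi (hli ▸ Finset.mem_of_mem_erase hl)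
  have hinot : i ∉ A.erase j := fun hmem => hne i hmem rfl
  have hp'i : p' i = p j * g j / g i := by simp [hp']
  have ht'i : t' i = t j := by simp [ht']
  have hp'_eq : ∀ l ∈ A.erase j, p' l = p l := fun l hl => by simp [hp', hne l hl]
  have ht'_eq : ∀ l ∈ A.erase j, t' l = t l := fun l hl => by simp [ht', hne l hl]
  have hsum : ∑ l ∈ insert i (A.erase j), t' l = ∑ l ∈ A, t l := by
    rw [Finset.sum_insert hinot, ht'i, Finset.sum_congr rfl ht'_eq, Finset.add_sum_erase A t hj]
  refine ⟨insert i (A.erase j), p', t', ⟨?_, ?_, ?_, hsum.trans_le h.sum_time_le⟩, ?_⟩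
  · refine Finset.forall_mem_insert _ _ _ |>.2 ⟨?_, fun l hl => ?_⟩
    · exact hp'i ▸ div_nonneg (mul_nonneg (h.power_nonneg j hj) (hg j)) hgi.le
    · exact hp'_eq l hl ▸ h.power_nonneg l (Finset.mem_of_mem_erase hl)
  · refine Finset.forall_mem_insert _ _ _ |>.2 ⟨?_, fun l hl => ?_⟩
    · exact hp'i ▸ hpj.trans (h.power_le j hj)
    · exact hp'_eq l hl ▸ h.power_le l (Finset.mem_of_mem_erase hl)
  · refine Finset.forall_mem_insert _ _ _ |>.2 ⟨?_, fun l hl => ?_⟩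
    · rw [hp'i, ht'i, ← h.packet j hj, rate, rate, div_mul_cancel₀ _ hgi.ne']
    · rw [hp'_eq l hl, ht'_eq l hl, h.packet l (Finset.mem_of_mem_erase hl)]
  · have hpower : X * (p j * g j / g i) * t j / S.Ts ≤ X * p j * t j / S.Ts := by gcongr
    have hrest : ∑ l ∈ A.erase j, (Y l - X * p' l * t' l / S.Ts) =
        ∑ l ∈ A.erase j, (Y l - X * p l * t l / S.Ts) :=
      Finset.sum_congr rfl fun l hl => by rw [hp'_eq l hl, ht'_eq l hl]
    rw [planValue, planValue, hsum, Finset.sum_insert hinot, hp'i, ht'i, hrest,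
      ← Finset.add_sum_erase A (fun l => Y l - X * p l * t l / S.Ts) hj]
    linarith

/-- A best plan is not excluded by the algorithm, since otherwise swapping two users would improve
it. -/
lemma exists_isCandidate_forall_planValue_le (hX : 0 ≤ X) (hψ : 0 ≤ ψ) (hg : ∀ i, 0 ≤ g i) :
    ∃ A p t tN, S.IsCandidate X ψ Y g A p t tN ∧ ∀ A' p' t', S.IsSchedule g A' p' t' →
      S.planValue X ψ Y A' p' t' ≤ S.candidateValue X ψ Y A p t tN := by
  classical
  have hex : ∀ A : {A : Finset (Fin nR) // S.IsFeasible g A}, ∃ p t tN,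
      S.IsPlan X ψ g A p t tN := fun A => A.2.exists_isPlan hX hψ
  choose p t tN hplan using hex
  have : Nonempty {A : Finset (Fin nR) // S.IsFeasible g A} :=
    ⟨∅, by simp, by simpa using S.Ts_pos.le⟩
  obtain ⟨A, hA⟩ := Finite.exists_max fun A : {A : Finset (Fin nR) // S.IsFeasible g A} =>
    S.planValue X ψ Y A (p A) (t A)
  have hbest : ∀ A' p' t', S.IsSchedule g A' p' t' →
      S.planValue X ψ Y A' p' t' ≤ S.planValue X ψ Y A (p A) (t A) := fun A' p' t' h' =>
    ((hplan ⟨A', h'.isFeasible hg⟩).planValue_le hX hψ hg h').trans (hA ⟨A', h'.isFeasible hg⟩)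
  have hP := hplan A
  refine ⟨A, p A, t A, tN A, ⟨?_, hP.power, hP.packet, hP.unscheduled, hP.remaining,
    hP.remaining_nonneg⟩, by rwa [hP.candidateValue_eq]⟩
  rintro ⟨i, hi, j, hj, hY, hgij⟩
  obtain ⟨A', p', t', h', hlt⟩ :=
    (hP.isSchedule hX hψ hg).exists_better_of_swap (ψ := ψ) hX hg hi hj hY hgij
  exact (hbest A' p' t' h').not_gt hlt

lemma exists_isLambertStrict (hN : 0 < nN) {Q : Fin nN → ℝ} (hX : 0 ≤ X) (hQ : ∀ i, 0 ≤ Q i)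
    (m : S.State) : ∃ μ P, S.IsLambertStrict Q Y X m μ P := by
  classical
  have : Nonempty (Fin nN) := ⟨⟨0, hN⟩⟩
  have hg : ∀ i : Fin nR, 0 ≤ (m (Sum.inl i) : ℝ) := fun i => S.gain_nonneg m _
  obtain ⟨j, hj⟩ := Finite.exists_max fun i => S.psiN X (Q i) (m (Sum.inr i))
  have hψ : 0 ≤ S.psiN X (Q j) (m (Sum.inr j)) := S.psiN_nonneg hX (hQ j) (S.gain_nonneg m _)
  obtain ⟨A, p, t, tN, hc, hbest⟩ :=
    exists_isCandidate_forall_planValue_le (S := S) (Y := Y) hX hψ hg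
  refine ⟨Sum.elim t fun i => if i = j then tN else 0,
    Sum.elim p fun i => if i = j then S.waterFilling X (Q j) (m (Sum.inr j)) else 0,
    j, hj, by simp, fun i hi => by simp [hi], A, by simpa using hc, fun A' p' t' tN' h' => ?_⟩
  rw [h'.isPlan.candidateValue_eq]
  simpa using hbest A' p' t' (h'.isPlan.isSchedule hX hψ hg)

/-- The vector of all queues. -/
def queueVec (Q : Fin nN → ℝ) (Y : Fin nR → ℝ) (X : ℝ) : QueueSpace nR nN :=
  WithLp.toLp 2 fun
    | none => X
    | some (Sum.inl i) => Y i
    | some (Sum.inr i) => Q i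

open Classical in
lemma inner_queueVec_outcome (Q : Fin nN → ℝ) (Y : Fin nR → ℝ) (X : ℝ) (m : S.State)
    (μ P : User nR nN → ℝ) :
    inner ℝ (queueVec Q Y X) (S.outcome m μ P) =
      ∑ i, (Y i * (if μ (Sum.inl i) = 0 then 0 else 1) -
        X * P (Sum.inl i) * μ (Sum.inl i) / S.Ts) +
      ∑ i, μ (Sum.inr i) * (Q i * rate (P (Sum.inr i)) (m (Sum.inr i)) -
        X * P (Sum.inr i) / S.Ts) := by
  rw [inner_eq_sum_mul, Fintype.sum_option, Fintype.sum_sum_type]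
  have hpower : X * ((∑ i, P i * μ i) / S.Ts) =
      ∑ i, X * P (Sum.inl i) * μ (Sum.inl i) / S.Ts +
        ∑ i, μ (Sum.inr i) * (X * P (Sum.inr i) / S.Ts) := by
    simp only [Fintype.sum_sum_type, add_div, mul_add, Finset.sum_div, Finset.mul_sum]
    congr 1 <;> exact Finset.sum_congr rfl fun i _ => by ring
  have hservice : ∀ i : Fin nN, Q i * (μ (Sum.inr i) * rate (P (Sum.inr i)) (m (Sum.inr i))) =
      μ (Sum.inr i) * (Q i * rate (P (Sum.inr i)) (m (Sum.inr i))) := fun i => by ring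
  simp only [outcome_none, outcome_inl, outcome_inr, queueVec, mul_neg, mul_sub,
    Finset.sum_sub_distrib, hpower, hservice]
  ring

open Classical in
/-- The RT users that are served by `μ`. -/
def servedRT (μ : User nR nN → ℝ) : Finset (Fin nR) :=
  Finset.univ.filter fun i => μ (Sum.inl i) ≠ 0

@[simp] lemma mem_servedRT {μ : User nR nN → ℝ} {i : Fin nR} :
    i ∈ servedRT μ ↔ μ (Sum.inl i) ≠ 0 := by
  simp [servedRT]

open Classical in
lemma sum_weight_eq_sum_servedRT (Y : Fin nR → ℝ) (X : ℝ) (μ P : User nR nN → ℝ) :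
    ∑ i, (Y i * (if μ (Sum.inl i) = 0 then 0 else 1) - X * P (Sum.inl i) * μ (Sum.inl i) / S.Ts) =
      ∑ i ∈ servedRT μ, (Y i - X * P (Sum.inl i) * μ (Sum.inl i) / S.Ts) := by
  rw [servedRT, Finset.sum_filter]
  refine Finset.sum_congr rfl fun i _ => ?_
  by_cases hi : μ (Sum.inl i) = 0 <;> simp [hi]

lemma sum_time_servedRT (μ : User nR nN → ℝ) :
    ∑ i ∈ servedRT μ, μ (Sum.inl i) = ∑ i, μ (Sum.inl i) :=
  Finset.sum_subset (Finset.subset_univ _) fun i _ hi => by simpa using hi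

section Slot

variable {Q : Fin nN → ℝ} {m : S.State} {μ P : User nR nN → ℝ}

lemma IsSlotAllocation.isSchedule_servedRT (h : S.IsSlotAllocation m μ P) :
    S.IsSchedule (fun i => m (Sum.inl i)) (servedRT μ) (fun i => P (Sum.inl i))
      fun i => μ (Sum.inl i) := by
  refine ⟨fun i _ => h.power_nonneg _, fun i _ => h.power_le _, fun i hi =>
    (h.whole_packet i).resolve_left (mem_servedRT.1 hi), ?_⟩
  have htime := h.time_sum
  rw [Fintype.sum_sum_type] at htime
  rw [sum_time_servedRT]
  linarith [Finset.sum_nonneg fun (i : Fin nN) (_ : i ∈ Finset.univ) => h.time_nonneg (Sum.inr i)]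

lemma IsSlotAllocation.inner_queueVec_outcome_le_planValue (h : S.IsSlotAllocation m μ P)
    (hX : 0 ≤ X) (hQ : ∀ i, 0 ≤ Q i) (hψ : 0 ≤ ψ)
    (hmax : ∀ i, S.psiN X (Q i) (m (Sum.inr i)) ≤ ψ) :
    inner ℝ (queueVec Q Y X) (S.outcome m μ P) ≤
      S.planValue X ψ Y (servedRT μ) (fun i => P (Sum.inl i)) fun i => μ (Sum.inl i) := by
  rw [inner_queueVec_outcome, planValue, sum_time_servedRT, sum_weight_eq_sum_servedRT]
  gcongr
  have htime := h.time_sum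
  rw [Fintype.sum_sum_type] at htime
  calc _ ≤ ∑ i, μ (Sum.inr i) * ψ := Finset.sum_le_sum fun i _ =>
        mul_le_mul_of_nonneg_left ((S.le_psiN hX (hQ i) (S.gain_nonneg m _)
          (h.power_nonneg _) (h.power_le _)).trans (hmax i)) (h.time_nonneg _)
    _ = ψ * ∑ i, μ (Sum.inr i) := by rw [← Finset.sum_mul, mul_comm]
    _ ≤ ψ * (S.Ts - ∑ i, μ (Sum.inl i)) := mul_le_mul_of_nonneg_left (by linarith) hψ

lemma IsPlan.servedRT_eq
    (h : S.IsPlan X ψ g A (fun i => P (Sum.inl i)) (fun i => μ (Sum.inl i)) tN) :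
    servedRT μ = A := by
  ext i
  rw [mem_servedRT]
  refine ⟨fun hi => by_contra fun hA => hi (h.unscheduled i hA).2, fun hA h0 => S.L_pos.ne ?_⟩
  rw [← h.packet i hA, h0, zero_mul]

namespace IsLambertStrict

variable (h : S.IsLambertStrict Q Y X m μ P)

include h

lemma sum_time : ∑ i, μ i = S.Ts := by
  obtain ⟨j, -, -, hother, A, hc, -⟩ := h
  rw [Fintype.sum_sum_type, Fintype.sum_eq_single j fun i hi => (hother i hi).2, hc.remaining]
  ring

lemma isSlotAllocation (hX : 0 ≤ X) (hQ : ∀ i, 0 ≤ Q i) : S.IsSlotAllocation m μ P := by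
  have htime := h.sum_time
  obtain ⟨j, -, hPj, hother, A, hc, -⟩ := h
  have hψ := S.psiN_nonneg hX (hQ j) (S.gain_nonneg m (Sum.inr j))
  have hg : ∀ i : Fin nR, 0 ≤ (m (Sum.inl i) : ℝ) := fun i => S.gain_nonneg m _
  have hpower : ∀ i, P (Sum.inr i) ∈ Set.Icc 0 S.Pmax := fun i => by
    by_cases hi : i = j
    · rw [hi, hPj]
      exact ⟨S.waterFilling_nonneg _ _ _, S.waterFilling_le _ _ _⟩
    · rw [(hother i hi).1]
      exact ⟨le_rfl, S.Pmax_pos.le⟩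
  refine ⟨?_, htime.le, ?_, ?_, fun i => ?_⟩
  · rintro (i | i)
    · exact hc.isPlan.time_nonneg hX hψ hg i
    · by_cases hi : i = j
      · exact hi ▸ hc.remaining_nonneg
      · exact (hother i hi).2.ge
  · rintro (i | i)
    exacts [hc.isPlan.power_nonneg hX hψ hg i, (hpower i).1]
  · rintro (i | i)
    exacts [hc.isPlan.power_le i, (hpower i).2]
  · by_cases hi : i ∈ A
    · exact Or.inr (hc.packet i hi)
    · exact Or.inl (hc.unscheduled i hi).2

lemma inner_le (hX : 0 ≤ X) (hQ : ∀ i, 0 ≤ Q i) {o : QueueSpace nR nN} (ho : o ∈ S.outcomes m) :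
    inner ℝ (queueVec Q Y X) o ≤ inner ℝ (queueVec Q Y X) (S.outcome m μ P) := by
  obtain ⟨μ', P', h', rfl⟩ := ho
  obtain ⟨j, hj, hPj, hother, A, hc, hmax⟩ := h
  set ψ := S.psiN X (Q j) (m (Sum.inr j))
  have hψ : 0 ≤ ψ := S.psiN_nonneg hX (hQ j) (S.gain_nonneg m _)
  obtain ⟨A₀, p₀, t₀, tN₀, hc₀, hbest⟩ := exists_isCandidate_forall_planValue_le (S := S) (Y := Y)
    hX hψ fun i => S.gain_nonneg m (Sum.inl i)
  have hvalue : inner ℝ (queueVec Q Y X) (S.outcome m μ P) =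
      S.candidateValue X ψ Y A (fun i => P (Sum.inl i)) (fun i => μ (Sum.inl i))
        (μ (Sum.inr j)) := by
    rw [inner_queueVec_outcome, sum_weight_eq_sum_servedRT, hc.isPlan.servedRT_eq,
      Fintype.sum_eq_single j fun i hi => by rw [(hother i hi).2, zero_mul], hPj, mul_comm,
      candidateValue]
    rfl
  calc inner ℝ (queueVec Q Y X) (S.outcome m μ' P')
      ≤ S.planValue X ψ Y (servedRT μ') (fun i => P' (Sum.inl i)) (fun i => μ' (Sum.inl i)) :=
        h'.inner_queueVec_outcome_le_planValue hX hQ hψ hj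
    _ ≤ S.candidateValue X ψ Y A₀ p₀ t₀ tN₀ := hbest _ _ _ h'.isSchedule_servedRT
    _ ≤ _ := hmax A₀ p₀ t₀ tN₀ hc₀
    _ = _ := hvalue.symm

end IsLambertStrict

end Slot

end System

/-! ### Slack and the tight cone -/

lemma exists_pos_forall_eq_zero_or_le {ι : Type*} [Finite ι] {f : ι → ℝ} (hf : ∀ i, 0 ≤ f i) :
    ∃ c : ℝ, 0 < c ∧ ∀ i, f i = 0 ∨ c ≤ f i := by
  have : ∀ᶠ c in 𝓝[>] (0 : ℝ), ∀ i, f i = 0 ∨ c ≤ f i := by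
    refine eventually_all.2 fun i => ?_
    rcases (hf i).eq_or_lt with hzero | hpos
    · exact Eventually.of_forall fun _ => Or.inl hzero.symm
    · filter_upwards [Ioo_mem_nhdsGT hpos] with c hc using Or.inr hc.2.le
  obtain ⟨c, hc, hpos⟩ := (this.and self_mem_nhdsWithin).exists
  exact ⟨c, hpos, hc⟩

namespace System

variable {nR nN : ℕ} (S : System nR nN) (lam : Fin nN → ℝ)

/-- The amount by which the best mean outcome in the direction of the queues `v` exceeds the inflow.
It is the largest possible negative drift of `‖v‖² / 2`, up to a bounded error. -/
def slack (v : QueueSpace nR nN) : ℝ :=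
  meanSupport S.prob S.outcomes v - inner ℝ v (S.target lam)

lemma meanSupport_le_of_forall_meanOutcome {v : QueueSpace nR nN} {c : ℝ}
    (h : ∀ μ P : S.State → User nR nN → ℝ, (∀ m, S.IsSlotAllocation m (μ m) (P m)) →
      inner ℝ v (S.meanOutcome μ P) ≤ c) : meanSupport S.prob S.outcomes v ≤ c := by
  refine le_of_forall_pos_le_add fun e he => ?_
  obtain ⟨μ, P, hall, hle⟩ := S.exists_meanSupport_le_inner_meanOutcome_add v he
  linarith [h μ P hall]

lemma exists_slack_le_slack_add :
    ∃ C : ℝ, 0 ≤ C ∧ ∀ v v' : QueueSpace nR nN,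
      S.slack lam v ≤ S.slack lam v' + C * ‖v - v'‖ := by
  obtain ⟨C, hC, hC'⟩ := S.exists_norm_bound
  have hC0 : 0 ≤ C := (norm_nonneg _).trans (hC' 0 fun _ => by simp)
  refine ⟨C + ‖S.target lam‖, by positivity, fun v v' => ?_⟩
  have hlip := meanSupport_le_add S.prob_nonneg S.prob_sum S.outcomes_nonempty hC v v'
  have hinner := real_inner_le_norm (v' - v) (S.target lam)
  rw [inner_sub_left, norm_sub_rev] at hinner
  rw [slack, slack]
  linarith

/-- The RT part of a vector of queues. Only in these coordinates can the slack vanish. -/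
def restrictRT (x : QueueSpace nR nN) : QueueSpace nR nN :=
  WithLp.toLp 2 fun
    | some (Sum.inl i) => x (some (Sum.inl i))
    | _ => 0

@[simp] lemma restrictRT_none (x : QueueSpace nR nN) : restrictRT x none = 0 := rfl

@[simp] lemma restrictRT_inl (x : QueueSpace nR nN) (i : Fin nR) :
    restrictRT x (some (Sum.inl i)) = x (some (Sum.inl i)) := rfl

@[simp] lemma restrictRT_inr (x : QueueSpace nR nN) (i : Fin nN) :
    restrictRT x (some (Sum.inr i)) = 0 := rfl

lemma inner_restrictRT_left (x : QueueSpace nR nN) {y : QueueSpace nR nN} (hnone : y none = 0)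
    (hinr : ∀ i : Fin nN, y (some (Sum.inr i)) = 0) :
    inner ℝ (restrictRT x) y = inner ℝ y x := by
  simp [inner_eq_sum_mul, Fintype.sum_option, hnone, hinr, mul_comm]

lemma norm_sub_restrictRT_le {x : QueueSpace nR nN} (hx : ∀ j, 0 ≤ x j) :
    ‖x - restrictRT x‖ ≤ ∑ i : Fin nN, x (some (Sum.inr i)) + x none := by
  refine (norm_le_sum_abs _).trans_eq ?_
  simp [Fintype.sum_option, abs_of_nonneg (hx _), add_comm]

/-- Normals of a polyhedral cone of RT directions, cut out of the tight cone by the mean outcomes of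
all allocations. -/
def rtNormals : Set (QueueSpace nR nN) :=
  (Set.range fun j => EuclideanSpace.single j 1) ∪ {-EuclideanSpace.single none 1} ∪
    (Set.range fun i : Fin nN => -EuclideanSpace.single (some (Sum.inr i)) 1) ∪
    {d | ∃ μ P : S.State → User nR nN → ℝ, (∀ m, S.IsSlotAllocation m (μ m) (P m)) ∧
      d = restrictRT (S.target lam - S.meanOutcome μ P)}

/-- The RT part of the mean outcome only depends on which users are scheduled in which state, since
a scheduled RT user receives exactly one packet. -/
lemma finite_rtNormals : (S.rtNormals lam).Finite := by
  classical
  refine (((Set.finite_range _).union (Set.finite_singleton _)).union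
    (Set.finite_range _)).union ?_
  refine (Set.finite_range fun idle : S.State → Fin nR → Bool => restrictRT (S.target lam -
    WithLp.toLp 2 fun
      | some (Sum.inl i) => ∑ m, S.prob m * if idle m i then 0 else 1
      | _ => 0)).subset ?_
  rintro _ ⟨μ, P, -, rfl⟩
  refine ⟨fun m i => decide (μ m (Sum.inl i) = 0), ?_⟩
  ext (_ | i | i)
  · rfl
  · simp [meanOutcome_apply]
  · rfl

lemma innerDual_rtNormals_subset_tightCone :
    (ProperCone.innerDual (S.rtNormals lam) : Set (QueueSpace nR nN)) ⊆
      tightCone S.prob S.outcomes (S.target lam) := by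
  intro y hy
  have hdual : ∀ g ∈ S.rtNormals lam, 0 ≤ inner ℝ g y := fun g hg => hy hg
  have hnonneg : ∀ j, 0 ≤ y j := fun j => by
    simpa [EuclideanSpace.inner_single_left] using hdual _ (.inl (.inl (.inl ⟨j, rfl⟩)))
  have hnone : y none = 0 := (hnonneg none).antisymm' <| by
    simpa [EuclideanSpace.inner_single_left] using hdual _ (.inl (.inl (.inr rfl)))
  have hinr : ∀ i : Fin nN, y (some (Sum.inr i)) = 0 := fun i => (hnonneg _).antisymm' <| by
    simpa [EuclideanSpace.inner_single_left] using hdual _ (.inl (.inr ⟨i, rfl⟩))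
  refine ⟨hnonneg, S.meanSupport_le_of_forall_meanOutcome fun μ P hall => ?_⟩
  have hexcess := hdual _ (.inr ⟨μ, P, hall, rfl⟩)
  rw [inner_restrictRT_left _ hnone hinr, inner_sub_right] at hexcess
  linarith

variable {lam}

lemma neg_slack_restrictRT_le_inner {x : QueueSpace nR nN} (hx : ∀ j, 0 ≤ x j)
    (hslack : 0 ≤ S.slack lam (restrictRT x)) {g : QueueSpace nR nN} (hg : g ∈ S.rtNormals lam) :
    -S.slack lam (restrictRT x) ≤ inner ℝ g (restrictRT x) := by
  rcases hg with ((⟨j, rfl⟩ | rfl) | ⟨i, rfl⟩) | ⟨μ, P, hall, rfl⟩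
  · refine (neg_nonpos.2 hslack).trans ?_
    rcases j with _ | i | i <;> simp [EuclideanSpace.inner_single_left, hx]
  · simpa [EuclideanSpace.inner_single_left] using hslack
  · simpa [EuclideanSpace.inner_single_left] using hslack
  · rw [inner_restrictRT_left _ (restrictRT_none x) (restrictRT_inr x), inner_sub_right, slack]
    linarith [inner_meanOutcome_le hall (restrictRT x)]

lemma exists_mul_infDist_restrictRT_le_slack
    (hslack : ∀ v : QueueSpace nR nN, (∀ j, 0 ≤ v j) → 0 ≤ S.slack lam v) :
    ∃ κ : ℝ, 0 < κ ∧ ∀ w : QueueSpace nR nN, (∀ j, 0 ≤ w j) →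
      κ * Metric.infDist (restrictRT w) (tightCone S.prob S.outcomes (S.target lam)) ≤
        S.slack lam (restrictRT w) := by
  obtain ⟨κ, hκ, hhoffman⟩ := exists_hoffman_bound (S.finite_rtNormals lam)
  refine ⟨κ, hκ, fun w hw => ?_⟩
  have hnonneg : ∀ j, 0 ≤ restrictRT w j := by
    rintro (_ | i | i) <;> simp [hw]
  have hrt := hslack _ hnonneg
  refine le_trans ?_ (hhoffman _ _ hrt fun g hg => S.neg_slack_restrictRT_le_inner hw hrt hg)
  exact mul_le_mul_of_nonneg_left
    (Metric.infDist_le_infDist_of_subset (S.innerDual_rtNormals_subset_tightCone lam)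
      ⟨0, zero_mem _⟩) hκ.le

section Interior

variable {ε : ℝ} (hε : 0 < ε) (h : (1 + ε) • lam ∈ S.lambertRegion)

include hε h

lemma nonneg_of_smul_mem (i : Fin nN) : 0 ≤ lam i :=
  nonneg_of_mul_nonneg_right (S.nonneg_of_mem_lambertRegion h i) (by linarith)

lemma slack_nonneg_of_smul_mem {v : QueueSpace nR nN} (hv : ∀ j, 0 ≤ v j) :
    0 ≤ S.slack lam v := by
  refine sub_nonneg.2 (le_trans ?_ (S.inner_target_le_of_mem h hv))
  rw [inner_eq_sum_mul, inner_eq_sum_mul]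
  refine Finset.sum_le_sum fun j _ => mul_le_mul_of_nonneg_left ?_ (hv j)
  rcases j with _ | i | i
  · simp
  · simp
  · refine mul_le_mul_of_nonneg_left ?_ S.L_pos.le
    exact le_mul_of_one_le_left (S.nonneg_of_smul_mem hε h i) (by linarith)

lemma eq_zero_of_mem_tightCone {y : QueueSpace nR nN}
    (hy : y ∈ tightCone S.prob S.outcomes (S.target lam)) {i : Fin nN} (hi : lam i ≠ 0) :
    y (some (Sum.inr i)) = 0 := by
  obtain ⟨δ, hδ, hslack⟩ := S.exists_slack_of_mem hε h fun hlam => hi (congrFun hlam i)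
  have hterm : ∀ i', 0 ≤ lam i' * y (some (Sum.inr i')) := fun i' =>
    mul_nonneg (S.nonneg_of_smul_mem hε h i') (hy.1 _)
  have hsum : ∑ i, lam i * y (some (Sum.inr i)) + y none ≤ 0 :=
    nonpos_of_mul_nonpos_right (by linarith [hslack y hy.1, hy.2]) hδ
  have hi0 := Finset.single_le_sum (fun i' _ => hterm i') (Finset.mem_univ i)
  have : lam i * y (some (Sum.inr i)) = 0 := le_antisymm (by linarith [hy.1 none]) (hterm i)
  exact (mul_eq_zero.1 this).resolve_left hi

variable (hlam : lam ≠ 0)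

include hlam

lemma exists_mul_sum_le_slack :
    ∃ δ : ℝ, 0 < δ ∧ ∀ w : QueueSpace nR nN, (∀ j, 0 ≤ w j) →
      (∀ i, lam i = 0 → w (some (Sum.inr i)) = 0) →
      δ * (∑ i : Fin nN, w (some (Sum.inr i)) + w none) ≤ S.slack lam w := by
  obtain ⟨δ, hδ, hslack⟩ := S.exists_slack_of_mem hε h hlam
  obtain ⟨c, hc, hmin⟩ := exists_pos_forall_eq_zero_or_le (S.nonneg_of_smul_mem hε h)
  refine ⟨δ * min c 1, by positivity, fun w hw hw0 => ?_⟩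
  have hsum : min c 1 * (∑ i : Fin nN, w (some (Sum.inr i)) + w none) ≤
      ∑ i, lam i * w (some (Sum.inr i)) + w none := by
    rw [mul_add, Finset.mul_sum]
    refine add_le_add (Finset.sum_le_sum fun i _ => ?_)
      (mul_le_of_le_one_left (hw _) (min_le_right _ _))
    rcases hmin i with hzero | hle
    · simp [hw0 i hzero]
    · exact mul_le_mul_of_nonneg_right ((min_le_left _ _).trans hle) (hw _)
  have hscaled := mul_le_mul_of_nonneg_left hsum hδ.le
  have hw' := hslack w hw
  rw [slack]
  linarith

/-- Replacing `w` by its RT part costs a multiple of the other coordinates, which are bounded by the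
slack. -/
lemma exists_mul_infDist_tightCone_le_slack :
    ∃ κ : ℝ, 0 < κ ∧ ∀ w : QueueSpace nR nN, (∀ j, 0 ≤ w j) →
      (∀ i, lam i = 0 → w (some (Sum.inr i)) = 0) →
      κ * Metric.infDist w (tightCone S.prob S.outcomes (S.target lam)) ≤ S.slack lam w := by
  obtain ⟨δ, hδ, hsum⟩ := S.exists_mul_sum_le_slack hε h hlam
  obtain ⟨κ, hκ, hrt⟩ := S.exists_mul_infDist_restrictRT_le_slack
    fun v hv => S.slack_nonneg_of_smul_mem hε h hv
  obtain ⟨C, hC, hlip⟩ := S.exists_slack_le_slack_add lam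
  set c := 1 / δ + (1 + C / δ) / κ
  refine ⟨1 / c, by positivity, fun w hw hw0 => ?_⟩
  set s := S.slack lam w
  have hdist : ‖w - restrictRT w‖ ≤ s / δ :=
    (norm_sub_restrictRT_le hw).trans ((le_div_iff₀' hδ).2 (hsum w hw hw0))
  have hinf : Metric.infDist (restrictRT w) (tightCone S.prob S.outcomes (S.target lam)) ≤
      (s + C * (s / δ)) / κ := by
    rw [le_div_iff₀' hκ]
    refine (hrt w hw).trans ((hlip _ w).trans ?_)
    rw [norm_sub_rev]
    gcongr
  rw [one_div, inv_mul_le_iff₀ (by positivity)]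
  calc Metric.infDist w (tightCone S.prob S.outcomes (S.target lam))
      ≤ Metric.infDist (restrictRT w) (tightCone S.prob S.outcomes (S.target lam)) +
          dist w (restrictRT w) := Metric.infDist_le_infDist_add_dist
    _ ≤ (s + C * (s / δ)) / κ + s / δ := add_le_add hinf (dist_eq_norm w _ ▸ hdist)
    _ = c * s := by ring

end Interior

end System

/-! ### Arrivals, fading states and queues over time -/

section Probability

variable {Ω α β ι : Type*} {mΩ : MeasurableSpace Ω}

lemma measurable_comp_of_finite_range [MeasurableSpace α] [MeasurableSingletonClass α]
    [MeasurableSpace β] {f : Ω → α} (hf : Measurable f) (hfin : (Set.range f).Finite) (g : α → β) :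
    Measurable fun ω => g (f ω) := by
  intro s _
  have hpre : (fun ω => g (f ω)) ⁻¹' s = f ⁻¹' (Set.range f ∩ g ⁻¹' s) := by
    ext ω
    simp
  rw [hpre]
  exact hf (hfin.inter_of_left _).measurableSet

lemma measurable_and_finite_range_of_recursion [MeasurableSpace α] [MeasurableSingletonClass α]
    [MeasurableSpace β] [MeasurableSingletonClass β] {ℱ : Filtration ℕ mΩ} {ξ : ℕ → Ω → β}
    (hξ : ∀ k, Measurable[ℱ (k + 1)] (ξ k)) (hfin : ∀ k, (Set.range (ξ k)).Finite)
    {w : ℕ → Ω → α} {w₀ : α} (h0 : ∀ ω, w 0 ω = w₀) {next : α → β → α}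
    (hsucc : ∀ k ω, w (k + 1) ω = next (w k ω) (ξ k ω)) (k : ℕ) :
    Measurable[ℱ (k + 1)] (fun ω => (w k ω, ξ k ω)) ∧
      (Set.range fun ω => (w k ω, ξ k ω)).Finite := by
  suffices hw : Measurable[ℱ k] (w k) ∧ (Set.range (w k)).Finite by
    refine ⟨(hw.1.mono (ℱ.mono k.le_succ) le_rfl).prodMk (hξ k),
      (hw.2.prod (hfin k)).subset ?_⟩
    rintro _ ⟨ω, rfl⟩
    exact ⟨⟨ω, rfl⟩, ω, rfl⟩
  induction k with
  | zero =>
    rw [show w 0 = fun _ => w₀ from funext h0]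
    exact ⟨measurable_const, Set.finite_range_const⟩
  | succ k ih =>
    have hpair : (Set.range fun ω => (w k ω, ξ k ω)).Finite :=
      (ih.2.prod (hfin k)).subset (by rintro _ ⟨ω, rfl⟩; exact ⟨⟨ω, rfl⟩, ω, rfl⟩)
    rw [show w (k + 1) = fun ω => next (w k ω) (ξ k ω) from funext (hsucc k)]
    refine ⟨measurable_comp_of_finite_range
      ((ih.1.mono (ℱ.mono k.le_succ) le_rfl).prodMk (hξ k)) hpair fun x => next x.1 x.2, ?_⟩
    refine (hpair.image fun x => next x.1 x.2).subset ?_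
    rintro _ ⟨ω, rfl⟩
    exact ⟨_, ⟨ω, rfl⟩, rfl⟩

lemma ae_tendsto_average_comp [Fintype ι] [MeasurableSpace ι] [MeasurableSingletonClass ι]
    {Pr : Measure Ω} [IsProbabilityMeasure Pr] {X : ℕ → Ω → ι} (hX : ∀ k, Measurable (X k))
    (hind : Pairwise fun k l => IndepFun (X k) (X l) Pr) {p : ι → ℝ}
    (hp : ∀ k x, Pr.real {ω | X k ω = x} = p x) (f : ι → ℝ) :
    ∀ᵐ ω ∂Pr, Tendsto (fun K : ℕ => (∑ k ∈ Finset.range K, f (X k ω)) / K) atTop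
      (𝓝 (∑ x, p x * f x)) := by
  have hf : Measurable f := measurable_of_finite f
  have hlaw : ∀ k x, (Pr.map (X k)).real {x} = p x := fun k x => by
    rw [map_measureReal_apply (hX k) (measurableSet_singleton x)]
    exact hp k x
  have hident : ∀ k, IdentDistrib (X k) (X 0) Pr Pr := fun k =>
    ⟨(hX k).aemeasurable, (hX 0).aemeasurable, Measure.ext_of_singleton fun x => by
      have := Measure.isProbabilityMeasure_map (μ := Pr) (hX k).aemeasurable
      have := Measure.isProbabilityMeasure_map (μ := Pr) (hX 0).aemeasurable
      exact (measureReal_eq_measureReal_iff (by finiteness) (by finiteness)).1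
        ((hlaw k x).trans (hlaw 0 x).symm)⟩
  have hint : Integrable (fun ω => f (X 0 ω)) Pr :=
    (Integrable.of_finite (μ := Pr.map (X 0)) (f := f)).comp_measurable (hX 0)
  have hmean : ∫ ω, f (X 0 ω) ∂Pr = ∑ x, p x * f x := by
    rw [← integral_map (hX 0).aemeasurable hf.aestronglyMeasurable, integral_fintype .of_finite]
    simp only [hlaw, smul_eq_mul]
  rw [← hmean]
  exact strong_law_ae_real (fun k ω => f (X k ω)) hint (fun k l hkl => (hind hkl).comp hf hf)
    fun k => (hident k).comp hf

end Probability

namespace System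

variable {nR nN : ℕ} (S : System nR nN)

section Path

variable (a : ℕ → User nR nN → ℝ) (g : ℕ → S.State)

section

variable (μ P : ℕ → User nR nN → ℝ)

/-- All queues along a sample path, as one vector. -/
def pathQueue (k : ℕ) : QueueSpace nR nN :=
  queueVec (fun i => S.queue a g μ P i k) (fun i => S.deliveryQueue a μ i k) (S.powerQueue μ P k)

lemma pathQueue_zero : S.pathQueue a g μ P 0 = 0 := by
  ext j
  rcases j with _ | i | i <;> rfl

lemma pathQueue_succ (k : ℕ) : S.pathQueue a g μ P (k + 1) =
    posVec (S.pathQueue a g μ P k + (S.inflow (a k) - S.outcome (g k) (μ k) (P k))) := by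
  ext j
  rw [posVec_apply, PiLp.add_apply, PiLp.sub_apply]
  rcases j with _ | i | i
  · rw [inflow_none, outcome_none]
    change max (S.powerQueue μ P k + (∑ i, P k i * μ k i) / S.Ts - S.Pavg) 0 =
      max (S.powerQueue μ P k + _) 0
    congr 1
    ring
  · rw [inflow_inl, outcome_inl, ← add_sub_assoc]
    rfl
  · rw [inflow_inr, outcome_inr, ← add_sub_assoc]
    rfl

lemma pathQueue_nonneg (k : ℕ) (j : Option (User nR nN)) : 0 ≤ S.pathQueue a g μ P k j := by
  cases k with
  | zero => simp [pathQueue_zero]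
  | succ k =>
    rw [pathQueue_succ]
    exact le_max_right _ _

lemma sum_inflow_sub_sum_outcome_le_pathQueue (K : ℕ) (j : Option (User nR nN)) :
    ∑ k ∈ Finset.range K, S.inflow (a k) j - ∑ k ∈ Finset.range K, S.outcome (g k) (μ k) (P k) j ≤
      S.pathQueue a g μ P K j := by
  induction K with
  | zero => simp [pathQueue_zero]
  | succ K ih =>
    rw [Finset.sum_range_succ, Finset.sum_range_succ, pathQueue_succ, posVec_apply,
      PiLp.add_apply, PiLp.sub_apply]
    refine le_trans ?_ (le_max_left _ _)
    linarith

end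

/-- All queues along a sample path when a slot with queues `w` and fading state `m` uses the
allocation `(u w m, p w m)`. -/
def feedbackQueue (u p : QueueSpace nR nN → S.State → User nR nN → ℝ) : ℕ → QueueSpace nR nN
  | 0 => 0
  | k + 1 => posVec (feedbackQueue u p k + (S.inflow (a k) -
      S.outcome (g k) (u (feedbackQueue u p k) (g k)) (p (feedbackQueue u p k) (g k))))

lemma pathQueue_eq_feedbackQueue (u p : QueueSpace nR nN → S.State → User nR nN → ℝ) (k : ℕ) :
    S.pathQueue a g (fun l => u (S.feedbackQueue a g u p l) (g l))
      (fun l => p (S.feedbackQueue a g u p l) (g l)) k = S.feedbackQueue a g u p k := by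
  induction k with
  | zero => exact S.pathQueue_zero _ _ _ _
  | succ k ih => rw [pathQueue_succ, ih, feedbackQueue]

lemma exists_isLambertStrict_select (hN : 0 < nN) :
    ∃ u p : QueueSpace nR nN → S.State → User nR nN → ℝ, ∀ w, (∀ j, 0 ≤ w j) → ∀ m,
      S.IsLambertStrict (fun i => w (some (.inr i))) (fun i => w (some (.inl i))) (w none) m
        (u w m) (p w m) := by
  have hex : ∀ (w : QueueSpace nR nN) (m : S.State), ∃ μ P : User nR nN → ℝ, (∀ j, 0 ≤ w j) →
      S.IsLambertStrict (fun i => w (some (.inr i))) (fun i => w (some (.inl i))) (w none) m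
        μ P := by
    intro w m
    by_cases hw : ∀ j, 0 ≤ w j
    · obtain ⟨μ, P, hs⟩ := exists_isLambertStrict (Y := fun i => w (some (.inl i))) hN (hw none)
        (fun i => hw (some (.inr i))) m
      exact ⟨μ, P, fun _ => hs⟩
    · exact ⟨0, 0, fun hw' => absurd hw' hw⟩
  choose u p h using hex
  exact ⟨u, p, fun w hw m => h w m hw⟩

end Path

namespace IsEnvironment

variable {S} {Ω : Type*} {mΩ : MeasurableSpace Ω} {Pr : Measure Ω}
  {ℱ : Filtration ℕ mΩ} {a : ℕ → Ω → User nR nN → ℝ} {γ : ℕ → Ω → S.State} {lam : Fin nN → ℝ}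
  (h : S.IsEnvironment lam Pr ℱ a γ)

include h

lemma arrival_mem (k : ℕ) (ω : Ω) (i : User nR nN) : a k ω i ∈ Set.Icc (0 : ℝ) 1 := by
  rcases h.arrival k ω i with h | h <;> simp [h]

lemma finite_range (k : ℕ) : (Set.range fun ω => (a k ω, γ k ω)).Finite := by
  have harr : {f : User nR nN → ℝ | ∀ i, f i ∈ ({0, 1} : Set ℝ)}.Finite :=
    Set.Finite.pi' fun _ => Set.toFinite _
  refine (harr.prod (Set.finite_univ (α := S.State))).subset ?_
  rintro _ ⟨ω, rfl⟩
  exact ⟨fun i => by simpa using h.arrival k ω i, trivial⟩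

lemma measurable (k : ℕ) : Measurable fun ω => (a k ω, γ k ω) :=
  (h.meas k).mono (ℱ.le _) le_rfl

lemma measurable_arrival (k : ℕ) (i : User nR nN) : Measurable fun ω => a k ω i :=
  (measurable_pi_apply i).comp (measurable_fst.comp (h.measurable k))

lemma measurable_state (k : ℕ) : Measurable (γ k) := measurable_snd.comp (h.measurable k)

lemma indepFun_past {β : Type*} [MeasurableSpace β] {k : ℕ} {f : Ω → β}
    (hf : Measurable[ℱ k] f) : IndepFun f (fun ω => (a k ω, γ k ω)) Pr := by
  rw [IndepFun_iff_Indep]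
  exact indep_of_indep_of_le_left (h.indep k).symm hf.comap_le

lemma pairwise_indepFun : Pairwise fun k l =>
    IndepFun (fun ω => (a k ω, γ k ω)) (fun ω => (a l ω, γ l ω)) Pr := by
  have hlt : ∀ k l, k < l → IndepFun (fun ω => (a k ω, γ k ω)) (fun ω => (a l ω, γ l ω)) Pr :=
    fun k l hkl => h.indepFun_past ((h.meas k).mono (ℱ.mono hkl) le_rfl)
  intro k l hne
  exact hne.lt_or_gt.elim (hlt k l) fun hlk => (hlt l k hlk).symm

lemma prob_arrival (k : ℕ) (i : User nR nN) :
    Pr.real {ω | a k ω i = 1} = Sum.elim S.rateR lam i := by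
  rcases i with i | i
  · exact h.rate_RT k i
  · exact h.rate_NRT k i

lemma measurableSet_arrival (k : ℕ) (i : User nR nN) : MeasurableSet {ω | a k ω i = 1} :=
  h.measurable_arrival k i (measurableSet_singleton 1)

lemma integral_arrival (k : ℕ) (i : User nR nN) :
    ∫ ω, a k ω i ∂Pr = Sum.elim S.rateR lam i := by
  have hind : (fun ω => a k ω i) = {ω | a k ω i = 1}.indicator fun _ => (1 : ℝ) := by
    funext ω
    rcases h.arrival k ω i with h | h <;> simp [h]
  rw [hind, integral_indicator_const _ (h.measurableSet_arrival k i),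
    h.prob_arrival, smul_eq_mul, mul_one]

lemma exists_policy (hN : 0 < nN) : ∃ μ P : ℕ → Ω → User nR nN → ℝ,
    IsCausal ℱ μ P ∧ S.FollowsLambertStrict a γ μ P := by
  obtain ⟨u, p, hsel⟩ := S.exists_isLambertStrict_select hN
  set w : ℕ → Ω → QueueSpace nR nN := fun k ω =>
    S.feedbackQueue (fun l => a l ω) (fun l => γ l ω) u p k
  have hmeas := measurable_and_finite_range_of_recursion h.meas h.finite_range (w := w)
    (fun _ => rfl)
    (next := fun v x => posVec (v + (S.inflow x.1 - S.outcome x.2 (u v x.2) (p v x.2))))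
    (fun _ _ => rfl)
  refine ⟨fun k ω => u (w k ω) (γ k ω), fun k ω => p (w k ω) (γ k ω), fun k => ?_, fun k ω => ?_⟩
  · exact ⟨measurable_comp_of_finite_range (hmeas k).1 (hmeas k).2 fun x => u x.1 x.2.2,
      measurable_comp_of_finite_range (hmeas k).1 (hmeas k).2 fun x => p x.1 x.2.2⟩
  · have hqueue : S.pathQueue (fun l => a l ω) (fun l => γ l ω) (fun l => u (w l ω) (γ l ω))
        (fun l => p (w l ω) (γ l ω)) k = w k ω := S.pathQueue_eq_feedbackQueue _ _ u p k
    have hstrict := hsel (w k ω) (fun j => hqueue ▸ S.pathQueue_nonneg _ _ _ _ k j) (γ k ω)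
    simp only [← hqueue] at hstrict ⊢
    exact hstrict

variable [IsProbabilityMeasure Pr]

lemma rate_mem (i : Fin nN) : lam i ∈ Set.Icc (0 : ℝ) 1 := by
  rw [← h.rate_NRT 0 i]
  exact ⟨measureReal_nonneg, measureReal_le_one⟩

lemma ae_tendsto_average_state (f : S.State → ℝ) :
    ∀ᵐ ω ∂Pr, Tendsto (fun K : ℕ => (∑ k ∈ Finset.range K, f (γ k ω)) / K) atTop
      (𝓝 (∑ m, S.prob m * f m)) :=
  ae_tendsto_average_comp h.measurable_state
    (fun _ _ hkl => (h.pairwise_indepFun hkl).comp measurable_snd measurable_snd) h.state f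

lemma ae_tendsto_average_arrival (i : User nR nN) :
    ∀ᵐ ω ∂Pr, Tendsto (fun K : ℕ => (∑ k ∈ Finset.range K, a k ω i) / K) atTop
      (𝓝 (Sum.elim S.rateR lam i)) := by
  classical
  have hone : MeasurableSet {x : (User nR nN → ℝ) × S.State | x.1 i = 1} :=
    measurableSet_eq_fun (by fun_prop) measurable_const
  have hdec : Measurable fun x : (User nR nN → ℝ) × S.State => decide (x.1 i = 1) :=
    measurable_to_bool (by simpa [Set.preimage] using hone)
  have hlaw : ∀ k b, Pr.real {ω | decide (a k ω i = 1) = b} =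
      cond b (Sum.elim S.rateR lam i) (1 - Sum.elim S.rateR lam i) := by
    intro k b
    cases b
    · have hcompl : {ω | decide (a k ω i = 1) = false} = {ω | a k ω i = 1}ᶜ := by
        ext ω
        simp
      rw [hcompl, measureReal_compl (h.measurableSet_arrival k i), h.prob_arrival,
        probReal_univ, cond_false]
    · simpa using h.prob_arrival k i
  have hlim := ae_tendsto_average_comp (fun k => hdec.comp (h.measurable k))
    (fun k l hkl => (h.pairwise_indepFun hkl).comp hdec hdec) hlaw fun b => cond b 1 0
  filter_upwards [hlim] with ω hω
  convert hω using 3 with K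
  · refine Finset.sum_congr rfl fun k _ => ?_
    rcases h.arrival k ω i with h | h <;> simp [h]
  · simp

lemma ae_tendsto_average_inflow (j : Option (User nR nN)) :
    ∀ᵐ ω ∂Pr, Tendsto (fun K : ℕ => (∑ k ∈ Finset.range K, S.inflow (a k ω) j) / K) atTop
      (𝓝 (S.target lam j)) := by
  rcases j with _ | i | i
  · refine ae_of_all _ fun ω => tendsto_const_nhds.congr' ?_
    filter_upwards [eventually_ge_atTop 1] with K hK
    have : (K : ℝ) ≠ 0 := by positivity
    simp only [inflow_none, target_none, Finset.sum_const, Finset.card_range, nsmul_eq_mul]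
    field_simp
  · filter_upwards [h.ae_tendsto_average_arrival (.inl i)] with ω hω
    refine (hω.mul_const (S.q i)).congr fun K => ?_
    simp only [inflow_inl, ← Finset.sum_mul]
    ring
  · filter_upwards [h.ae_tendsto_average_arrival (.inr i)] with ω hω
    refine (hω.const_mul S.L).congr fun K => ?_
    simp only [inflow_inr, ← Finset.mul_sum]
    ring

end IsEnvironment

end System

/-! ### Achievability -/

lemma measurable_posVec {J : Type*} :
    Measurable (posVec : EuclideanSpace ℝ J → EuclideanSpace ℝ J) :=
  (WithLp.measurable_toLp 2 (J → ℝ)).comp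
    (measurable_pi_lambda _ fun j => (by fun_prop : Measurable fun x : EuclideanSpace ℝ J =>
      x j).max measurable_const)

namespace System

variable {nR nN : ℕ} (S : System nR nN)

lemma measurable_outcome : Measurable fun x : S.State × (User nR nN → ℝ) × (User nR nN → ℝ) =>
    S.outcome x.1 x.2.1 x.2.2 := by
  refine (WithLp.measurable_toLp 2 _).comp (measurable_pi_lambda _ fun j => ?_)
  rcases j with _ | i | i
  · fun_prop
  · exact Measurable.ite (measurableSet_eq_fun (by fun_prop) measurable_const)
      measurable_const measurable_const
  · simp only [rate]
    fun_prop

lemma measurable_inflow : Measurable S.inflow := by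
  refine (WithLp.measurable_toLp 2 _).comp (measurable_pi_lambda _ fun j => ?_)
  rcases j with _ | i | i <;> fun_prop

lemma average_power_eq (g : ℕ → S.State) (μ P : ℕ → User nR nN → ℝ) (K : ℕ) :
    (∑ k ∈ Finset.range K, ∑ i, P k i * μ k i) / (K * S.Ts) =
      -((∑ k ∈ Finset.range K, S.outcome (g k) (μ k) (P k) none) / K) := by
  simp only [outcome_none, Finset.sum_neg_distrib, neg_div, neg_neg]
  rw [← Finset.sum_div, div_div, mul_comm]

variable {S} in
lemma average_service_eq {g : ℕ → S.State} {μ P : ℕ → User nR nN → ℝ}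
    (hall : ∀ k, S.IsSlotAllocation (g k) (μ k) (P k)) (i : Fin nR) (K : ℕ) :
    (∑ k ∈ Finset.range K, μ k (.inl i) * rate (P k (.inl i)) (g k (.inl i))) / (S.L * K) =
      (∑ k ∈ Finset.range K, S.outcome (g k) (μ k) (P k) (some (.inl i))) / K := by
  rw [Finset.sum_congr rfl fun k _ => (hall k).service_eq i, ← Finset.mul_sum,
    mul_div_mul_left _ _ S.L_pos.ne']
  simp only [outcome_inl]

variable {Ω : Type*} {mΩ : MeasurableSpace Ω}

/-- The queues under the policy `(μ, P)` as random vectors. -/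
def randomQueue (a : ℕ → Ω → User nR nN → ℝ) (γ : ℕ → Ω → S.State)
    (μ P : ℕ → Ω → User nR nN → ℝ) (k : ℕ) (ω : Ω) : QueueSpace nR nN :=
  S.pathQueue (fun l => a l ω) (fun l => γ l ω) (fun l => μ l ω) (fun l => P l ω) k

variable {S} {Pr : Measure Ω} {ℱ : Filtration ℕ mΩ} {a : ℕ → Ω → User nR nN → ℝ}
  {γ : ℕ → Ω → S.State} {lam : Fin nN → ℝ} {μ P : ℕ → Ω → User nR nN → ℝ}

lemma randomQueue_nonneg (k : ℕ) (ω : Ω) (j : Option (User nR nN)) :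
    0 ≤ S.randomQueue a γ μ P k ω j :=
  S.pathQueue_nonneg _ _ _ _ k j

lemma measurable_randomQueue {m : ℕ → MeasurableSpace Ω} (hm : Monotone m)
    (ha : ∀ k, Measurable[m (k + 1)] (a k)) (hγ : ∀ k, Measurable[m (k + 1)] (γ k))
    (hμ : ∀ k, Measurable[m (k + 1)] (μ k)) (hP : ∀ k, Measurable[m (k + 1)] (P k)) (k : ℕ) :
    Measurable[m k] (S.randomQueue a γ μ P k) := by
  induction k with
  | zero =>
    rw [show S.randomQueue a γ μ P 0 = fun _ => 0 from funext fun ω => S.pathQueue_zero _ _ _ _]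
    exact measurable_const
  | succ k ih =>
    have hsucc : S.randomQueue a γ μ P (k + 1) = fun ω => posVec (S.randomQueue a γ μ P k ω +
        (S.inflow (a k ω) - S.outcome (γ k ω) (μ k ω) (P k ω))) :=
      funext fun ω => S.pathQueue_succ _ _ _ _ k
    rw [hsucc]
    exact measurable_posVec.comp ((ih.mono (hm k.le_succ) le_rfl).add
      ((S.measurable_inflow.comp (ha k)).sub
        (S.measurable_outcome.comp ((hγ k).prodMk ((hμ k).prodMk (hP k))))))

lemma sum_average_inflow_sub_le (ω : Ω) (K : ℕ) (j : Option (User nR nN)) :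
    (∑ k ∈ Finset.range K, S.inflow (a k ω) j) / K - S.randomQueue a γ μ P K ω j / K ≤
      (∑ k ∈ Finset.range K, S.outcome (γ k ω) (μ k ω) (P k ω) j) / K := by
  rw [← sub_div]
  gcongr
  exact sub_le_comm.1 (S.sum_inflow_sub_sum_outcome_le_pathQueue _ _ _ _ K j)

namespace IsEnvironment

variable (h : S.IsEnvironment lam Pr ℱ a γ)

include h

lemma integral_inflow [IsProbabilityMeasure Pr] (k : ℕ) :
    ∫ ω, S.inflow (a k ω) ∂Pr = S.target lam := by
  have hmeas : Measurable fun ω => S.inflow (a k ω) :=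
    S.measurable_inflow.comp (measurable_fst.comp (h.measurable k))
  have hint : ∀ j, Integrable (fun ω => S.inflow (a k ω) j) Pr := fun j =>
    Integrable.of_bound ((by fun_prop : Measurable fun x : QueueSpace nR nN => x j).comp
      hmeas).aestronglyMeasurable _
      (ae_of_all _ fun ω => S.abs_inflow_le (h.arrival_mem k ω) j)
  ext j
  rw [eval_integral_piLp hint]
  rcases j with _ | i | i
  · simp
  · simp only [inflow_inl, target_inl]
    rw [integral_mul_const, h.integral_arrival, Sum.elim_inl]
  · simp only [inflow_inr, target_inr]
    rw [integral_const_mul, h.integral_arrival, Sum.elim_inr]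

lemma ae_arrival_eq_zero [IsFiniteMeasure Pr] {i : Fin nN} (hi : lam i = 0) :
    ∀ᵐ ω ∂Pr, ∀ k, a k ω (.inr i) = 0 := by
  refine ae_all_iff.2 fun k => ?_
  have hnull : Pr {ω | a k ω (.inr i) = 1} = 0 := by
    rw [← measureReal_eq_zero_iff, h.rate_NRT, hi]
  filter_upwards [measure_eq_zero_iff_ae_notMem.1 hnull] with ω hω
  exact (h.arrival k ω _).resolve_right hω

lemma ae_queue_eq_zero [IsFiniteMeasure Pr]
    (hall : ∀ k ω, S.IsSlotAllocation (γ k ω) (μ k ω) (P k ω)) :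
    ∀ᵐ ω ∂Pr, ∀ i, lam i = 0 → ∀ k, S.randomQueue a γ μ P k ω (some (.inr i)) = 0 := by
  refine ae_all_iff.2 fun i => Filter.eventually_imp_distrib_left.2 fun hi => ?_
  filter_upwards [h.ae_arrival_eq_zero hi] with ω hω k
  induction k with
  | zero => simp [randomQueue, pathQueue_zero]
  | succ k ih =>
    rw [randomQueue] at ih ⊢
    rw [pathQueue_succ, posVec_apply, PiLp.add_apply, ih, PiLp.sub_apply, inflow_inr, hω k,
      outcome_inr]
    simpa using (hall k ω).service_nonneg (.inr i)

end IsEnvironment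

namespace FollowsLambertStrict

variable (h : S.FollowsLambertStrict a γ μ P)

include h

lemma isSlotAllocation (k : ℕ) (ω : Ω) : S.IsSlotAllocation (γ k ω) (μ k ω) (P k ω) :=
  (h k ω).isSlotAllocation (randomQueue_nonneg (a := a) (γ := γ) k ω none)
    fun i => randomQueue_nonneg k ω (some (.inr i))

lemma inner_le (k : ℕ) (ω : Ω) {o : QueueSpace nR nN} (ho : o ∈ S.outcomes (γ k ω)) :
    inner ℝ (S.randomQueue a γ μ P k ω) o ≤
      inner ℝ (S.randomQueue a γ μ P k ω) (S.outcome (γ k ω) (μ k ω) (P k ω)) :=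
  (h k ω).inner_le (randomQueue_nonneg (a := a) (γ := γ) k ω none)
    (fun i => randomQueue_nonneg k ω (some (.inr i))) ho

variable [IsProbabilityMeasure Pr] (henv : S.IsEnvironment lam Pr ℱ a γ) (hc : IsCausal ℱ μ P)

include henv hc

lemma exists_isMaxWeight :
    ∃ C : ℝ, IsMaxWeight Pr S.outcomes S.prob (S.target lam) C
      (S.randomQueue a γ μ P) (fun k ω => S.inflow (a k ω))
      (fun k ω => S.outcome (γ k ω) (μ k ω) (P k ω)) γ := by
  obtain ⟨C, hout, hin⟩ := S.exists_norm_bound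
  have hmeas : ∀ k, Measurable[ℱ k] (S.randomQueue a γ μ P k) :=
    measurable_randomQueue ℱ.mono' (fun k => measurable_fst.comp (henv.meas k))
      (fun k => measurable_snd.comp (henv.meas k)) (fun k => (hc k).1) fun k => (hc k).2
  exact ⟨C,
    { zero := fun ω => S.pathQueue_zero _ _ _ _
      succ := fun k ω => S.pathQueue_succ _ _ _ _ k
      measurable := fun k => (hmeas k).mono (ℱ.le k) le_rfl
      measurable_arrival := fun k =>
        S.measurable_inflow.comp (measurable_fst.comp (henv.measurable k))
      measurable_state := henv.measurable_state
      indep := fun k => (henv.indepFun_past (hmeas k)).comp measurable_id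
        (S.measurable_inflow.prodMap measurable_id)
      mean_arrival := henv.integral_inflow
      prob_state := henv.state
      nonempty := S.outcomes_nonempty
      bound := hout
      bound_arrival := fun k ω => hin _ (henv.arrival_mem k ω)
      mem := fun k ω => ⟨_, _, h.isSlotAllocation k ω, rfl⟩
      optimal := fun k ω _ ho => h.inner_le k ω ho }⟩

variable {ε : ℝ} (hε : 0 < ε) (hmem : (1 + ε) • lam ∈ S.lambertRegion)

include hε hmem

lemma ae_tendsto_inflow_sub_queue (j : Option (User nR nN)) :
    ∀ᵐ ω ∂Pr, Tendsto (fun K : ℕ => (∑ k ∈ Finset.range K, S.inflow (a k ω) j) / K -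
      S.randomQueue a γ μ P K ω j / K) atTop (𝓝 (S.target lam j)) := by
  obtain ⟨C, hMW⟩ := h.exists_isMaxWeight henv hc
  filter_upwards [henv.ae_tendsto_average_inflow j, hMW.ae_tendsto_div fun v hv =>
    sub_nonneg.1 (S.slack_nonneg_of_smul_mem hε hmem hv)] with ω hinflow hqueue
  simpa using hinflow.sub (hqueue j)

lemma exists_integral_queue_le {i : Fin nN} (hi : lam i ≠ 0) :
    ∃ B : ℝ, ∀ k, ∫⁻ ω, ENNReal.ofReal (S.randomQueue a γ μ P k ω (some (.inr i))) ∂Pr ≤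
      ENNReal.ofReal B := by
  obtain ⟨C, hMW⟩ := h.exists_isMaxWeight henv hc
  set T := tightCone S.prob S.outcomes (S.target lam)
  have h0 : 0 ∈ T := zero_mem_tightCone S.outcomes_nonempty
  obtain ⟨κ, hκ, hslack⟩ :=
    S.exists_mul_infDist_tightCone_le_slack hε hmem (Function.ne_iff.2 ⟨i, hi⟩)
  obtain ⟨B, hB⟩ := hMW.exists_integral_infDist_le
    (isClosed_tightCone S.outcomes_nonempty hMW.bound)
    (convex_tightCone S.prob_nonneg S.outcomes_nonempty hMW.bound) h0 subset_rfl hκ fun k => by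
      filter_upwards [henv.ae_queue_eq_zero h.isSlotAllocation] with ω hω
      exact hslack _ (hMW.nonneg k ω) fun i' hi' => hω i' hi' k
  have hcoord : ∀ w : QueueSpace nR nN, w (some (.inr i)) ≤ Metric.infDist w T := fun w => by
    refine (Metric.le_infDist ⟨0, h0⟩).2 fun y hy => ?_
    rw [dist_eq_norm]
    calc w (some (.inr i)) = (w - y) (some (.inr i)) := by
          rw [PiLp.sub_apply, S.eq_zero_of_mem_tightCone hε hmem hy hi, sub_zero]
      _ ≤ ‖w - y‖ := (Real.le_norm_self _).trans (PiLp.norm_apply_le _ _)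
  refine ⟨B, fun k => ?_⟩
  calc ∫⁻ ω, ENNReal.ofReal (S.randomQueue a γ μ P k ω (some (.inr i))) ∂Pr
      ≤ ∫⁻ ω, ENNReal.ofReal (Metric.infDist (S.randomQueue a γ μ P k ω) T) ∂Pr :=
        lintegral_mono fun ω => ENNReal.ofReal_le_ofReal (hcoord _)
    _ = ENNReal.ofReal (∫ ω, Metric.infDist (S.randomQueue a γ μ P k ω) T ∂Pr) :=
        (ofReal_integral_eq_lintegral_ofReal (hMW.integrable_infDist h0 k)
          (ae_of_all _ fun _ => Metric.infDist_nonneg)).symm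
    _ ≤ ENNReal.ofReal B := ENNReal.ofReal_le_ofReal (hB k)

lemma limsup_lintegral_queue_lt_top (i : Fin nN) :
    limsup (fun k : ℕ => ∫⁻ ω, ENNReal.ofReal
      (S.randomQueue a γ μ P k ω (some (.inr i))) ∂Pr) atTop < ⊤ := by
  by_cases hi : lam i = 0
  · have hzero : ∀ k, ∫⁻ ω, ENNReal.ofReal
        (S.randomQueue a γ μ P k ω (some (.inr i))) ∂Pr = 0 := fun k =>
      lintegral_eq_zero_of_ae_eq_zero <| by
        filter_upwards [henv.ae_queue_eq_zero h.isSlotAllocation] with ω hω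
        simp [hω i hi k]
    simp [hzero]
  · obtain ⟨B, hB⟩ := h.exists_integral_queue_le henv hc hε hmem hi
    exact (limsup_le_of_le (by isBoundedDefault) (.of_forall hB)).trans_lt ENNReal.ofReal_lt_top

lemma ae_le_liminf_delivery (i : Fin nR) :
    ∀ᵐ ω ∂Pr, S.q i * S.rateR i ≤ liminf (fun K : ℕ =>
      (∑ k ∈ Finset.range K, μ k ω (.inl i) * rate (P k ω (.inl i)) (γ k ω (.inl i))) /
        (S.L * K)) atTop := by
  filter_upwards [h.ae_tendsto_inflow_sub_queue henv hc hε hmem (some (.inl i))] with ω hlim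
  simp only [average_service_eq fun k => h.isSlotAllocation k ω]
  rw [target_inl, mul_comm] at hlim
  exact le_liminf_of_tendsto
    (abs_average_le fun k => (h.isSlotAllocation k ω).abs_outcome_le _) hlim
    (.of_forall fun K => sum_average_inflow_sub_le ω K _)

lemma ae_limsup_power_le :
    ∀ᵐ ω ∂Pr, limsup (fun K : ℕ =>
      (∑ k ∈ Finset.range K, ∑ i, P k ω i * μ k ω i) / (K * S.Ts)) atTop ≤ S.Pavg := by
  filter_upwards [h.ae_tendsto_inflow_sub_queue henv hc hε hmem none] with ω hlim
  simp only [S.average_power_eq fun k => γ k ω]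
  have hlim' := hlim.neg
  rw [target_none, neg_neg] at hlim'
  refine limsup_le_of_tendsto (B := S.outcomeBound) (fun K => ?_) hlim'
    (.of_forall fun K => neg_le_neg (sum_average_inflow_sub_le ω K _))
  rw [abs_neg]
  exact abs_average_le (fun k => (h.isSlotAllocation k ω).abs_outcome_le none) K

lemma meetsConstraints : S.MeetsConstraints Pr a γ μ P where
  allocation := h.isSlotAllocation
  full_slot k ω := (h k ω).sum_time
  stable := h.limsup_lintegral_queue_lt_top henv hc hε hmem
  delivery := h.ae_le_liminf_delivery henv hc hε hmem
  avg_power := h.ae_limsup_power_le henv hc hε hmem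

end FollowsLambertStrict

end System

/-! ### Converse -/

lemma tendsto_div_natCast_of_limsup_lt_top {x : ℕ → ENNReal} (hx : limsup x atTop < ⊤) :
    Tendsto (fun K : ℕ => x K / K) atTop (𝓝 0) := by
  obtain ⟨B, hxB, hB⟩ := exists_between hx
  have hlim : Tendsto (fun K : ℕ => B / (K : ENNReal)) atTop (𝓝 0) := by
    simpa [div_eq_mul_inv] using
      ENNReal.Tendsto.const_mul ENNReal.tendsto_inv_nat_nhds_zero (Or.inr hB.ne) (a := B)
  refine tendsto_of_tendsto_of_tendsto_of_le_of_le' tendsto_const_nhds hlim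
    (.of_forall fun _ => zero_le) ?_
  filter_upwards [eventually_lt_of_limsup_lt hxB] with K hK
  gcongr

lemma ae_liminf_eq_zero_of_tendsto_lintegral {Ω : Type*} {mΩ : MeasurableSpace Ω} {Pr : Measure Ω}
    {f : ℕ → Ω → ENNReal} (hf : ∀ k, Measurable (f k))
    (hlim : Tendsto (fun k => ∫⁻ ω, f k ω ∂Pr) atTop (𝓝 0)) :
    ∀ᵐ ω ∂Pr, liminf (fun k => f k ω) atTop = 0 := by
  have hFatou := lintegral_liminf_le (μ := Pr) (u := atTop) hf
  rw [hlim.liminf_eq, nonpos_iff_eq_zero] at hFatou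
  exact (lintegral_eq_zero_iff (.liminf hf)).1 hFatou

lemma ae_frequently_div_natCast_le {Ω ι : Type*} [Finite ι] {mΩ : MeasurableSpace Ω}
    {Pr : Measure Ω} {f : ℕ → ι → Ω → ℝ} (hf : ∀ k i, Measurable (f k i))
    (hbdd : ∀ i, limsup (fun k => ∫⁻ ω, ENNReal.ofReal (f k i ω) ∂Pr) atTop < ⊤) :
    ∀ᵐ ω ∂Pr, ∀ e : ℝ, 0 < e → ∃ᶠ K : ℕ in atTop, ∀ i, f K i ω / K ≤ e := by
  cases nonempty_fintype ι
  set F : ℕ → Ω → ENNReal := fun K ω => ∑ i, ENNReal.ofReal (f K i ω) / K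
  have hterm : ∀ K i, Measurable fun ω => ENNReal.ofReal (f K i ω) / (K : ENNReal) := fun K i =>
    (hf K i).ennreal_ofReal.div_const _
  have hlim : Tendsto (fun K => ∫⁻ ω, F K ω ∂Pr) atTop (𝓝 0) := by
    have hsum : ∀ K, ∫⁻ ω, F K ω ∂Pr =
        ∑ i, (∫⁻ ω, ENNReal.ofReal (f K i ω) ∂Pr) / K := fun K => by
      simp only [F]
      rw [lintegral_finsetSum _ fun i _ => hterm K i]
      simp only [div_eq_mul_inv]
      exact Finset.sum_congr rfl fun i _ => lintegral_mul_const _ (hf K i).ennreal_ofReal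
    simp only [hsum]
    simpa using tendsto_finsetSum Finset.univ fun i _ =>
      tendsto_div_natCast_of_limsup_lt_top (hbdd i)
  filter_upwards [ae_liminf_eq_zero_of_tendsto_lintegral
    (fun K => Finset.measurable_sum _ fun i _ => hterm K i) hlim] with ω hω e he
  have hlt : liminf (fun K => F K ω) atTop < ENNReal.ofReal e := by simpa [F, hω] using he
  refine ((frequently_lt_of_liminf_lt (by isBoundedDefault) hlt).and_eventually
    (eventually_gt_atTop 0)).mono fun K ⟨hK, hKpos⟩ i => ?_
  refine (ENNReal.ofReal_le_ofReal_iff he.le).1 ?_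
  rw [ENNReal.ofReal_div_of_pos (Nat.cast_pos.2 hKpos), ENNReal.ofReal_natCast]
  exact (Finset.single_le_sum (f := fun i => ENNReal.ofReal (f K i ω) / (K : ENNReal))
    (fun _ _ => zero_le) (Finset.mem_univ i)).trans hK.le

namespace System

variable {nR nN : ℕ} {S : System nR nN}

namespace MeetsConstraints

variable {Ω : Type*} {mΩ : MeasurableSpace Ω} {Pr : Measure Ω} {ℱ : Filtration ℕ mΩ}
  {a : ℕ → Ω → User nR nN → ℝ} {γ : ℕ → Ω → S.State} {lam : Fin nN → ℝ}
  {μ P : ℕ → Ω → User nR nN → ℝ} (h : S.MeetsConstraints Pr a γ μ P)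

include h

lemma ae_eventually_le_average_outcome_inl (i : Fin nR) :
    ∀ᵐ ω ∂Pr, ∀ e : ℝ, 0 < e → ∀ᶠ K : ℕ in atTop, S.target lam (some (.inl i)) - e ≤
      (∑ k ∈ Finset.range K, S.outcome (γ k ω) (μ k ω) (P k ω) (some (.inl i))) / K := by
  filter_upwards [h.delivery i] with ω hω e he
  simp only [average_service_eq fun k => h.allocation k ω] at hω
  rw [target_inl, mul_comm]
  exact eventually_sub_le_of_le_liminf
    (abs_average_le fun k => (h.allocation k ω).abs_outcome_le _) hω he

lemma ae_eventually_le_average_outcome_none :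
    ∀ᵐ ω ∂Pr, ∀ e : ℝ, 0 < e → ∀ᶠ K : ℕ in atTop, S.target lam none - e ≤
      (∑ k ∈ Finset.range K, S.outcome (γ k ω) (μ k ω) (P k ω) none) / K := by
  filter_upwards [h.avg_power] with ω hω e he
  simp only [S.average_power_eq fun k => γ k ω] at hω
  have habs : ∀ K : ℕ, |-((∑ k ∈ Finset.range K, S.outcome (γ k ω) (μ k ω) (P k ω) none) / K)| ≤
      S.outcomeBound := fun K => by
    rw [abs_neg]
    exact abs_average_le (fun k => (h.allocation k ω).abs_outcome_le none) K
  filter_upwards [eventually_le_add_of_limsup_le habs hω he] with K hK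
  rw [target_none]
  linarith

variable (henv : S.IsEnvironment lam Pr ℱ a γ)
  (hm : ∀ k, Measurable (μ k) ∧ Measurable (P k))

include henv hm

lemma ae_frequently_queue_div_le :
    ∀ᵐ ω ∂Pr, ∀ e : ℝ, 0 < e → ∃ᶠ K : ℕ in atTop, ∀ i : Fin nN,
      S.randomQueue a γ μ P K ω (some (.inr i)) / K ≤ e := by
  have hmeas : ∀ k, Measurable (S.randomQueue a γ μ P k) :=
    measurable_randomQueue monotone_const (fun k => measurable_fst.comp (henv.measurable k))
      henv.measurable_state (fun k => (hm k).1) fun k => (hm k).2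
  exact ae_frequently_div_natCast_le (fun k i => (by fun_prop : Measurable
    fun x : QueueSpace nR nN => x (some (.inr i))).comp (hmeas k)) h.stable

variable [IsProbabilityMeasure Pr]

lemma ae_frequently_le_average_outcome_inr :
    ∀ᵐ ω ∂Pr, ∀ e : ℝ, 0 < e → ∃ᶠ K : ℕ in atTop, ∀ i : Fin nN,
      S.target lam (some (.inr i)) - e ≤
        (∑ k ∈ Finset.range K, S.outcome (γ k ω) (μ k ω) (P k ω) (some (.inr i))) / K := by
  filter_upwards [h.ae_frequently_queue_div_le henv hm,
    ae_all_iff.2 henv.ae_tendsto_average_inflow] with ω hqueue hinflow e he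
  have hlower : ∀ᶠ K : ℕ in atTop, ∀ i : Fin nN, S.target lam (some (.inr i)) - e / 2 ≤
      (∑ k ∈ Finset.range K, S.inflow (a k ω) (some (.inr i))) / K :=
    eventually_all.2 fun i => (hinflow _).eventually_const_le (sub_lt_self _ (half_pos he))
  refine ((hqueue _ (half_pos he)).and_eventually hlower).mono fun K ⟨hq, hin⟩ i => ?_
  linarith [hq i, hin i, sum_average_inflow_sub_le (S := S) (a := a) (γ := γ) (μ := μ) (P := P)
    ω K (some (.inr i))]

lemma mem_lambertRegion : lam ∈ S.lambertRegion := by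
  refine S.mem_lambertRegion_iff.2 ⟨fun i => (henv.rate_mem i).1, fun v hv => ?_⟩
  obtain ⟨C, hC, -⟩ := S.exists_norm_bound
  obtain ⟨ω, hNRT, hRT, hpower, hstate⟩ :=
    ((h.ae_frequently_le_average_outcome_inr henv hm).and
      ((ae_all_iff.2 h.ae_eventually_le_average_outcome_inl).and
        (h.ae_eventually_le_average_outcome_none.and
          (henv.ae_tendsto_average_state fun m => support (S.outcomes m) v)))).exists
  refine inner_le_of_frequently_le_average hv
    (fun k => inner_le_support (hC (γ k ω)) v ⟨_, _, h.allocation k ω, rfl⟩) hstate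
    fun e he => ?_
  refine ((hNRT e he).and_eventually
    ((eventually_all.2 fun i => hRT i e he).and (hpower e he))).mono ?_
  rintro K ⟨hN, hR, hP⟩ (_ | i | i)
  exacts [hP, hR i, hN i]

end MeetsConstraints

end System

/-! ### Independent slots and the capacity region -/

/-- The information in the first `k` terms of a sequence, without the term of index `k`. -/
def prefixFiltration (X : Type*) [MeasurableSpace X] :
    Filtration ℕ (inferInstance : MeasurableSpace (ℕ → X)) where
  seq k := MeasurableSpace.comap (fun (ω : ℕ → X) (l : Finset.range k) => ω l) inferInstance
  mono' k l hkl := by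
    have hrestrict : Measurable fun (x : Finset.range l → X) (i : Finset.range k) =>
        x ⟨i, Finset.mem_range.2 ((Finset.mem_range.1 i.2).trans_le hkl)⟩ :=
      measurable_pi_lambda _ fun i => measurable_pi_apply _
    exact (hrestrict.comp
      (comap_measurable fun (ω : ℕ → X) (i : Finset.range l) => ω i)).comap_le
  le' k := Measurable.comap_le (measurable_pi_lambda _ fun i => measurable_pi_apply _)

section InfinitePi

variable {X : Type*} [MeasurableSpace X]

lemma measurable_eval_prefixFiltration (k : ℕ) :
    Measurable[prefixFiltration X (k + 1)] fun ω : ℕ → X => ω k :=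
  (measurable_pi_apply (⟨k, by simp⟩ : Finset.range (k + 1))).comp
    (comap_measurable fun (ω : ℕ → X) (l : Finset.range (k + 1)) => ω l)

variable (ν : Measure X) [IsProbabilityMeasure ν]

lemma infinitePi_real_eval {s : Set X} (hs : MeasurableSet s) (k : ℕ) :
    (Measure.infinitePi fun _ : ℕ => ν).real {ω | ω k ∈ s} = ν.real s :=
  (measurePreserving_eval_infinitePi (fun _ : ℕ => ν) k).measureReal_preimage hs.nullMeasurableSet

lemma indep_eval_prefixFiltration (k : ℕ) :
    Indep (MeasurableSpace.comap (fun ω : ℕ → X => ω k) inferInstance) (prefixFiltration X k)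
      (Measure.infinitePi fun _ : ℕ => ν) := by
  have hindep : iIndepFun (fun (k : ℕ) (ω : ℕ → X) => ω k) (Measure.infinitePi fun _ : ℕ => ν) :=
    iIndepFun_infinitePi (X := fun _ x => x) fun _ => measurable_id
  have hpast := hindep.indepFun_finset {k} (Finset.range k) (by simp) fun l => measurable_pi_apply l
  rw [IndepFun_iff_Indep] at hpast
  refine indep_of_indep_of_le_left hpast (Measurable.comap_le ?_)
  exact (measurable_pi_apply (⟨k, by simp⟩ : ({k} : Finset ℕ))).comp
    (comap_measurable fun (ω : ℕ → X) (l : ({k} : Finset ℕ)) => ω l)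

end InfinitePi

namespace System

variable {nR nN : ℕ} (S : System nR nN)

/-- The distribution of the fading state. -/
def stateMeasure : Measure S.State := ∑ m, ENNReal.ofReal (S.prob m) • Measure.dirac m

instance : IsProbabilityMeasure S.stateMeasure := by
  refine ⟨?_⟩
  rw [stateMeasure, Measure.finsetSum_apply]
  simp only [Measure.smul_apply, measure_univ, smul_eq_mul, mul_one]
  rw [← ENNReal.ofReal_sum_of_nonneg fun m _ => S.prob_nonneg m, S.prob_sum, ENNReal.ofReal_one]

lemma stateMeasure_real_singleton (m : S.State) : S.stateMeasure.real {m} = S.prob m := by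
  classical
  rw [Measure.real, stateMeasure, Measure.finsetSum_apply]
  simp only [Measure.smul_apply, Measure.dirac_apply, Set.indicator_apply, Set.mem_singleton_iff,
    smul_eq_mul, Pi.one_apply, mul_ite, mul_one, mul_zero]
  rw [Finset.sum_ite_eq' Finset.univ m]
  simp [ENNReal.toReal_ofReal (S.prob_nonneg m)]

/-- The randomness of one slot: a uniform variable, from which all arrival indicators are drawn,
and the fading state. -/
abbrev Slot : Type := unitInterval × S.State

/-- The distribution of one slot. -/
def slotMeasure : Measure S.Slot := (volume : Measure unitInterval).prod S.stateMeasure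

instance : IsProbabilityMeasure S.slotMeasure :=
  inferInstanceAs (IsProbabilityMeasure (Measure.prod _ _))

open Classical in
/-- Arrival indicators with given rates, as functions of the uniform variable of a slot. -/
def slotArrival (lam : Fin nN → ℝ) (x : S.Slot) (i : User nR nN) : ℝ :=
  if (x.1 : ℝ) ≤ Sum.elim S.rateR lam i then 1 else 0

lemma measurable_slotArrival (lam : Fin nN → ℝ) : Measurable (S.slotArrival lam) :=
  measurable_pi_lambda _ fun _ => Measurable.ite
    (measurableSet_le (measurable_subtype_coe.comp measurable_fst) measurable_const)
    measurable_const measurable_const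

lemma measurableSet_slotArrival (lam : Fin nN → ℝ) (i : User nR nN) :
    MeasurableSet {x | S.slotArrival lam x i = 1} :=
  ((measurable_pi_apply i).comp (S.measurable_slotArrival lam)) (measurableSet_singleton 1)

lemma slotMeasure_real_arrival {lam : Fin nN → ℝ} (hlam : ∀ i, lam i ∈ Set.Icc (0 : ℝ) 1)
    (i : User nR nN) :
    S.slotMeasure.real {x | S.slotArrival lam x i = 1} = Sum.elim S.rateR lam i := by
  have hrate : Sum.elim S.rateR lam i ∈ Set.Icc (0 : ℝ) 1 := by
    rcases i with i | i
    exacts [S.rateR_mem i, hlam i]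
  have hset : {x : S.Slot | S.slotArrival lam x i = 1} =
      Set.Iic (⟨_, hrate⟩ : unitInterval) ×ˢ Set.univ := by
    ext x
    simp [slotArrival, ← Subtype.coe_le_coe]
  rw [hset, slotMeasure, measureReal_prod_prod]
  simp [Measure.real, unitInterval.volume_Iic, hrate.1]

lemma slotMeasure_real_state (m : S.State) : S.slotMeasure.real {x | x.2 = m} = S.prob m := by
  have hset : {x : S.Slot | x.2 = m} = Set.univ ×ˢ {m} := by
    ext x
    simp
  rw [hset, slotMeasure, measureReal_prod_prod, S.stateMeasure_real_singleton]
  simp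

lemma isEnvironment_infinitePi {lam : Fin nN → ℝ} (hlam : ∀ i, lam i ∈ Set.Icc (0 : ℝ) 1) :
    S.IsEnvironment lam (Measure.infinitePi fun _ : ℕ => S.slotMeasure) (prefixFiltration S.Slot)
      (fun k ω => S.slotArrival lam (ω k)) (fun k ω => (ω k).2) where
  arrival k ω i := by
    by_cases h : ((ω k).1 : ℝ) ≤ Sum.elim S.rateR lam i <;> simp [slotArrival, h]
  meas k := ((S.measurable_slotArrival lam).prodMk measurable_snd).comp
    (measurable_eval_prefixFiltration k)
  indep k := indep_of_indep_of_le_left (indep_eval_prefixFiltration S.slotMeasure k)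
    (((S.measurable_slotArrival lam).prodMk measurable_snd).comp (comap_measurable _)).comap_le
  rate_RT k i := (infinitePi_real_eval S.slotMeasure (S.measurableSet_slotArrival lam _) k).trans
    (S.slotMeasure_real_arrival hlam (.inl i))
  rate_NRT k i := (infinitePi_real_eval S.slotMeasure (S.measurableSet_slotArrival lam _) k).trans
    (S.slotMeasure_real_arrival hlam (.inr i))
  state k m := (infinitePi_real_eval S.slotMeasure
    (measurable_snd (measurableSet_singleton m)) k).trans (S.slotMeasure_real_state m)

lemma isAdmissible_of_smul_mem (hN : 0 < nN) {lam : Fin nN → ℝ}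
    (hlam : ∀ i, lam i ∈ Set.Icc (0 : ℝ) 1) {ε : ℝ} (hε : 0 < ε)
    (hmem : (1 + ε) • lam ∈ S.lambertRegion) : S.IsAdmissible lam := by
  have henv := S.isEnvironment_infinitePi hlam
  obtain ⟨μ, P, hc, hf⟩ := henv.exists_policy hN
  exact ⟨_, _, _, _, _, _, μ, P, inferInstance, henv, hc, hf.meetsConstraints henv hc hε hmem⟩

variable {S} in
lemma IsAdmissible.mem_lambertRegion_inter_Icc {lam : Fin nN → ℝ} (h : S.IsAdmissible lam) :
    lam ∈ S.lambertRegion ∩ Set.Icc 0 1 := by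
  obtain ⟨Ω, mΩ, Pr, ℱ, a, γ, μ, P, hPr, henv, hc, hm⟩ := h
  exact ⟨hm.mem_lambertRegion henv fun k =>
    ⟨(hc k).1.mono (ℱ.le _) le_rfl, (hc k).2.mono (ℱ.le _) le_rfl⟩,
    fun i => (henv.rate_mem i).1, fun i => (henv.rate_mem i).2⟩

lemma closure_isAdmissible (hN : 0 < nN) :
    closure {lam : Fin nN → ℝ | S.IsAdmissible lam} = S.lambertRegion ∩ Set.Icc 0 1 := by
  refine Set.Subset.antisymm (closure_minimal (fun lam h => h.mem_lambertRegion_inter_Icc)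
    (S.isClosed_lambertRegion.inter isClosed_Icc)) ?_
  rintro lam ⟨hmem, h0, h1⟩
  have hlim : Tendsto (fun ε : ℝ => (1 + ε)⁻¹ • lam) (𝓝[>] 0) (𝓝 lam) := by
    have hcont : ContinuousAt (fun ε : ℝ => (1 + ε)⁻¹ • lam) 0 := by fun_prop (disch := norm_num)
    simpa using hcont.tendsto.mono_left nhdsWithin_le_nhds
  refine mem_closure_of_tendsto hlim (eventually_mem_nhdsWithin.mono fun ε (hε : 0 < ε) => ?_)
  have hinv : 0 ≤ (1 + ε)⁻¹ := by positivity
  refine S.isAdmissible_of_smul_mem hN (fun i => ⟨mul_nonneg hinv (h0 i), ?_⟩) hε ?_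
  · exact mul_le_one₀ (inv_le_one_of_one_le₀ (by linarith)) (h0 i) (h1 i)
  · rwa [smul_smul, mul_inv_cancel₀ (by positivity), one_smul]

end System

end Downlink

end

theorem mainTheorem2 {nR nN : ℕ} (hN : 0 < nN) (S : Downlink.System nR nN) :
    (∀ (Ω : Type*) (mΩ : MeasurableSpace Ω) (Pr : Measure Ω) (_ : IsProbabilityMeasure Pr)
      (ℱ : Filtration ℕ mΩ) (a : ℕ → Ω → Downlink.User nR nN → ℝ) (γ : ℕ → Ω → S.State)
      (lam : Fin nN → ℝ), S.IsEnvironment lam Pr ℱ a γ →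
      -- the algorithm can be run
      (∃ μ P : ℕ → Ω → Downlink.User nR nN → ℝ,
        Downlink.System.IsCausal ℱ μ P ∧ S.FollowsLambertStrict a γ μ P) ∧
      -- achievability
      ((∃ ε : ℝ, 0 < ε ∧ (1 + ε) • lam ∈ S.lambertRegion) →
        ∀ μ P : ℕ → Ω → Downlink.User nR nN → ℝ,
          Downlink.System.IsCausal ℱ μ P → S.FollowsLambertStrict a γ μ P →
          S.MeetsConstraints Pr a γ μ P) ∧
      -- converse, also for policies that know the future
      (lam ∉ S.lambertRegion →
        ¬ ∃ μ P : ℕ → Ω → Downlink.User nR nN → ℝ,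
          (∀ k, Measurable (μ k) ∧ Measurable (P k)) ∧ S.MeetsConstraints Pr a γ μ P)) ∧
    -- the capacity region
    closure {lam : Fin nN → ℝ | S.IsAdmissible lam} = S.lambertRegion ∩ Set.Icc 0 1 := by
  refine ⟨fun Ω mΩ Pr _ ℱ a γ lam henv => ⟨henv.exists_policy hN, ?_, ?_⟩,
    S.closure_isAdmissible hN⟩
  · rintro ⟨ε, hε, hmem⟩ μ P hc hf
    exact hf.meetsConstraints henv hc hε hmem
  · rintro hnot ⟨μ, P, hm, hmeets⟩
    exact hnot (hmeets.mem_lambertRegion henv hm)
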